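/- Manifolds are smooth, Hausdorff and finite-dimensional, and $M$ has positive dimension. **Definitions.** A *complex structure* on a manifold is a smooth endomorphism field $J$ of the tangent bundle with $J^2=-\mathrm{Id}$ which admits local holomorphic coordinates around each point. A *para-complex structure* is a smooth endomorphism field $J\neq \mathrm{Id}$ with $J^2=\mathrm{Id}$ whose eigendistributions $\ker(\mathrm{Id}\mp J)$ have the same rank and are both integrable (through each point there passes an integral manifold). A *para-hyper-Kähler structure* $(J_1,J_2,J_3,g)$ consists of three pairwise anticommuting endomorphism fields $J_1,J_2,J_3=J_1J_2$, two of which are para-complex structures and one of which is a complex structure, and a pseudo-Riemannian metric $g$ for which all $J_\alpha$ are skew-symmetric and the three two-forms $g(J_\alpha\cdot,\cdot)$ are closed. A *special (pseudo-)Kähler manifold* $(M,J,g,\nabla)$ is a manifold $M$ with a complex structure $J$, a pseudo-Riemannian metric $g$ (of any signature) for which $J$ is skew-symmetric and the Kähler form $\omega=g(J\cdot,\cdot)$ is closed, and a smooth flat torsion-free connection $\nabla$ on $TM$ with $\nabla\omega=0$ and $(\nabla_XJ)Y=(\nabla_YJ)X$ for all vector fields $X,Y$. **Theorem.** Let $(M,J,g,\nabla)$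 be a special (pseudo-)Kähler manifold with Kähler form $\omega$, and let $\pi:N=T^*M\to M$ be its cotangent bundle. For $\xi\in N$ and $p=\pi(\xi)$ identify $$T_\xi N=\mathcal H^\nabla_\xi\oplus \ker d\pi_\xi\cong T_pM\oplus T_p^*M ,$$ where $\mathcal H^\nabla_\xi$ is the horizontal space of the connection induced by $\nabla$ on $T^*M$, identified with $T_pM$ by $d\pi_\xi$, and $\ker d\pi_\xi=T_\xi(T^*_pM)\cong T_p^*M$ canonically. With respect to this identification put $$J_1=J^\nabla=\begin{pmatrix}J&0\\0&J^*\end{pmatrix},\quad J_2=J^\omega=\begin{pmatrix}0&\omega^{-1}\\ \omega&0\end{pmatrix},\quad J_3=J_1J_2,\quad g_N=\begin{pmatrix}g&0\\0&-g^{-1}\end{pmatrix},$$ where $J^*\alpha=\alpha\circ J$, $\omega:T_pM\to T_p^*M$ is the map $v\mapsto\omega(v,\cdot)$, and $g^{-1}$ is the metric on $T^*_pM$ induced by $g$. Then $(J_1,J_2,J_3,g_N)$ is a para-hyper-Kähler structure on $N$; $J_1$ is a complex structure, and $J_2$, $J_3$ are para-complex structures. Moreover, $J_1=J_N$ is the canonical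 complex structure of the cotangent bundle of $(M,J)$, that is, the unique endomorphism field of $TN$ such that for all local holomorphic coordinates $z$ of $(M,J)$ the induced local coordinates $(z,w)$ of $T^*M$ are holomorphic, where the complex structure of the fibre coordinates $w$ is the one given by $\alpha\mapsto\alpha\circ J$ on $T^*_pM$. -/

import Mathlib

open Bundle
open scoped Manifold ContDiff

noncomputable section

/-! ## Tensor fields on a manifold -/

section General

variable {E : Type*} [NormedAddCommGroup E] [NormedSpace ℝ E]
  {H : Type*} [TopologicalSpace H] (I : ModelWithCorners ℝ E H)
  (M : Type*) [TopologicalSpace M] [ChartedSpace H M]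

/-- Fields of endomorphisms of the tangent spaces (no regularity). -/
abbrev EndField := ∀ x : M, TangentSpace I x →L[ℝ] TangentSpace I x

/-- Fields of bilinear forms on the tangent spaces (no regularity). -/
abbrev BilinField := ∀ x : M, TangentSpace I x →L[ℝ] TangentSpace I x →L[ℝ] ℝ

variable {I M}

/-- Smoothness of an endomorphism field, as a section of `Hom(TM, TM)`. -/
def EndField.IsSmooth [IsManifold I ∞ M] (J : EndField I M) : Prop :=
  ContMDiff I (I.prod 𝓘(ℝ, E →L[ℝ] E)) ∞
    (fun x ↦ TotalSpace.mk' (E →L[ℝ] E) (E := fun x : M ↦ TangentSpace I x →L[ℝ] TangentSpace I x)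
      x (J x))

/-- Smoothness of a field of bilinear forms, as a section of `Hom(TM, Hom(TM, ℝ))`. -/
def BilinField.IsSmooth [IsManifold I ∞ M] (b : BilinField I M) : Prop :=
  ContMDiff I (I.prod 𝓘(ℝ, E →L[ℝ] E →L[ℝ] ℝ)) ∞
    (fun x ↦ TotalSpace.mk' (E →L[ℝ] E →L[ℝ] ℝ)
      (E := fun x : M ↦ TangentSpace I x →L[ℝ] TangentSpace I x →L[ℝ] ℝ) x (b x))

/-- A pseudo-Riemannian metric: smooth, symmetric and nondegenerate, of arbitrary signature. -/
structure IsPseudoRiemannian [IsManifold I ∞ M] (g : BilinField I M) : Prop where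
  smooth : g.IsSmooth
  symm : ∀ x v w, g x v w = g x w v
  nondegenerate : ∀ x v, (∀ w, g x v w = 0) → v = 0

/-- The endomorphism field `J` is skew-symmetric with respect to `g`. -/
def IsSkew (g : BilinField I M) (J : EndField I M) : Prop :=
  ∀ x v w, g x (J x v) w = - g x v (J x w)

/-- The fundamental two-form `g(J·, ·)`. -/
def fundamentalForm (g : BilinField I M) (J : EndField I M) : BilinField I M :=
  fun x ↦ g x ∘L J x

/-- Closedness of a field `Ω` of (skew-symmetric) bilinear forms: `dΩ = 0`, with `dΩ` given by
`dΩ(X,Y,Z) = X Ω(Y,Z) - Y Ω(X,Z) + Z Ω(X,Y) - Ω([X,Y],Z) + Ω([X,Z],Y) - Ω([Y,Z],X)`. -/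
def IsClosedForm [IsManifold I ∞ M] (Ω : BilinField I M) : Prop :=
  ∀ (x : M) (X Y Z : ∀ x : M, TangentSpace I x),
    MDiffAt (T% X) x → MDiffAt (T% Y) x → MDiffAt (T% Z) x →
    mvfderiv I (fun y ↦ Ω y (Y y) (Z y)) x (X x)
      - mvfderiv I (fun y ↦ Ω y (X y) (Z y)) x (Y x)
      + mvfderiv I (fun y ↦ Ω y (X y) (Y y)) x (Z x)
      - Ω x (VectorField.mlieBracket I X Y x) (Z x)
      + Ω x (VectorField.mlieBracket I X Z x) (Y x)
      - Ω x (VectorField.mlieBracket I Y Z x) (X x) = 0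

/-! ## Complex structures -/

/-- An almost complex structure: a smooth endomorphism field with `J² = -1`. -/
structure IsAlmostComplex [IsManifold I ∞ M] (J : EndField I M) : Prop where
  smooth : J.IsSmooth
  sq : ∀ x v, J x (J x v) = - v

/-- `e` is a local holomorphic coordinate system for `J`: a diffeomorphism between open subsets of
`M` and of the model vector space `E`, whose differential intertwines `J` with a constant linear
complex structure `j` on `E` (so that `(E, j)` is a copy of `ℂⁿ`). -/
structure IsHolomorphicChart (J : EndField I M) (e : OpenPartialHomeomorph M E)
    (j : E →L[ℝ] E) : Prop where
  contMDiffOn : ContMDiffOn I 𝓘(ℝ, E) ∞ e e.source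
  contMDiffOn_symm : ContMDiffOn 𝓘(ℝ, E) I ∞ e.symm e.target
  sq : ∀ v, j (j v) = - v
  mfderiv_comp : ∀ x ∈ e.source, ∀ v : TangentSpace I x,
    mvfderiv I e x (J x v) = j (mvfderiv I e x v)

/-- A complex structure: an almost complex structure which admits local holomorphic coordinates
around each point. -/
structure IsComplexStructure [IsManifold I ∞ M] (J : EndField I M) : Prop
    extends IsAlmostComplex J where
  exists_chart : ∀ x : M, ∃ (e : OpenPartialHomeomorph M E) (j : E →L[ℝ] E),
    x ∈ e.source ∧ IsHolomorphicChart J e j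

/-! ## Para-complex structures -/

/-- A distribution is integrable if through each point there passes an integral manifold, i.e. an
immersed submanifold whose tangent space at each of its points is given by the distribution. -/
def IsIntegrableDistribution (D : ∀ x : M, Submodule ℝ (TangentSpace I x)) : Prop :=
  ∀ x : M, ∃ (k : ℕ) (U : Set (EuclideanSpace ℝ (Fin k))) (f : EuclideanSpace ℝ (Fin k) → M),
    IsOpen U ∧ 0 ∈ U ∧ f 0 = x ∧ ContMDiffOn 𝓘(ℝ, EuclideanSpace ℝ (Fin k)) I ∞ f U ∧
    ∀ u ∈ U, Function.Injective (mfderiv 𝓘(ℝ, EuclideanSpace ℝ (Fin k)) I f u) ∧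
      (mfderiv 𝓘(ℝ, EuclideanSpace ℝ (Fin k)) I f u).range = D (f u)

/-- The eigendistribution `ker (Id - J)`. -/
def plusDistribution (J : EndField I M) (x : M) : Submodule ℝ (TangentSpace I x) :=
  (ContinuousLinearMap.id ℝ (TangentSpace I x) - J x).ker

/-- The eigendistribution `ker (Id + J)`. -/
def minusDistribution (J : EndField I M) (x : M) : Submodule ℝ (TangentSpace I x) :=
  (ContinuousLinearMap.id ℝ (TangentSpace I x) + J x).ker

/-- An almost para-complex structure: a smooth involution `J ≠ Id` of the tangent bundle whose two
eigendistributions have the same rank. -/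
structure IsAlmostParaComplex [IsManifold I ∞ M] (J : EndField I M) : Prop where
  smooth : J.IsSmooth
  ne_id : ∀ x, J x ≠ ContinuousLinearMap.id ℝ (TangentSpace I x)
  sq : ∀ x v, J x (J x v) = v
  finrank_eq : ∀ x,
    Module.finrank ℝ (plusDistribution J x) = Module.finrank ℝ (minusDistribution J x)

/-- A para-complex structure: an almost para-complex structure with integrable
eigendistributions. -/
structure IsParaComplexStructure [IsManifold I ∞ M] (J : EndField I M) : Prop
    extends IsAlmostParaComplex J where
  integrable_plus : IsIntegrableDistribution (plusDistribution J)
  integrable_minus : IsIntegrableDistribution (minusDistribution J)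

/-! ## Para-hyper-Kähler structures -/

/-- A para-hypercomplex structure: three pairwise anticommuting structures `J₁, J₂, J₃ = J₁J₂`, two
of them para-complex and one of them complex. -/
structure IsParaHypercomplex [IsManifold I ∞ M] (J₁ J₂ J₃ : EndField I M) : Prop where
  eq_comp : ∀ x v, J₃ x v = J₁ x (J₂ x v)
  anticomm₁₂ : ∀ x v, J₁ x (J₂ x v) = - J₂ x (J₁ x v)
  anticomm₁₃ : ∀ x v, J₁ x (J₃ x v) = - J₃ x (J₁ x v)
  anticomm₂₃ : ∀ x v, J₂ x (J₃ x v) = - J₃ x (J₂ x v)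
  types : (IsComplexStructure J₁ ∧ IsParaComplexStructure J₂ ∧ IsParaComplexStructure J₃) ∨
    (IsParaComplexStructure J₁ ∧ IsComplexStructure J₂ ∧ IsParaComplexStructure J₃) ∨
    (IsParaComplexStructure J₁ ∧ IsParaComplexStructure J₂ ∧ IsComplexStructure J₃)

/-- A para-hyper-Hermitian structure: a para-hypercomplex structure together with a
pseudo-Riemannian metric for which the three endomorphism fields are skew-symmetric. -/
structure IsParaHyperHermitian [IsManifold I ∞ M] (J₁ J₂ J₃ : EndField I M)
    (g : BilinField I M) : Prop extends IsParaHypercomplex J₁ J₂ J₃ where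
  metric : IsPseudoRiemannian g
  skew₁ : IsSkew g J₁
  skew₂ : IsSkew g J₂
  skew₃ : IsSkew g J₃

/-- A para-hyper-Kähler structure: a para-hyper-Hermitian structure whose three fundamental
two-forms are closed. -/
structure IsParaHyperKahler [IsManifold I ∞ M] (J₁ J₂ J₃ : EndField I M)
    (g : BilinField I M) : Prop extends IsParaHyperHermitian J₁ J₂ J₃ g where
  closed₁ : IsClosedForm (fundamentalForm g J₁)
  closed₂ : IsClosedForm (fundamentalForm g J₂)
  closed₃ : IsClosedForm (fundamentalForm g J₃)

/-! ## Special (pseudo-)Kähler manifolds -/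

/-- A (pseudo-)Kähler manifold `(M, J, g)`. -/
structure IsPseudoKahler [IsManifold I ∞ M] (J : EndField I M) (g : BilinField I M) : Prop where
  complex : IsComplexStructure J
  metric : IsPseudoRiemannian g
  skew : IsSkew g J
  closed : IsClosedForm (fundamentalForm g J)

/-- The linear connection `D` is flat: `D_X D_Y Z - D_Y D_X Z - D_{[X,Y]} Z = 0` for all smooth
vector fields. Recall that `D Y x (X x)` is `(D_X Y)_x`. -/
def IsFlatConnection [IsManifold I ∞ M]
    (D : CovariantDerivative I E (TangentSpace I : M → Type _)) : Prop :=
  ∀ X Y Z : ∀ x : M, TangentSpace I x,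
    CMDiff ∞ (T% X) → CMDiff ∞ (T% Y) → CMDiff ∞ (T% Z) → ∀ x : M,
    D (fun y ↦ D Z y (Y y)) x (X x) - D (fun y ↦ D Z y (X y)) x (Y x)
      - D Z x (VectorField.mlieBracket I X Y x) = 0

/-- The bilinear form field `Ω` is parallel for the linear connection `D`. -/
def IsParallelForm [IsManifold I ∞ M]
    (D : CovariantDerivative I E (TangentSpace I : M → Type _))
    (Ω : BilinField I M) : Prop :=
  ∀ (x : M) (v : TangentSpace I x) (Y Z : ∀ x : M, TangentSpace I x),
    MDiffAt (T% Y) x → MDiffAt (T% Z) x →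
    mvfderiv I (fun y ↦ Ω y (Y y) (Z y)) x v = Ω x (D Y x v) (Z x) + Ω x (Y x) (D Z x v)

/-- `DJ` is symmetric: `(D_X J) Y = (D_Y J) X`, where `(D_X J) Y = D_X (J Y) - J (D_X Y)`. -/
def HasSymmetricDerivative [IsManifold I ∞ M]
    (D : CovariantDerivative I E (TangentSpace I : M → Type _))
    (J : EndField I M) : Prop :=
  ∀ (x : M) (X Y : ∀ x : M, TangentSpace I x), MDiffAt (T% X) x → MDiffAt (T% Y) x →
    D (fun y ↦ J y (Y y)) x (X x) - J x (D Y x (X x)) =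
      D (fun y ↦ J y (X y)) x (Y x) - J x (D X x (Y x))

/-- An (affine) special (pseudo-)Kähler manifold `(M, J, g, D)`: a (pseudo-)Kähler manifold with a
smooth flat torsion-free connection `D` such that `Dω = 0` and `DJ` is symmetric. -/
structure IsSpecialPseudoKahler [IsManifold I ∞ M] [FiniteDimensional ℝ E]
    (J : EndField I M) (g : BilinField I M)
    (D : CovariantDerivative I E (TangentSpace I : M → Type _)) : Prop
    extends IsPseudoKahler J g where
  smooth_connection : D.ContMDiffCovariantDerivative ∞
  flat : IsFlatConnection D
  torsion_free : haveI := FiniteDimensional.complete ℝ E; D.torsion = 0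
  parallel : IsParallelForm D (fundamentalForm g J)
  symmetric : HasSymmetricDerivative D J

end General

/-! ## The cotangent bundle -/

section Cotangent

variable (E : Type*) [NormedAddCommGroup E] [NormedSpace ℝ E]
  (M : Type*) [TopologicalSpace M] [ChartedSpace E M]

variable {M} in
/-- The cotangent space `T*_x M`. -/
abbrev CotangentSpace (x : M) : Type _ := TangentSpace 𝓘(ℝ, E) x →L[ℝ] Trivial M ℝ x

/-- The cotangent bundle `T*M`. -/
abbrev CotangentBundle : Type _ := TotalSpace (E →L[ℝ] ℝ) (CotangentSpace E : M → Type _)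

/-- The model of the cotangent bundle as a manifold. -/
abbrev cotangentModel : ModelWithCorners ℝ (E × (E →L[ℝ] ℝ)) (ModelProd E (E →L[ℝ] ℝ)) :=
  𝓘(ℝ, E).prod 𝓘(ℝ, E →L[ℝ] ℝ)

variable {E M}
variable [IsManifold 𝓘(ℝ, E) ∞ M]

/-- The differential `dπ_ξ : T_ξ N → T_p M` of the projection `π : N = T*M → M`, `p = π ξ`. -/
def projDeriv (ξ : CotangentBundle E M) :
    TangentSpace (cotangentModel E) ξ →L[ℝ] TangentSpace 𝓘(ℝ, E) ξ.proj :=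
  mfderiv (cotangentModel E) 𝓘(ℝ, E) (TotalSpace.proj : CotangentBundle E M → M) ξ

/-- A vector field `Y` on `M`, seen as the fiberwise linear function `η ↦ η(Y)` on `N = T*M`. -/
def fiberLinear (Y : ∀ x : M, TangentSpace 𝓘(ℝ, E) x) (η : CotangentBundle E M) : ℝ :=
  η.2 (Y η.proj)

lemma mdifferentiableAt_fiberLinear {ξ : CotangentBundle E M}
    {Y : ∀ x : M, TangentSpace 𝓘(ℝ, E) x} (hY : MDiffAt (T% Y) ξ.proj) :
    MDifferentiableAt (cotangentModel E) 𝓘(ℝ, ℝ) (fiberLinear Y) ξ := by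
  have h1 : MDifferentiableAt (cotangentModel E) (𝓘(ℝ, E).prod 𝓘(ℝ, E →L[ℝ] ℝ))
      (fun η : CotangentBundle E M ↦ TotalSpace.mk' (E →L[ℝ] ℝ)
        (E := (CotangentSpace E : M → Type _)) η.proj η.2) ξ :=
    mdifferentiableAt_id
  have h2 : MDifferentiableAt (cotangentModel E) (𝓘(ℝ, E).prod 𝓘(ℝ, E))
      (fun η : CotangentBundle E M ↦ TotalSpace.mk' E
        (E := (TangentSpace 𝓘(ℝ, E) : M → Type _)) η.proj (Y η.proj)) ξ :=
    MDifferentiableAt.comp (I' := 𝓘(ℝ, E)) ξ hY (mdifferentiableAt_proj _)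
  have h3 := MDifferentiableAt.clm_bundle_apply h1 h2
  rw [mdifferentiableAt_totalSpace] at h3
  exact h3.2

/-- The vertical lift of `α ∈ T*_p M` to `T_ξ N`: the velocity of `t ↦ ξ + t α` at `t = 0`. -/
def verticalLift (ξ : CotangentBundle E M) (α : CotangentSpace E ξ.proj) :
    TangentSpace (cotangentModel E) ξ :=
  (mfderiv 𝓘(ℝ, ℝ) (cotangentModel E)
    (fun t : ℝ ↦ (⟨ξ.proj, ξ.2 + t • α⟩ : CotangentBundle E M)) 0 (1 : ℝ) : E × (E →L[ℝ] ℝ))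

lemma mdifferentiableAt_fiberLine (ξ : CotangentBundle E M) (α : CotangentSpace E ξ.proj) :
    MDifferentiableAt 𝓘(ℝ, ℝ) (cotangentModel E)
      (fun t : ℝ ↦ (⟨ξ.proj, ξ.2 + t • α⟩ : CotangentBundle E M)) 0 := by
  rw [mdifferentiableAt_totalSpace]
  refine ⟨mdifferentiableAt_const, ?_⟩
  have hb := FiberBundle.mem_baseSet_trivializationAt' (F := E →L[ℝ] ℝ)
    (E := (CotangentSpace E : M → Type _)) ξ.proj
  set e := trivializationAt (E →L[ℝ] ℝ) (CotangentSpace E : M → Type _) ξ.proj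
  have h : (fun t : ℝ ↦ (e (⟨ξ.proj, ξ.2 + t • α⟩ : CotangentBundle E M)).2) = fun t : ℝ ↦
      e.linearMapAt ℝ ξ.proj ξ.2 + t • e.linearMapAt ℝ ξ.proj α := by
    funext t
    rw [← map_smul, ← map_add, e.linearMapAt_apply, if_pos hb]
  change MDifferentiableAt _ _ (fun t : ℝ ↦ (e (⟨ξ.proj, ξ.2 + t • α⟩ : CotangentBundle E M)).2) 0
  rw [h]
  apply DifferentiableAt.mdifferentiableAt
  fun_prop

lemma projDeriv_verticalLift (ξ : CotangentBundle E M) (α : CotangentSpace E ξ.proj) :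
    projDeriv ξ (verticalLift ξ α) = 0 := by
  have h0 : (⟨ξ.proj, ξ.2 + (0 : ℝ) • α⟩ : CotangentBundle E M) = ξ := by simp
  have hp : MDifferentiableAt (cotangentModel E) 𝓘(ℝ, E)
      (TotalSpace.proj : CotangentBundle E M → M)
      (⟨ξ.proj, ξ.2 + (0 : ℝ) • α⟩ : CotangentBundle E M) := mdifferentiableAt_proj _
  have h := mfderiv_comp (0 : ℝ) hp (mdifferentiableAt_fiberLine ξ α)
  have hc : (TotalSpace.proj : CotangentBundle E M → M) ∘
      (fun t : ℝ ↦ (⟨ξ.proj, ξ.2 + t • α⟩ : CotangentBundle E M)) = fun _ ↦ ξ.proj := rfl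
  rw [hc, mfderiv_const] at h
  have h1 := congr($h (1 : ℝ))
  rw [h0] at h1
  exact h1.symm

lemma projDeriv_surjective (ξ : CotangentBundle E M) : Function.Surjective (projDeriv ξ) := by
  intro v
  let σ : ∀ x : M, CotangentSpace E x := FiberBundle.extend (E →L[ℝ] ℝ) ξ.2
  have hσ : MDifferentiableAt 𝓘(ℝ, E) (cotangentModel E)
      (fun x ↦ (⟨x, σ x⟩ : CotangentBundle E M)) ξ.proj :=
    FiberBundle.mdifferentiableAt_extend 𝓘(ℝ, E) (E →L[ℝ] ℝ) ξ.2
  have h0 : (⟨ξ.proj, σ ξ.proj⟩ : CotangentBundle E M) = ξ := by simp [σ]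
  have hp : MDifferentiableAt (cotangentModel E) 𝓘(ℝ, E)
      (TotalSpace.proj : CotangentBundle E M → M)
      (⟨ξ.proj, σ ξ.proj⟩ : CotangentBundle E M) := mdifferentiableAt_proj _
  have h := mfderiv_comp ξ.proj hp hσ
  have hc : (TotalSpace.proj : CotangentBundle E M → M) ∘
      (fun x ↦ (⟨x, σ x⟩ : CotangentBundle E M)) = id := rfl
  rw [hc, mfderiv_id] at h
  have h1 := congr($h v)
  rw [h0] at h1
  exact ⟨_, h1.symm⟩

variable (D : CovariantDerivative 𝓘(ℝ, E) E (TangentSpace 𝓘(ℝ, E) : M → Type _))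

lemma tensorialAt_connection (ξ : CotangentBundle E M)
    (w : TangentSpace (cotangentModel E) ξ) :
    TensorialAt 𝓘(ℝ, E) E
      (fun Y : ∀ x : M, TangentSpace 𝓘(ℝ, E) x ↦
        (mvfderiv (cotangentModel E) (fiberLinear Y) ξ w - ξ.2 (D Y ξ.proj (projDeriv ξ w)) : ℝ))
      ξ.proj where
  smul {f σ} hf hσ := by
    have h := mdifferentiableAt_fiberLinear hσ
    have hf' : MDifferentiableAt (cotangentModel E) 𝓘(ℝ, ℝ)
        (fun η : CotangentBundle E M ↦ f η.proj) ξ :=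
      MDifferentiableAt.comp (I' := 𝓘(ℝ, E)) ξ hf (mdifferentiableAt_proj _)
    have e : fiberLinear (f • σ) = fun η : CotangentBundle E M ↦ f η.proj * fiberLinear σ η := by
      funext η
      simp [fiberLinear]
    have hd : mvfderiv (cotangentModel E) (fun η : CotangentBundle E M ↦ f η.proj) ξ w
        = mvfderiv 𝓘(ℝ, E) f ξ.proj (projDeriv ξ w) := by
      have := mfderiv_comp (I' := 𝓘(ℝ, E)) ξ hf
        (mdifferentiableAt_proj (CotangentSpace E : M → Type _))
      exact congr($this w)
    rw [e, mvfderiv_fun_mul hf' h, D.isCovariantDerivativeOn.leibniz hσ hf]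
    simp [hd, fiberLinear]
    ring
  add {σ σ'} hσ hσ' := by
    have e : fiberLinear (σ + σ')
        = fun η : CotangentBundle E M ↦ fiberLinear σ η + fiberLinear σ' η := by
      funext η
      simp [fiberLinear]
    rw [e, mvfderiv_fun_add (mdifferentiableAt_fiberLinear hσ)
      (mdifferentiableAt_fiberLinear hσ'), D.isCovariantDerivativeOn.add hσ hσ']
    simp
    ring

variable [FiniteDimensional ℝ E]

/-- The connection map `K_ξ : T_ξ N → T*_p M` of the linear connection induced by `D` on `T*M`. It is
determined by `K_ξ(w)(Y_p) = w(η ↦ η(Y)) - ξ(D_{dπ w} Y)` for all vector fields `Y` on `M`. -/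
def connectionMap (ξ : CotangentBundle E M) :
    TangentSpace (cotangentModel E) ξ →ₗ[ℝ] CotangentSpace E ξ.proj where
  toFun w := TensorialAt.mkHom _ ξ.proj (tensorialAt_connection D ξ w)
  map_add' w w' := by
    ext v
    rw [add_apply]
    simp only [TensorialAt.mkHom_apply_eq_extend, ContinuousLinearMap.map_add]
    ring
  map_smul' c w := by
    ext v
    rw [smul_apply]
    simp only [TensorialAt.mkHom_apply_eq_extend, ContinuousLinearMap.map_smul, RingHom.id_apply,
      smul_eq_mul]
    ring

lemma connectionMap_apply (ξ : CotangentBundle E M) (w : TangentSpace (cotangentModel E) ξ)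
    {Y : ∀ x : M, TangentSpace 𝓘(ℝ, E) x} (hY : MDiffAt (T% Y) ξ.proj) :
    connectionMap D ξ w (Y ξ.proj) =
      mvfderiv (cotangentModel E) (fiberLinear Y) ξ w - ξ.2 (D Y ξ.proj (projDeriv ξ w)) :=
  TensorialAt.mkHom_apply _ hY

/-- The horizontal space of `D` at `ξ ∈ T*M`. -/
def horizontalSpace (ξ : CotangentBundle E M) :
    Submodule ℝ (TangentSpace (cotangentModel E) ξ) :=
  LinearMap.ker (connectionMap D ξ)

lemma connectionMap_verticalLift (ξ : CotangentBundle E M) (α : CotangentSpace E ξ.proj) :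
    connectionMap D ξ (verticalLift ξ α) = α := by
  ext v
  let Y : ∀ x : M, TangentSpace 𝓘(ℝ, E) x := FiberBundle.extend E v
  have hY : MDiffAt (T% Y) ξ.proj := FiberBundle.mdifferentiableAt_extend 𝓘(ℝ, E) E v
  have hv : Y ξ.proj = v := by simp [Y]
  have h0 : (⟨ξ.proj, ξ.2 + (0 : ℝ) • α⟩ : CotangentBundle E M) = ξ := by simp
  have hp : MDifferentiableAt (cotangentModel E) 𝓘(ℝ, ℝ) (fiberLinear Y)
      (⟨ξ.proj, ξ.2 + (0 : ℝ) • α⟩ : CotangentBundle E M) := mdifferentiableAt_fiberLinear hY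
  have h := mfderiv_comp (0 : ℝ) hp (mdifferentiableAt_fiberLine ξ α)
  have hc : (fiberLinear Y) ∘ (fun t : ℝ ↦ (⟨ξ.proj, ξ.2 + t • α⟩ : CotangentBundle E M))
      = fun t : ℝ ↦ (ξ.2 v : ℝ) + t * (α v : ℝ) := by
    funext t
    simp [fiberLinear, hv]
  have hd : HasDerivAt (fun t : ℝ ↦ (ξ.2 v : ℝ) + t * (α v : ℝ)) (α v : ℝ) 0 := by
    simpa using ((hasDerivAt_id (0 : ℝ)).mul_const (α v : ℝ)).const_add (ξ.2 v : ℝ)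
  rw [hc, mfderiv_eq_fderiv, hd.hasFDerivAt.fderiv] at h
  have h1 := congr($h (1 : ℝ))
  rw [h0] at h1
  have h2 : mvfderiv (cotangentModel E) (fiberLinear Y) ξ (verticalLift ξ α) = (α v : ℝ) := by
    refine Eq.trans h1.symm ?_
    simp
  have h3 := connectionMap_apply D ξ (verticalLift ξ α) hY
  rw [hv, h2, projDeriv_verticalLift] at h3
  rw [h3]
  simp

lemma splitting_bijective (ξ : CotangentBundle E M) :
    Function.Bijective ((projDeriv ξ).toLinearMap.prod (connectionMap D ξ)) := by
  have hs : Function.Surjective ((projDeriv ξ).toLinearMap.prod (connectionMap D ξ)) := by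
    rintro ⟨v, α⟩
    obtain ⟨w, rfl⟩ := projDeriv_surjective ξ v
    refine ⟨w + verticalLift ξ (α - connectionMap D ξ w), ?_⟩
    rw [LinearMap.prod_apply]
    refine Prod.ext ?_ ?_
    · exact ((projDeriv ξ).map_add _ _).trans (by rw [projDeriv_verticalLift, add_zero])
    · exact ((connectionMap D ξ).map_add _ _).trans
        (by rw [connectionMap_verticalLift, add_sub_cancel])
  refine ⟨?_, hs⟩
  have : FiniteDimensional ℝ (TangentSpace (cotangentModel E) ξ) :=
    inferInstanceAs (FiniteDimensional ℝ (E × (E →L[ℝ] ℝ)))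
  have : FiniteDimensional ℝ (TangentSpace 𝓘(ℝ, E) ξ.proj × CotangentSpace E ξ.proj) :=
    inferInstanceAs (FiniteDimensional ℝ (E × (E →L[ℝ] ℝ)))
  refine (LinearMap.injective_iff_surjective_of_finrank_eq_finrank ?_).2 hs
  rfl

/-- The canonical identification `T_ξ N ≅ T_p M ⊕ T*_p M` determined by the connection `D`: it
identifies the horizontal space with `T_p M` by means of `dπ`, and the vertical space `ker dπ` with
`T*_p M` by means of the vertical lift. -/
def splitting (ξ : CotangentBundle E M) :
    TangentSpace (cotangentModel E) ξ ≃L[ℝ]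
      TangentSpace 𝓘(ℝ, E) ξ.proj × CotangentSpace E ξ.proj :=
  haveI : FiniteDimensional ℝ (TangentSpace (cotangentModel E) ξ) :=
    inferInstanceAs (FiniteDimensional ℝ (E × (E →L[ℝ] ℝ)))
  haveI : T2Space (TangentSpace (cotangentModel E) ξ) :=
    inferInstanceAs (T2Space (E × (E →L[ℝ] ℝ)))
  haveI : T2Space (TangentSpace 𝓘(ℝ, E) ξ.proj × CotangentSpace E ξ.proj) :=
    inferInstanceAs (T2Space (E × (E →L[ℝ] ℝ)))
  (LinearEquiv.ofBijective _ (splitting_bijective D ξ)).toContinuousLinearEquiv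

lemma splitting_apply (ξ : CotangentBundle E M) (w : TangentSpace (cotangentModel E) ξ) :
    splitting D ξ w = (projDeriv ξ w, connectionMap D ξ w) := rfl

/-! ## The structures on the cotangent bundle -/

/-- The endomorphism field `J^D = diag(J, J*)` of `N = T*M`, with respect to the splitting of `TN`
determined by `D`; here `J* α = α ∘ J`. -/
def cotangentJ (J : EndField 𝓘(ℝ, E) M) : EndField (cotangentModel E) (CotangentBundle E M) :=
  fun ξ ↦ (splitting D ξ).symm.toContinuousLinearMap ∘L
    ((J ξ.proj).prodMap (ContinuousLinearMap.precomp ℝ (J ξ.proj))) ∘L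
    (splitting D ξ).toContinuousLinearMap

/-- The endomorphism field `(v, α) ↦ (Ω⁻¹ α, Ω v)` of `N = T*M` associated to a nondegenerate
two-form `Ω` on `M`, seen as the map `v ↦ Ω(v, ·)`, with respect to the splitting of `TN`
determined by `D`. -/
def cotangentOmega (Ω : BilinField 𝓘(ℝ, E) M) :
    EndField (cotangentModel E) (CotangentBundle E M) :=
  fun ξ ↦ (splitting D ξ).symm.toContinuousLinearMap ∘L
    (((Ω ξ.proj).inverse ∘L ContinuousLinearMap.snd ℝ _ _).prod
      (Ω ξ.proj ∘L ContinuousLinearMap.fst ℝ _ _)) ∘L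
    (splitting D ξ).toContinuousLinearMap

/-- The pull-back of a bilinear form under a linear map. -/
def pullbackForm {V W : Type*} [AddCommGroup V] [Module ℝ V] [TopologicalSpace V]
    [IsTopologicalAddGroup V] [ContinuousSMul ℝ V]
    [AddCommGroup W] [Module ℝ W] [TopologicalSpace W]
    [IsTopologicalAddGroup W] [ContinuousSMul ℝ W]
    (b : W →L[ℝ] W →L[ℝ] ℝ) (A : V →L[ℝ] W) : V →L[ℝ] V →L[ℝ] ℝ :=
  ContinuousLinearMap.precomp ℝ A ∘L b ∘L A

/-- The field of bilinear forms `g_N = diag(g, -g⁻¹)` on `N = T*M`, with respect to the splitting of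
`TN` determined by `D`; here `g⁻¹(α, β) = g(g⁻¹ α, g⁻¹ β)` is the form on `T*_p M` which corresponds
to `g` under the isomorphism `v ↦ g(v, ·)` of `T_p M` with `T*_p M`. -/
def cotangentMetric (g : BilinField 𝓘(ℝ, E) M) :
    BilinField (cotangentModel E) (CotangentBundle E M) :=
  fun ξ ↦ pullbackForm (g ξ.proj)
      (ContinuousLinearMap.fst ℝ _ _ ∘L (splitting D ξ).toContinuousLinearMap)
    - pullbackForm (g ξ.proj)
      ((g ξ.proj).inverse ∘L ContinuousLinearMap.snd ℝ _ _ ∘L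
        (splitting D ξ).toContinuousLinearMap)

end Cotangent

/-! ## The canonical complex structure of the cotangent bundle -/

section Canonical

variable {E : Type*} [NormedAddCommGroup E] [NormedSpace ℝ E]
  {M : Type*} [TopologicalSpace M] [ChartedSpace E M] [IsManifold 𝓘(ℝ, E) ∞ M]

/-- The local coordinates `η ↦ (e(π η), η ∘ (de)⁻¹)` of `T*M` induced by local coordinates `e` of
`M`. -/
def cotangentChart (e : OpenPartialHomeomorph M E) (η : CotangentBundle E M) :
    E × (E →L[ℝ] ℝ) :=
  (e η.proj, η.2 ∘L (mvfderiv 𝓘(ℝ, E) e η.proj).inverse)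

/-- `JN` is the canonical complex structure of the cotangent bundle of the complex manifold `(M, J)`:
for each local holomorphic coordinate system `z = e` on `M`, with values in `(E, j)`, the induced
coordinates `(z, w)` of `T*M` are holomorphic for `JN`, where the fiber coordinate `w` takes its
values in the complex vector space `(E*, j*)`, `j* β = β ∘ j`. -/
def IsCanonicalComplexStructure (J : EndField 𝓘(ℝ, E) M)
    (JN : EndField (cotangentModel E) (CotangentBundle E M)) : Prop :=
  ∀ (e : OpenPartialHomeomorph M E) (j : E →L[ℝ] E), IsHolomorphicChart J e j →
    ∀ ξ : CotangentBundle E M, ξ.proj ∈ e.source →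
    ∀ w : TangentSpace (cotangentModel E) ξ,
      mvfderiv (cotangentModel E) (cotangentChart e) ξ (JN ξ w) =
        (j (mvfderiv (cotangentModel E) (cotangentChart e) ξ w).1,
          (mvfderiv (cotangentModel E) (cotangentChart e) ξ w).2 ∘L j)

end Canonical

end

/-!
By the Frobenius theorem the flat torsion-free connection `∇` is trivial in suitable charts of `M`,
where `ω` is a constant form `Ω` and the symmetry of `∇J` says that `J = j(x)`, regarded as a
vector-valued one-form, is closed. In the induced charts of `T*M` the structures are
`J₁(a, β) = (j a, β ∘ j)`, `J₂(a, β) = (Ω⁻¹ β, Ω a)`, `g_N = g - g⁻¹` at each point, and the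
algebraic identities become linear algebra on `E × E*`. The two-forms of `J₁` and `J₃` are constant,
and that of `J₂` is `β(j a') - β'(j a)`, which is closed because `j` is. The eigendistributions of
`J₂` and `J₃` are `β = ± Ω a` and `β = ∓ Ω(j a)`, hence tangent to the graphs of the primitives of
closed `E*`-valued one-forms. In a holomorphic chart, torsion-freeness and the symmetry of `∇J` make
the Christoffel symbols complex symmetric, `Γ(j u, v) = Γ(u, j v)`; their contribution to `J₁` then
cancels, so that `J₁` has the constant coefficients of the canonical complex structure.
-/

/-! ## Integrable total differential equations -/

section Frobenius

open Metric Set Filter Topology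
open scoped NNReal

variable {E : Type*} [NormedAddCommGroup E] [NormedSpace ℝ E]
  {W : Type*} [NormedAddCommGroup W] [NormedSpace ℝ W]
  {Q : Type*} [NormedAddCommGroup Q] [NormedSpace ℝ Q]

/-- Uniform `C²`-type bounds on a set: `f` and its derivative are bounded by `K`, and so is the
quotient of the first order Taylor remainder by the squared distance. -/
structure IsTaylorBoundedOn (f : Q → W) (s : Set Q) (K : ℝ≥0) : Prop where
  differentiableAt : ∀ q ∈ s, DifferentiableAt ℝ f q
  norm_le : ∀ q ∈ s, ‖f q‖ ≤ K
  norm_fderiv_le : ∀ q ∈ s, ‖fderiv ℝ f q‖ ≤ K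
  norm_remainder_le : ∀ q ∈ s, ∀ q' ∈ s, ‖f q' - f q - fderiv ℝ f q (q' - q)‖ ≤ K * ‖q' - q‖ ^ 2

lemma IsTaylorBoundedOn.mono {f : Q → W} {s s' : Set Q} {K K' : ℝ≥0}
    (h : IsTaylorBoundedOn f s K) (hs : s' ⊆ s) (hK : K ≤ K') : IsTaylorBoundedOn f s' K' where
  differentiableAt q hq := h.differentiableAt q (hs hq)
  norm_le q hq := (h.norm_le q (hs hq)).trans (by exact_mod_cast hK)
  norm_fderiv_le q hq := (h.norm_fderiv_le q (hs hq)).trans (by exact_mod_cast hK)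
  norm_remainder_le q hq q' hq' :=
    (h.norm_remainder_le q (hs hq) q' (hs hq')).trans (by gcongr)

lemma norm_taylor_remainder_le {f : Q → W} {s : Set Q} {C : ℝ≥0} (hs : Convex ℝ s)
    (hf : ∀ q ∈ s, DifferentiableAt ℝ f q)
    (hC : LipschitzOnWith C (fderiv ℝ f) s)
    {q q' : Q} (hq : q ∈ s) (hq' : q' ∈ s) :
    ‖f q' - f q - fderiv ℝ f q (q' - q)‖ ≤ C * ‖q' - q‖ ^ 2 := by
  have hseg : segment ℝ q q' ⊆ s := hs.segment_subset hq hq'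
  have hbound : ∀ z ∈ segment ℝ q q', ‖fderiv ℝ f z - fderiv ℝ f q‖ ≤ C * ‖q' - q‖ := by
    intro z hz
    refine (hC.norm_sub_le (hseg hz) hq).trans ?_
    gcongr
    exact norm_sub_le_of_mem_segment hz
  rw [sq, ← mul_assoc]
  exact (convex_segment q q').norm_image_sub_le_of_norm_hasFDerivWithin_le'
    (fun z hz ↦ (hf z (hseg hz)).hasFDerivAt.hasFDerivWithinAt) hbound
    (left_mem_segment ℝ q q') (right_mem_segment ℝ q q')

theorem exists_isTaylorBoundedOn_closedBall {f : Q → W} {q₀ : Q} (hf : ContDiffAt ℝ 2 f q₀) :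
    ∃ K, ∃ R > 0, IsTaylorBoundedOn f (closedBall q₀ R) K := by
  have hf' : ContDiffAt ℝ 1 (fderiv ℝ f) q₀ := hf.fderiv_right (by norm_num)
  obtain ⟨C, s, hs, hC⟩ := hf'.exists_lipschitzOnWith
  have hdiff : ∀ᶠ q in 𝓝 q₀, DifferentiableAt ℝ f q := by
    filter_upwards [hf.eventually (by simp)] with q hq
    exact hq.differentiableAt (by simp)
  have hbdd : ∀ᶠ q in 𝓝 q₀, ‖f q‖₊ < ‖f q₀‖₊ + 1 :=
    hf.continuousAt.nnnorm.eventually (gt_mem_nhds (lt_add_one _))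
  have hbdd' : ∀ᶠ q in 𝓝 q₀, ‖fderiv ℝ f q‖₊ < ‖fderiv ℝ f q₀‖₊ + 1 :=
    hf'.continuousAt.nnnorm.eventually (gt_mem_nhds (lt_add_one _))
  obtain ⟨R, hR, hball⟩ := nhds_basis_closedBall.eventually_iff.1
    (hdiff.and (hbdd.and (hbdd'.and (eventually_mem_set.2 hs))))
  refine ⟨max C (max (‖f q₀‖₊ + 1) (‖fderiv ℝ f q₀‖₊ + 1)), R, hR, fun q hq ↦ (hball hq).1,
    fun q hq ↦ ?_, fun q hq ↦ ?_, fun q hq q' hq' ↦ ?_⟩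
  · exact_mod_cast (hball hq).2.1.le.trans (le_max_of_le_right (le_max_left _ _))
  · exact_mod_cast (hball hq).2.2.1.le.trans (le_max_of_le_right (le_max_right _ _))
  · refine (norm_taylor_remainder_le (convex_closedBall q₀ R) (fun z hz ↦ (hball hz).1)
      (hC.mono fun z hz ↦ (hball hz).2.2.2) hq hq').trans ?_
    gcongr
    exact le_max_left _ _

theorem exists_hasDerivWithinAt_mem_closedBall_of_isPicardLindelof [CompleteSpace W]
    {f : ℝ → W → W} {tmin tmax : ℝ} {t₀ : Icc tmin tmax} {x₀ : W} {a L K : ℝ≥0}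
    (hf : IsPicardLindelof f t₀ x₀ a 0 L K) :
    ∃ α : ℝ → W, α t₀ = x₀ ∧ (∀ t, α t ∈ closedBall x₀ a) ∧
      ∀ t ∈ Icc tmin tmax, HasDerivWithinAt α (f t (α t)) (Icc tmin tmax) t := by
  obtain ⟨α, hα⟩ :=
    ODE.FunSpace.exists_isFixedPt_next hf (mem_closedBall_self (NNReal.coe_nonneg 0))
  refine ⟨α.compProj, by rw [ODE.FunSpace.compProj_val, ← hα, ODE.FunSpace.next_apply₀],
    fun t ↦ α.compProj_mem_closedBall hf.mul_max_le, fun t ht ↦ ?_⟩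
  apply ODE.hasDerivWithinAt_picard_Icc t₀.2 hf.continuousOn_uncurry
    α.continuous_compProj.continuousOn (fun _ _ ↦ α.compProj_mem_closedBall hf.mul_max_le)
    x₀ ht |>.congr_of_mem _ ht
  intro t' ht'
  nth_rw 1 [← hα]
  rw [ODE.FunSpace.compProj_of_mem ht', ODE.FunSpace.next_apply]

lemma hasDerivWithinAt_Ici_of_Icc {f : ℝ → W} {f' : W} {a b t : ℝ}
    (hf : HasDerivWithinAt f f' (Icc a b) t) (ht : t ∈ Ico a b) :
    HasDerivWithinAt f f' (Ici t) t :=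
  hf.mono_of_mem_nhdsWithin (mem_of_superset (Icc_mem_nhdsGE ht.2) (Icc_subset_Icc_left ht.1))

lemma gronwallBound_zero_mul (K ε c x : ℝ) :
    gronwallBound 0 K (ε * c) x = gronwallBound 0 K ε x * c := by
  unfold gronwallBound
  split_ifs <;> ring

/-- The right-hand side `φ` of the total differential equation `dσ_x = φ(x, σ(x))` is integrable in
the sense of Frobenius and uniformly bounded on a product of balls. The normalisations `1 ≤ K` and
`R ≤ 1` make `K * ‖x‖ ≤ R / 2` the only smallness condition on increments `x`. -/
structure IsFrobeniusBox (φ : E × W → E →L[ℝ] W) (x₀ : E) (w₀ : W) (K : ℝ≥0) (R : ℝ) : Prop where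
  one_le : 1 ≤ K
  pos : 0 < R
  le_one : R ≤ 1
  bounded : IsTaylorBoundedOn φ (closedBall x₀ R ×ˢ closedBall w₀ R) K
  integrable : ∀ q ∈ closedBall x₀ R ×ˢ closedBall w₀ R, ∀ u v,
    fderiv ℝ φ q (u, φ q u) v = fderiv ℝ φ q (v, φ q v) u

theorem exists_isFrobeniusBox {φ : E × W → E →L[ℝ] W} {x₀ : E} {w₀ : W}
    (hφ : ContDiffAt ℝ 2 φ (x₀, w₀))
    (hint : ∀ᶠ q in 𝓝 (x₀, w₀), ∀ u v,
      fderiv ℝ φ q (u, φ q u) v = fderiv ℝ φ q (v, φ q v) u) :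
    ∃ K R, IsFrobeniusBox φ x₀ w₀ K R := by
  obtain ⟨K, R, hR, hK⟩ := exists_isTaylorBoundedOn_closedBall hφ
  obtain ⟨R', hR', hint⟩ := nhds_basis_closedBall.eventually_iff.1 hint
  have hsub : ∀ S, min 1 (min R R') ≤ S →
      closedBall x₀ (min 1 (min R R')) ×ˢ closedBall w₀ (min 1 (min R R')) ⊆
        closedBall (x₀, w₀) S := fun S hS ↦ by
    rw [closedBall_prod_same]
    exact closedBall_subset_closedBall hS
  exact ⟨max 1 K, min 1 (min R R'), le_max_left _ _, by positivity, min_le_left _ _,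
    hK.mono (hsub R ((min_le_right _ _).trans (min_le_left _ _))) (le_max_right _ _),
    fun q hq ↦ hint (hsub R' ((min_le_right _ _).trans (min_le_right _ _)) hq)⟩

/-- The right-hand side of the ordinary differential equation satisfied by `t ↦ σ(x₀ + t x)` when
`dσ_x = φ(x, σ(x))`. -/
def radialField (φ : E × W → E →L[ℝ] W) (x₀ x : E) (t : ℝ) (w : W) : W :=
  φ (x₀ + t • x, w) x

/-- A solution on `[0, 1]` of the radial equation with initial value `w₀` which stays in the ball of
radius `R / 2`. -/
structure IsRadialSolution (φ : E × W → E →L[ℝ] W) (x₀ : E) (w₀ : W) (R : ℝ) (x : E)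
    (y : ℝ → W) : Prop where
  initial : y 0 = w₀
  mem_closedBall : ∀ t, y t ∈ closedBall w₀ (R / 2)
  hasDerivWithinAt : ∀ t ∈ Icc (0 : ℝ) 1,
    HasDerivWithinAt y (radialField φ x₀ x t (y t)) (Icc 0 1) t

variable {φ : E × W → E →L[ℝ] W} {x₀ : E} {w₀ : W} {K : ℝ≥0} {R : ℝ}

namespace IsFrobeniusBox

variable (h : IsFrobeniusBox φ x₀ w₀ K R)
include h

lemma norm_le_half {x : E} (hx : K * ‖x‖ ≤ R / 2) : ‖x‖ ≤ R / 2 :=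
  (le_mul_of_one_le_left (norm_nonneg x) (by exact_mod_cast h.one_le)).trans hx

lemma norm_le_one {x : E} (hx : K * ‖x‖ ≤ R / 2) : ‖x‖ ≤ 1 := by
  linarith [h.norm_le_half hx, h.le_one]

lemma closedBall_half_subset : closedBall w₀ (R / 2) ⊆ closedBall w₀ R :=
  closedBall_subset_closedBall (half_le_self h.pos.le)

lemma ray_mem {x : E} (hx : K * ‖x‖ ≤ R / 2) {t : ℝ} (ht : t ∈ Icc (0 : ℝ) 1) :
    x₀ + t • x ∈ closedBall x₀ R := by
  rw [mem_closedBall, dist_self_add_left, norm_smul, Real.norm_eq_abs, abs_of_nonneg ht.1]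
  linarith [mul_le_of_le_one_left (norm_nonneg x) ht.2, h.norm_le_half hx, h.pos]

lemma lipschitzOnWith : LipschitzOnWith K φ (closedBall x₀ R ×ˢ closedBall w₀ R) :=
  ((convex_closedBall _ _).prod (convex_closedBall _ _)).lipschitzOnWith_of_nnnorm_fderiv_le
    h.bounded.differentiableAt h.bounded.norm_fderiv_le

lemma lipschitzOnWith_radialField {x : E} (hx : K * ‖x‖ ≤ R / 2) {t : ℝ}
    (ht : t ∈ Icc (0 : ℝ) 1) : LipschitzOnWith K (radialField φ x₀ x t) (closedBall w₀ R) := by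
  refine LipschitzOnWith.of_dist_le_mul fun w hw w' hw' ↦ ?_
  rw [dist_eq_norm, radialField, radialField, ← _root_.sub_apply]
  calc ‖(φ (x₀ + t • x, w) - φ (x₀ + t • x, w')) x‖
      ≤ ‖φ (x₀ + t • x, w) - φ (x₀ + t • x, w')‖ :=
        ContinuousLinearMap.unit_le_opNorm _ _ (h.norm_le_one hx)
    _ ≤ K * dist (x₀ + t • x, w) (x₀ + t • x, w') := by
        rw [← dist_eq_norm]
        exact h.lipschitzOnWith.dist_le_mul _ ⟨h.ray_mem hx ht, hw⟩ _ ⟨h.ray_mem hx ht, hw'⟩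
    _ = K * dist w w' := by rw [dist_prod_same_left]

theorem exists_isRadialSolution [CompleteSpace W] {x : E} (hx : K * ‖x‖ ≤ R / 2) :
    ∃ y, IsRadialSolution φ x₀ w₀ R x y := by
  obtain ⟨a, ha⟩ : ∃ a : ℝ≥0, (a : ℝ) = R / 2 := ⟨⟨R / 2, (half_pos h.pos).le⟩, rfl⟩
  have hpl : IsPicardLindelof (radialField φ x₀ x) (⟨0, by simp⟩ : Icc (0 : ℝ) 1) w₀
      a 0 (K * ‖x‖₊) K := by
    refine ⟨fun t ht ↦ (h.lipschitzOnWith_radialField hx ht).mono ?_, fun w hw ↦ ?_,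
      fun t ht w hw ↦ ?_, by simpa [ha] using hx⟩ <;> rw [ha] at *
    · exact h.closedBall_half_subset
    · exact (h.lipschitzOnWith.continuousOn.comp (by fun_prop) fun t ht ↦
        ⟨h.ray_mem hx ht, h.closedBall_half_subset hw⟩).clm_apply continuousOn_const
    · refine (φ _).le_of_opNorm_le ?_ x
      exact h.bounded.norm_le _ ⟨h.ray_mem hx ht, h.closedBall_half_subset hw⟩
  obtain ⟨y, hy₀, hy, hy'⟩ := exists_hasDerivWithinAt_mem_closedBall_of_isPicardLindelof hpl
  exact ⟨y, hy₀, ha ▸ hy, hy'⟩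

end IsFrobeniusBox

/-- The first order approximation in `v` of the radial solution in direction `x + v`, built from a
radial solution `y` in direction `x`: for `y t = σ(x₀ + t x)` it is
`σ(x₀ + t x) + t dσ_{x₀ + t x}(v)`. -/
def radialVariation (φ : E × W → E →L[ℝ] W) (x₀ x v : E) (y : ℝ → W) (t : ℝ) : W :=
  y t + t • φ (x₀ + t • x, y t) v

namespace IsRadialSolution

lemma apply_one_eq {y : ℝ → W} (hy : IsRadialSolution φ x₀ w₀ R 0 y) : y 1 = w₀ := by
  refine (constant_of_has_deriv_right_zero (HasDerivWithinAt.continuousOn hy.hasDerivWithinAt)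
    (fun t ht ↦ ?_) 1 (by simp)).trans hy.initial
  simpa [radialField] using
    hasDerivWithinAt_Ici_of_Icc (hy.hasDerivWithinAt t (Ico_subset_Icc_self ht)) ht

variable {x v : E} {y : ℝ → W} (hy : IsRadialSolution φ x₀ w₀ R x y)
  (h : IsFrobeniusBox φ x₀ w₀ K R)
include hy h

lemma mem (hx : K * ‖x‖ ≤ R / 2) {t : ℝ} (ht : t ∈ Icc (0 : ℝ) 1) :
    (x₀ + t • x, y t) ∈ closedBall x₀ R ×ˢ closedBall w₀ R :=
  ⟨h.ray_mem hx ht, h.closedBall_half_subset (hy.mem_closedBall t)⟩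

lemma hasDerivWithinAt_radialVariation (hx : K * ‖x‖ ≤ R / 2) {t : ℝ}
    (ht : t ∈ Icc (0 : ℝ) 1) :
    HasDerivWithinAt (radialVariation φ x₀ x v y)
      (φ (x₀ + t • x, y t) x + (t • fderiv ℝ φ (x₀ + t • x, y t) (x, φ (x₀ + t • x, y t) x) v
        + φ (x₀ + t • x, y t) v)) (Icc 0 1) t := by
  have hray : HasDerivWithinAt (fun t : ℝ ↦ x₀ + t • x) x (Icc 0 1) t := by
    simpa using (((hasDerivAt_id t).smul_const x).const_add x₀).hasDerivWithinAt
  have hφ : HasDerivWithinAt (fun t ↦ φ (x₀ + t • x, y t))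
      (fderiv ℝ φ (x₀ + t • x, y t) (x, φ (x₀ + t • x, y t) x)) (Icc 0 1) t :=
    (h.bounded.differentiableAt _ (hy.mem h hx ht)).hasFDerivAt.comp_hasDerivWithinAt t
      (hray.prodMk (hy.hasDerivWithinAt t ht))
  have hφv : HasDerivWithinAt (fun t ↦ φ (x₀ + t • x, y t) v)
      (fderiv ℝ φ (x₀ + t • x, y t) (x, φ (x₀ + t • x, y t) x) v) (Icc 0 1) t := by
    simpa using hφ.clm_apply (hasDerivWithinAt_const t (Icc (0 : ℝ) 1) v)
  unfold radialVariation
  simpa only [one_smul, radialField] using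
    (hy.hasDerivWithinAt t ht).fun_add ((hasDerivAt_id' t).hasDerivWithinAt.fun_smul hφv)

lemma norm_smul_apply_le (hx : K * ‖x‖ ≤ R / 2) {t : ℝ} (ht : t ∈ Icc (0 : ℝ) 1) :
    ‖t • φ (x₀ + t • x, y t) v‖ ≤ K * ‖v‖ := by
  rw [norm_smul, Real.norm_eq_abs, abs_of_nonneg ht.1]
  exact (mul_le_of_le_one_left (norm_nonneg _) ht.2).trans
    ((φ _).le_of_opNorm_le (h.bounded.norm_le _ (hy.mem h hx ht)) v)

lemma radialVariation_mem (hx : K * ‖x‖ ≤ R / 2) (hv : K * ‖v‖ ≤ R / 2) {t : ℝ}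
    (ht : t ∈ Icc (0 : ℝ) 1) : radialVariation φ x₀ x v y t ∈ closedBall w₀ R := by
  have hyt := hy.mem_closedBall t
  rw [Metric.mem_closedBall, dist_eq_norm] at hyt ⊢
  rw [radialVariation, add_sub_right_comm]
  exact (norm_add_le _ _).trans (by linarith [hy.norm_smul_apply_le h (v := v) hx ht])

/-- By integrability, the first order terms of the defect cancel. -/
lemma dist_deriv_radialVariation_le (hx : K * ‖x‖ ≤ R / 2) (hv : K * ‖v‖ ≤ R / 2)
    (hxv : K * ‖x + v‖ ≤ R / 2) {t : ℝ} (ht : t ∈ Icc (0 : ℝ) 1) :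
    dist (φ (x₀ + t • x, y t) x + (t • fderiv ℝ φ (x₀ + t • x, y t)
        (x, φ (x₀ + t • x, y t) x) v + φ (x₀ + t • x, y t) v))
      (radialField φ x₀ (x + v) t (radialVariation φ x₀ x v y t)) ≤ 2 * K ^ 3 * ‖v‖ ^ 2 := by
  set q : E × W := (x₀ + t • x, y t) with hq
  set k : E × W := t • (v, φ q v) with hk
  have hqk : ((x₀ + t • (x + v), radialVariation φ x₀ x v y t) : E × W) = q + k := by
    simp only [hq, hk, radialVariation, Prod.smul_mk, Prod.mk_add_mk, smul_add, add_assoc]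
  have hqk_mem : q + k ∈ closedBall x₀ R ×ˢ closedBall w₀ R :=
    hqk ▸ ⟨h.ray_mem hxv ht, hy.radialVariation_mem h hx hv ht⟩
  have hknorm : ‖k‖ ≤ K * ‖v‖ := by
    rw [hk, Prod.smul_mk, Prod.norm_mk]
    refine max_le ?_ (hy.norm_smul_apply_le h hx ht)
    rw [norm_smul, Real.norm_eq_abs, abs_of_nonneg ht.1]
    exact mul_le_mul_of_nonneg_right (ht.2.trans (by exact_mod_cast h.one_le)) (norm_nonneg v)
  have hremainder := h.bounded.norm_remainder_le q (hy.mem h hx ht) _ hqk_mem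
  have hderiv := h.bounded.norm_fderiv_le q (hy.mem h hx ht)
  rw [add_sub_cancel_left] at hremainder
  have hdefect : φ q x + (t • fderiv ℝ φ q (x, φ q x) v + φ q v)
      - radialField φ x₀ (x + v) t (radialVariation φ x₀ x v y t) =
      -((φ (q + k) - φ q - fderiv ℝ φ q k) (x + v)) - fderiv ℝ φ q k v := by
    rw [radialField, hqk, h.integrable q (hy.mem h hx ht) x v]
    simp only [hk, _root_.sub_apply, map_add, map_smul, _root_.smul_apply]
    module
  have hK : (1 : ℝ) ≤ K := by exact_mod_cast h.one_le
  rw [dist_eq_norm, hdefect]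
  calc _ ≤ ‖(φ (q + k) - φ q - fderiv ℝ φ q k) (x + v)‖ + ‖fderiv ℝ φ q k v‖ := by
        rw [← norm_neg ((φ (q + k) - φ q - fderiv ℝ φ q k) (x + v))]
        exact norm_sub_le _ _
    _ ≤ K * ‖k‖ ^ 2 + K * ‖k‖ * ‖v‖ := add_le_add
        ((ContinuousLinearMap.unit_le_opNorm _ _ (h.norm_le_one hxv)).trans hremainder)
        (ContinuousLinearMap.le_of_opNorm_le _ (ContinuousLinearMap.le_of_opNorm_le _ hderiv k) v)
    _ ≤ K * (K * ‖v‖) ^ 2 + K * (K * ‖v‖) * ‖v‖ := by gcongr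
    _ = (K ^ 3 + K ^ 2) * ‖v‖ ^ 2 := by ring
    _ ≤ 2 * K ^ 3 * ‖v‖ ^ 2 := by
        rw [two_mul]
        gcongr
        norm_num

theorem norm_sub_le {y' : ℝ → W} (hy' : IsRadialSolution φ x₀ w₀ R (x + v) y')
    (hx : K * ‖x‖ ≤ R / 2) (hv : K * ‖v‖ ≤ R / 2) (hxv : K * ‖x + v‖ ≤ R / 2) :
    ‖y' 1 - y 1 - φ (x₀ + x, y 1) v‖ ≤ gronwallBound 0 K (2 * K ^ 3) 1 * ‖v‖ ^ 2 := by
  have hIcc {t : ℝ} (ht : t ∈ Ico (0 : ℝ) 1) : t ∈ Icc (0 : ℝ) 1 := Ico_subset_Icc_self ht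
  have hdist := dist_le_of_approx_trajectories_ODE_of_mem
    (v := radialField φ x₀ (x + v)) (s := fun _ ↦ closedBall w₀ R)
    (f' := fun t ↦ radialField φ x₀ (x + v) t (y' t)) (δ := 0) (εf := 0)
    (fun t ht ↦ h.lipschitzOnWith_radialField hxv (hIcc ht))
    (HasDerivWithinAt.continuousOn hy'.hasDerivWithinAt)
    (fun t ht ↦ hasDerivWithinAt_Ici_of_Icc (hy'.hasDerivWithinAt t (hIcc ht)) ht)
    (fun t _ ↦ (dist_self _).le)
    (fun t _ ↦ h.closedBall_half_subset (hy'.mem_closedBall t))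
    (HasDerivWithinAt.continuousOn fun t ht ↦ hy.hasDerivWithinAt_radialVariation h hx ht)
    (fun t ht ↦
      hasDerivWithinAt_Ici_of_Icc (hy.hasDerivWithinAt_radialVariation h hx (hIcc ht)) ht)
    (fun t ht ↦ hy.dist_deriv_radialVariation_le h hx hv hxv (hIcc ht))
    (fun t ht ↦ hy.radialVariation_mem h hx hv (hIcc ht))
    (by simp [radialVariation, hy.initial, hy'.initial]) 1 (by simp)
  rwa [zero_add, sub_zero, gronwallBound_zero_mul, dist_eq_norm, radialVariation, one_smul,
    one_smul, ← sub_sub] at hdist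

end IsRadialSolution
/-- The total differential equation is solved along the rays from `x₀`, and Grönwall's inequality
compares the solutions along neighbouring rays up to second order. -/
theorem exists_eventually_hasFDerivAt_of_integrable [CompleteSpace W]
    (hφ : ContDiffAt ℝ 2 φ (x₀, w₀))
    (hint : ∀ᶠ q in 𝓝 (x₀, w₀), ∀ u v,
      fderiv ℝ φ q (u, φ q u) v = fderiv ℝ φ q (v, φ q v) u) :
    ∃ σ : E → W, σ x₀ = w₀ ∧ ∀ᶠ x in 𝓝 x₀, HasFDerivAt σ (φ (x, σ x)) x := by
  obtain ⟨K, R, h⟩ := exists_isFrobeniusBox hφ hint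
  choose! y hy using fun x (hx : K * ‖x‖ ≤ R / 2) ↦ h.exists_isRadialSolution hx
  have hsmall {X : Type _} [TopologicalSpace X] {f : X → E} {a : X} (hf : ContinuousAt f a)
      (ha : K * ‖f a‖ < R / 2) : ∀ᶠ x in 𝓝 a, K * ‖f x‖ < R / 2 :=
    (hf.norm.const_mul (K : ℝ)).eventually (gt_mem_nhds ha)
  refine ⟨fun x ↦ y (x - x₀) 1, ?_, ?_⟩
  · simpa using (sub_self x₀ ▸ hy (x₀ - x₀) (by simpa using (half_pos h.pos).le)).apply_one_eq
  filter_upwards [hsmall (f := fun x ↦ x - x₀) (a := x₀) (by fun_prop) (by simpa using h.pos)]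
    with x hx
  rw [hasFDerivAt_iff_isLittleO_nhds_zero]
  refine Asymptotics.IsBigO.trans_isLittleO (g := fun v : E ↦ ‖v‖ ^ 2)
    (Asymptotics.IsBigO.of_bound (gronwallBound 0 K (2 * K ^ 3) 1) ?_)
    (by simpa using Asymptotics.isLittleO_norm_pow_id (E' := E) one_lt_two)
  filter_upwards [hsmall (f := fun v ↦ v) (a := 0) (by fun_prop) (by simpa using h.pos),
    hsmall (f := fun v ↦ x - x₀ + v) (a := 0) (by fun_prop) (by simpa using hx)] with v hv hxv
  have hle := (hy _ hx.le).norm_sub_le h (hy _ hxv.le) hx.le hv.le hxv.le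
  rw [add_sub_cancel, sub_add_eq_add_sub] at hle
  simpa using hle

theorem exists_contDiffOn_hasFDerivAt_of_integrable [CompleteSpace W] {O : Set (E × W)}
    (hO : IsOpen O) (hφ : ContDiffOn ℝ ∞ φ O)
    (hint : ∀ q ∈ O, ∀ u v, fderiv ℝ φ q (u, φ q u) v = fderiv ℝ φ q (v, φ q v) u)
    (h₀ : (x₀, w₀) ∈ O) :
    ∃ (σ : E → W) (U : Set E), IsOpen U ∧ x₀ ∈ U ∧ σ x₀ = w₀ ∧ ContDiffOn ℝ ∞ σ U ∧
      ∀ x ∈ U, (x, σ x) ∈ O ∧ HasFDerivAt σ (φ (x, σ x)) x := by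
  obtain ⟨σ, hσ₀, hσ⟩ := exists_eventually_hasFDerivAt_of_integrable
    ((hφ.contDiffAt (hO.mem_nhds h₀)).of_le (by norm_cast))
    (by filter_upwards [hO.mem_nhds h₀] with q hq using hint q hq)
  have hmem : ∀ᶠ x in 𝓝 x₀, (x, σ x) ∈ O :=
    (continuousAt_id.prodMk hσ.self_of_nhds.continuousAt).eventually_mem
      (by simpa [hσ₀] using hO.mem_nhds h₀)
  obtain ⟨U, hU, hUo, hxU⟩ := _root_.eventually_nhds_iff.1 (hmem.and hσ)
  refine ⟨σ, U, hUo, hxU, hσ₀, ?_, hU⟩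
  rw [contDiffOn_infty]
  intro n
  induction n with
  | zero =>
    rw [Nat.cast_zero, contDiffOn_zero]
    exact fun x hx ↦ (hU x hx).2.continuousAt.continuousWithinAt
  | succ n ih =>
    rw [Nat.cast_succ, contDiffOn_succ_iff_fderiv_of_isOpen hUo]
    refine ⟨fun x hx ↦ (hU x hx).2.differentiableAt.differentiableWithinAt, by simp, ?_⟩
    refine ContDiffOn.congr (f := fun x ↦ φ (x, σ x)) ?_ fun x hx ↦ (hU x hx).2.fderiv
    exact (hφ.of_le (by norm_cast; exact le_top)).comp (contDiffOn_id.prodMk ih)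
      fun x hx ↦ (hU x hx).1

end Frobenius

/-! ## Calculus in smooth charts -/

section SmoothChart

open Set Filter Topology

variable {E : Type*} [NormedAddCommGroup E] [NormedSpace ℝ E]
  {H : Type*} [TopologicalSpace H] {I : ModelWithCorners ℝ E H}
  {M : Type*} [TopologicalSpace M] [ChartedSpace H M]
  {F : Type*} [NormedAddCommGroup F] [NormedSpace ℝ F]
  {G : Type*} [NormedAddCommGroup G] [NormedSpace ℝ G]

lemma fderiv_clm_apply_const {f : E → F →L[ℝ] G} {x : E} (hf : DifferentiableAt ℝ f x) (v : F)
    (h : E) : fderiv ℝ (fun x ↦ f x v) x h = fderiv ℝ f x h v := by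
  rw [fderiv_clm_apply hf (differentiableAt_const v)]
  simp

lemma mvfderiv_fderiv_comp {x : M} {f : M → F} {h : F → G}
    (hh : DifferentiableAt ℝ h (f x)) (hf : MDifferentiableAt I 𝓘(ℝ, F) f x) :
    mvfderiv I (fun y ↦ h (f y)) x = fderiv ℝ h (f x) ∘L mvfderiv I f x := by
  have h1 := mfderiv_comp x hh.mdifferentiableAt hf
  rw [mfderiv_eq_fderiv] at h1
  exact h1

lemma mvfderiv_congr {x : M} {f g : M → F} (h : f =ᶠ[𝓝 x] g) :
    mvfderiv I f x = mvfderiv I g x :=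
  (h.mfderiv_eq : (mfderiv I 𝓘(ℝ, F) f x : TangentSpace I x →L[ℝ] F) = mfderiv I 𝓘(ℝ, F) g x)

variable (I) in
/-- A smooth chart: a diffeomorphism between open subsets of `M` and of the model vector space. -/
structure IsSmoothChart (e : OpenPartialHomeomorph M E) : Prop where
  contMDiffOn : ContMDiffOn I 𝓘(ℝ, E) ∞ e e.source
  contMDiffOn_symm : ContMDiffOn 𝓘(ℝ, E) I ∞ e.symm e.target

lemma IsHolomorphicChart.isSmoothChart {J : EndField I M} {e : OpenPartialHomeomorph M E}
    {j : E →L[ℝ] E} (he : IsHolomorphicChart J e j) : IsSmoothChart I e :=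
  ⟨he.contMDiffOn, he.contMDiffOn_symm⟩

variable (I) in
/-- The vector field which is constant equal to `u` in the chart `e`. -/
noncomputable def chartField (e : OpenPartialHomeomorph M E) (u : E) (x : M) : TangentSpace I x :=
  (mvfderiv I e x).inverse u

/-- The representation of a vector field in a chart. -/
noncomputable def chartVec (e : OpenPartialHomeomorph M E) (X : ∀ y : M, TangentSpace I y)
    (z : E) : E :=
  mvfderiv I e (e.symm z) (X (e.symm z))

/-- The representation of an endomorphism field in a chart. -/
noncomputable def chartEnd (e : OpenPartialHomeomorph M E) (J : EndField I M) (z : E) :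
    E →L[ℝ] E :=
  mvfderiv I e (e.symm z) ∘L J (e.symm z) ∘L (mvfderiv I e (e.symm z)).inverse

/-- The representation of a field of bilinear forms in a chart. -/
noncomputable def chartBilin (e : OpenPartialHomeomorph M E) (b : BilinField I M) (z : E) :
    E →L[ℝ] E →L[ℝ] ℝ :=
  pullbackForm (b (e.symm z)) (mvfderiv I e (e.symm z)).inverse

variable {e : OpenPartialHomeomorph M E}

lemma chartField_add (u v : E) : chartField I e (u + v) = chartField I e u + chartField I e v :=
  funext fun x ↦ map_add (mvfderiv I e x).inverse u v

lemma chartField_smul (c : ℝ) (u : E) : chartField I e (c • u) = c • chartField I e u :=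
  funext fun x ↦ map_smul (mvfderiv I e x).inverse c u

lemma eventually_mvfderiv_eq_chartVec {x : M} (hx : x ∈ e.source) (X : ∀ y : M, TangentSpace I y) :
    ∀ᶠ y in 𝓝 x, mvfderiv I e y (X y) = chartVec e X (e y) := by
  filter_upwards [e.open_source.mem_nhds hx] with y hy
  rw [chartVec, e.left_inv hy]

namespace IsSmoothChart

variable (he : IsSmoothChart I e) {x : M}
include he

lemma contMDiffAt (hx : x ∈ e.source) : ContMDiffAt I 𝓘(ℝ, E) ∞ e x :=
  he.contMDiffOn.contMDiffAt (e.open_source.mem_nhds hx)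

lemma contMDiffAt_symm {z : E} (hz : z ∈ e.target) : ContMDiffAt 𝓘(ℝ, E) I ∞ e.symm z :=
  he.contMDiffOn_symm.contMDiffAt (e.open_target.mem_nhds hz)

lemma mdifferentiableAt (hx : x ∈ e.source) : MDifferentiableAt I 𝓘(ℝ, E) e x :=
  (he.contMDiffAt hx).mdifferentiableAt (by simp)

lemma mdifferentiableAt_symm {z : E} (hz : z ∈ e.target) :
    MDifferentiableAt 𝓘(ℝ, E) I e.symm z :=
  (he.contMDiffAt_symm hz).mdifferentiableAt (by simp)

lemma mvfderiv_mfderiv_symm {z : E} (hz : z ∈ e.target) (u : E) :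
    mvfderiv I e (e.symm z) (mfderiv 𝓘(ℝ, E) I e.symm z u) = u := by
  have h := mfderiv_comp z (he.mdifferentiableAt (e.map_target hz)) (he.mdifferentiableAt_symm hz)
  have h1 : (e ∘ e.symm) =ᶠ[𝓝 z] id := by
    filter_upwards [e.open_target.mem_nhds hz] with y hy using e.right_inv hy
  rw [h1.mfderiv_eq, mfderiv_id] at h
  exact congr($h u).symm

lemma mfderiv_symm_mvfderiv (hx : x ∈ e.source) (v : TangentSpace I x) :
    mfderiv 𝓘(ℝ, E) I e.symm (e x) (mvfderiv I e x v) = v := by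
  have h := mfderiv_comp x (he.mdifferentiableAt_symm (e.map_source hx)) (he.mdifferentiableAt hx)
  have h1 : (e.symm ∘ e) =ᶠ[𝓝 x] id := by
    filter_upwards [e.open_source.mem_nhds hx] with y hy using e.left_inv hy
  rw [h1.mfderiv_eq, mfderiv_id] at h
  exact congr($h v).symm

lemma isInvertible (hx : x ∈ e.source) : (mvfderiv I e x).IsInvertible := by
  refine ContinuousLinearMap.IsInvertible.of_inverse
    (g := (mfderiv 𝓘(ℝ, E) I e.symm (e x) : E →L[ℝ] E)) ?_ ?_
  · ext u
    have h := he.mvfderiv_mfderiv_symm (e.map_source hx) u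
    rw [e.left_inv hx] at h
    exact h
  · ext v
    exact he.mfderiv_symm_mvfderiv hx v

lemma mvfderiv_chartField (hx : x ∈ e.source) (u : E) :
    mvfderiv I e x (chartField I e u x) = u :=
  (he.isInvertible hx).self_apply_inverse u

lemma eventually_mvfderiv_chartField (hx : x ∈ e.source) (u : E) :
    ∀ᶠ y in 𝓝 x, mvfderiv I e y (chartField I e u y) = u := by
  filter_upwards [e.open_source.mem_nhds hx] with y hy using he.mvfderiv_chartField hy u

lemma chartField_mvfderiv (hx : x ∈ e.source) (v : TangentSpace I x) :
    chartField I e (mvfderiv I e x v) x = v :=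
  (he.isInvertible hx).inverse_apply_self v

lemma mvfderiv_injective (hx : x ∈ e.source) {v w : TangentSpace I x}
    (h : mvfderiv I e x v = mvfderiv I e x w) : v = w :=
  (he.isInvertible hx).injective h

lemma mvfderiv_endField (J : EndField I M) (hx : x ∈ e.source) (v : TangentSpace I x) :
    mvfderiv I e x (J x v) = chartEnd e J (e x) (mvfderiv I e x v) := by
  have h : ∀ y, y = x → mvfderiv I e x (J x v) =
      mvfderiv I e y (J y ((mvfderiv I e y).inverse (mvfderiv I e x v))) := by
    rintro _ rfl
    rw [(he.isInvertible hx).inverse_apply_self]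
  exact h _ (e.left_inv hx)

lemma bilinField_apply (b : BilinField I M) (hx : x ∈ e.source) (v w : TangentSpace I x) :
    b x v w = chartBilin e b (e x) (mvfderiv I e x v) (mvfderiv I e x w) := by
  have h : ∀ y, y = x → b x v w = b y ((mvfderiv I e y).inverse (mvfderiv I e x v))
      ((mvfderiv I e y).inverse (mvfderiv I e x w)) := by
    rintro _ rfl
    rw [(he.isInvertible hx).inverse_apply_self, (he.isInvertible hx).inverse_apply_self]
  exact h _ (e.left_inv hx)

lemma mvfderiv_eq_fderiv (hx : x ∈ e.source) {f : M → G} {h : E → G}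
    (hh : DifferentiableAt ℝ h (e x)) (hf : ∀ᶠ y in 𝓝 x, f y = h (e y)) (v : TangentSpace I x) :
    mvfderiv I f x v = fderiv ℝ h (e x) (mvfderiv I e x v) := by
  rw [mvfderiv_congr hf, mvfderiv_fderiv_comp hh (he.mdifferentiableAt hx),
    ContinuousLinearMap.comp_apply]

lemma mvfderiv_mfderiv_symm_comp {f : G → E} {u : G} (hf : DifferentiableAt ℝ f u)
    (hu : f u ∈ e.target) (a : G) :
    mvfderiv I e (e.symm (f u)) (mfderiv 𝓘(ℝ, G) I (fun u ↦ e.symm (f u)) u a) =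
      fderiv ℝ f u a := by
  have h := mfderiv_comp u (he.mdifferentiableAt_symm hu) hf.mdifferentiableAt
  rw [mfderiv_eq_fderiv] at h
  exact (congrArg (mvfderiv I e (e.symm (f u))) congr($h a)).trans (he.mvfderiv_mfderiv_symm hu _)

lemma contDiffOn_comp_symm {f : M → G}
    (hf : ∀ x ∈ e.source, ContMDiffAt I 𝓘(ℝ, G) ∞ f x) :
    ContDiffOn ℝ ∞ (fun z ↦ f (e.symm z)) e.target := by
  intro z hz
  have h := (hf _ (e.map_target hz)).comp z (he.contMDiffAt_symm hz)
  exact h.contDiffAt.contDiffWithinAt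

end IsSmoothChart

theorem isIntegrableDistribution_of_chart {V : Type*} [NormedAddCommGroup V] [NormedSpace ℝ V]
    [FiniteDimensional ℝ V] {D : ∀ x : M, Submodule ℝ (TangentSpace I x)}
    (h : ∀ x : M, ∃ (e : OpenPartialHomeomorph M E) (O : Set V) (v₀ : V) (f : V → E),
      IsSmoothChart I e ∧ x ∈ e.source ∧ IsOpen O ∧ v₀ ∈ O ∧ f v₀ = e x ∧
      ContDiffOn ℝ ∞ f O ∧ MapsTo f O e.target ∧
      ∀ v ∈ O, Function.Injective (fderiv ℝ f v) ∧
        ∀ w : TangentSpace I (e.symm (f v)), w ∈ D (e.symm (f v)) ↔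
          ∃ a, fderiv ℝ f v a = mvfderiv I e (e.symm (f v)) w) :
    IsIntegrableDistribution D := by
  intro x
  obtain ⟨e, O, v₀, f, he, hx, hO, hv₀, hfv₀, hf, hft, hD⟩ := h x
  let L : EuclideanSpace ℝ (Fin (Module.finrank ℝ V)) ≃L[ℝ] V :=
    ContinuousLinearEquiv.ofFinrankEq (by simp)
  have hL : ContDiff ℝ ∞ fun u ↦ v₀ + L u := by fun_prop
  refine ⟨Module.finrank ℝ V, (fun u ↦ v₀ + L u) ⁻¹' O, fun u ↦ e.symm (f (v₀ + L u)),
    hO.preimage hL.continuous, by simpa using hv₀, by simp [hfv₀, e.left_inv hx],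
    he.contMDiffOn_symm.comp (hf.comp hL.contDiffOn fun u hu ↦ hu).contMDiffOn fun u hu ↦ hft hu,
    fun u hu ↦ ?_⟩
  obtain ⟨hinj, hw⟩ := hD _ hu
  have hfL : HasFDerivAt (fun u ↦ f (v₀ + L u)) (fderiv ℝ f (v₀ + L u) ∘L (L : _ →L[ℝ] V)) u :=
    ((hf.contDiffAt (hO.mem_nhds hu)).differentiableAt (by simp)).hasFDerivAt.comp u
      (L.hasFDerivAt.const_add v₀)
  have hderiv : ∀ a, mvfderiv I e (e.symm (f (v₀ + L u)))
      (mfderiv 𝓘(ℝ, EuclideanSpace ℝ (Fin (Module.finrank ℝ V))) I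
        (fun u ↦ e.symm (f (v₀ + L u))) u a) = fderiv ℝ f (v₀ + L u) (L a) := fun a ↦
    (he.mvfderiv_mfderiv_symm_comp hfL.differentiableAt (hft hu) a).trans congr($(hfL.fderiv) a)
  constructor
  · intro a b hab
    exact L.injective (hinj (by rw [← hderiv, ← hderiv, hab]))
  · ext w
    rw [hw w]
    constructor
    · rintro ⟨a, rfl⟩
      exact ⟨L a, (hderiv a).symm⟩
    · rintro ⟨a, ha⟩
      refine ⟨L.symm a, he.mvfderiv_injective (e.map_target (hft hu)) ((hderiv _).trans ?_)⟩
      rw [L.apply_symm_apply, ha]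

variable [IsManifold I ∞ M]

lemma eventually_mem_baseSet {x : M} : ∀ᶠ y in 𝓝 x,
    y ∈ (trivializationAt E (TangentSpace I : M → Type _) x).baseSet :=
  (trivializationAt E (TangentSpace I : M → Type _) x).open_baseSet.mem_nhds
    (FiberBundle.mem_baseSet_trivializationAt' x)

lemma mvfderiv_comp_symmL_trivialization {x y : M}
    (hy : y ∈ (trivializationAt E (TangentSpace I : M → Type _) x).baseSet)
    (v : TangentSpace I y) :
    (mvfderiv I e y ∘L (trivializationAt E (TangentSpace I) x).symmL ℝ y : E →L[ℝ] E)
      (trivializationAt E (TangentSpace I : M → Type _) x ⟨y, v⟩).2 = mvfderiv I e y v := by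
  have h := (trivializationAt E (TangentSpace I : M → Type _) x).symmL_continuousLinearMapAt
    (R := ℝ) hy v
  rw [Trivialization.continuousLinearMapAt_apply, Trivialization.linearMapAt_apply,
    if_pos hy] at h
  rw [ContinuousLinearMap.comp_apply]
  exact congrArg _ h

lemma trivializationAt_dual_apply {x y : M}
    (L : TangentSpace I y →L[ℝ] Trivial M ℝ y) (v : E) :
    (trivializationAt (E →L[ℝ] ℝ) (fun x : M ↦ TangentSpace I x →L[ℝ] Trivial M ℝ x) x
      ⟨y, L⟩).2 v = L ((trivializationAt E (TangentSpace I) x).symmL ℝ y v) := by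
  rw [hom_trivializationAt_apply]
  simp only [ContinuousLinearMap.inCoordinates]
  exact congr($(Trivial.continuousLinearMapAt_trivialization (𝕜 := ℝ) (B := M) (F := ℝ) y) _)

namespace IsSmoothChart

variable (he : IsSmoothChart I e) {x : M}
include he

lemma contMDiffAt_mvfderiv_comp_symmL (hx : x ∈ e.source) :
    ContMDiffAt I 𝓘(ℝ, E →L[ℝ] E) ∞ (fun y ↦
      (mvfderiv I e y ∘L (trivializationAt E (TangentSpace I) x).symmL ℝ y : E →L[ℝ] E)) x := by
  have h := (he.contMDiffAt hx).mfderiv_const (m := ∞) (by simp)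
  refine h.congr_of_eventuallyEq (Eventually.of_forall fun y ↦ ?_)
  ext u
  simp only [inTangentCoordinates, ContinuousLinearMap.inCoordinates]
  rw [TangentBundle.continuousLinearMapAt_model_space]
  rfl

lemma isInvertible_mvfderiv_comp_symmL {y : M} (hy : y ∈ e.source)
    (hy' : y ∈ (trivializationAt E (TangentSpace I) x).baseSet) :
    (mvfderiv I e y ∘L (trivializationAt E (TangentSpace I) x).symmL ℝ y :
      E →L[ℝ] E).IsInvertible := by
  refine (he.isInvertible hy).comp
    ⟨((trivializationAt E (TangentSpace I) x).continuousLinearEquivAt ℝ y hy').symm, ?_⟩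
  ext u
  exact congrFun (Trivialization.symm_continuousLinearEquivAt_eq _ hy') u

lemma contMDiffAt_bilinField (hx : x ∈ e.source) {b : BilinField I M}
    {B : E → E →L[ℝ] E →L[ℝ] ℝ} (hB : ContDiffAt ℝ ∞ B (e x))
    (hb : ∀ y ∈ e.source, ∀ v w, b y v w = B (e y) (mvfderiv I e y v) (mvfderiv I e y w)) :
    ContMDiffAt I (I.prod 𝓘(ℝ, E →L[ℝ] E →L[ℝ] ℝ)) ∞
      (fun y ↦ TotalSpace.mk' (E →L[ℝ] E →L[ℝ] ℝ)
      (E := fun x : M ↦ TangentSpace I x →L[ℝ] TangentSpace I x →L[ℝ] ℝ) y (b y)) x := by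
  rw [contMDiffAt_hom_bundle]
  refine ⟨contMDiffAt_id, ?_⟩
  have h1 := he.contMDiffAt_mvfderiv_comp_symmL hx
  have h3 : ContMDiffAt I 𝓘(ℝ, E →L[ℝ] E →L[ℝ] ℝ) ∞ (fun y ↦ B (e y)) x :=
    hB.contMDiffAt.comp x (he.contMDiffAt hx)
  refine ((h1.clm_precomp (F₃ := ℝ)).clm_comp (h3.clm_comp h1)).congr_of_eventuallyEq ?_
  filter_upwards [eventually_mem_baseSet (I := I), e.open_source.mem_nhds hx] with y hy hy'
  ext u v
  have hy2 : y ∈ (trivializationAt (E →L[ℝ] ℝ)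
      (fun x : M ↦ TangentSpace I x →L[ℝ] Trivial M ℝ x) x).baseSet := ⟨hy, trivial⟩
  have key : ∀ L : TangentSpace I y →L[ℝ] Trivial M ℝ y,
      (trivializationAt (E →L[ℝ] ℝ)
        (fun x : M ↦ TangentSpace I x →L[ℝ] Trivial M ℝ x) x).continuousLinearMapAt ℝ y L v =
      L ((trivializationAt E (TangentSpace I) x).symmL ℝ y v) := by
    intro L
    rw [Trivialization.continuousLinearMapAt_apply, Trivialization.linearMapAt_apply,
      if_pos hy2]
    exact trivializationAt_dual_apply L v
  exact (key _).trans (hb y hy' _ _)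

variable [CompleteSpace E]

lemma contMDiffAt_inverse_mvfderiv_comp_symmL (hx : x ∈ e.source) :
    ContMDiffAt I 𝓘(ℝ, E →L[ℝ] E) ∞ (fun y ↦
      (mvfderiv I e y ∘L (trivializationAt E (TangentSpace I) x).symmL ℝ y :
        E →L[ℝ] E).inverse) x := by
  obtain ⟨A, hA⟩ := he.isInvertible_mvfderiv_comp_symmL hx
    (FiberBundle.mem_baseSet_trivializationAt' x)
  have h := contDiffAt_map_inverse (n := ∞) A
  rw [hA] at h
  exact h.contMDiffAt.comp x (he.contMDiffAt_mvfderiv_comp_symmL hx)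

lemma contMDiffAt_section_iff (hx : x ∈ e.source)
    {Y : ∀ y : M, TangentSpace I y} :
    ContMDiffAt I (I.prod 𝓘(ℝ, E)) ∞ (T% Y) x ↔
      ContMDiffAt I 𝓘(ℝ, E) ∞ (fun y ↦ mvfderiv I e y (Y y)) x := by
  rw [contMDiffAt_section]
  constructor
  · intro h
    refine ((he.contMDiffAt_mvfderiv_comp_symmL hx).clm_apply h).congr_of_eventuallyEq ?_
    filter_upwards [eventually_mem_baseSet (I := I)] with y hy
    exact (mvfderiv_comp_symmL_trivialization hy _).symm
  · intro h
    refine ((he.contMDiffAt_inverse_mvfderiv_comp_symmL hx).clm_apply h).congr_of_eventuallyEq ?_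
    filter_upwards [eventually_mem_baseSet (I := I), e.open_source.mem_nhds hx] with y hy hy'
    rw [← mvfderiv_comp_symmL_trivialization (x := x) hy,
      (he.isInvertible_mvfderiv_comp_symmL hy' hy).inverse_apply_self]

lemma mdifferentiableAt_section_iff (hx : x ∈ e.source)
    {Y : ∀ y : M, TangentSpace I y} :
    MDifferentiableAt I (I.prod 𝓘(ℝ, E)) (T% Y) x ↔
      MDifferentiableAt I 𝓘(ℝ, E) (fun y ↦ mvfderiv I e y (Y y)) x := by
  rw [mdifferentiableAt_section]
  constructor
  · intro h
    refine (((he.contMDiffAt_mvfderiv_comp_symmL hx).mdifferentiableAt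
      (by simp)).clm_apply h).congr_of_eventuallyEq ?_
    filter_upwards [eventually_mem_baseSet (I := I)] with y hy
    exact (mvfderiv_comp_symmL_trivialization hy _).symm
  · intro h
    refine (((he.contMDiffAt_inverse_mvfderiv_comp_symmL hx).mdifferentiableAt
      (by simp)).clm_apply h).congr_of_eventuallyEq ?_
    filter_upwards [eventually_mem_baseSet (I := I), e.open_source.mem_nhds hx] with y hy hy'
    rw [← mvfderiv_comp_symmL_trivialization (x := x) hy,
      (he.isInvertible_mvfderiv_comp_symmL hy' hy).inverse_apply_self]

lemma mdifferentiableAt_of_eventually (hx : x ∈ e.source) {X : ∀ y : M, TangentSpace I y}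
    {X' : E → E} (hX : DifferentiableAt ℝ X' (e x))
    (hXX' : ∀ᶠ y in 𝓝 x, mvfderiv I e y (X y) = X' (e y)) : MDiffAt (T% X) x :=
  (he.mdifferentiableAt_section_iff hx).2
    ((hX.mdifferentiableAt.comp x (he.mdifferentiableAt hx)).congr_of_eventuallyEq hXX')

lemma differentiableAt_chartVec (hx : x ∈ e.source) {X : ∀ y : M, TangentSpace I y}
    (hX : MDiffAt (T% X) x) : DifferentiableAt ℝ (chartVec e X) (e x) := by
  have h := (he.mdifferentiableAt_section_iff hx).1 hX
  rw [← e.left_inv hx] at h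
  exact (h.comp (e x) (he.mdifferentiableAt_symm (e.map_source hx))).differentiableAt

lemma contMDiffAt_chartField_comp (hx : x ∈ e.source) {f : M → E}
    (hf : ContMDiffAt I 𝓘(ℝ, E) ∞ f x) :
    ContMDiffAt I (I.prod 𝓘(ℝ, E)) ∞ (T% fun y ↦ chartField I e (f y) y) x := by
  rw [he.contMDiffAt_section_iff hx]
  refine hf.congr_of_eventuallyEq ?_
  filter_upwards [e.open_source.mem_nhds hx] with y hy using he.mvfderiv_chartField hy _

lemma contMDiffAt_chartField (hx : x ∈ e.source) (u : E) :
    ContMDiffAt I (I.prod 𝓘(ℝ, E)) ∞ (T% (chartField I e u)) x :=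
  he.contMDiffAt_chartField_comp hx contMDiffAt_const

lemma mdifferentiableAt_chartField (hx : x ∈ e.source) (u : E) :
    MDifferentiableAt I (I.prod 𝓘(ℝ, E)) (T% (chartField I e u)) x :=
  (he.contMDiffAt_chartField hx u).mdifferentiableAt (by simp)

lemma contMDiffAt_endField (hx : x ∈ e.source) {J : EndField I M}
    {A : E → E →L[ℝ] E} (hA : ContDiffAt ℝ ∞ A (e x))
    (hJ : ∀ y ∈ e.source, ∀ v, mvfderiv I e y (J y v) = A (e y) (mvfderiv I e y v)) :
    ContMDiffAt I (I.prod 𝓘(ℝ, E →L[ℝ] E)) ∞ (fun y ↦ TotalSpace.mk' (E →L[ℝ] E)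
      (E := fun x : M ↦ TangentSpace I x →L[ℝ] TangentSpace I x) y (J y)) x := by
  rw [contMDiffAt_hom_bundle]
  refine ⟨contMDiffAt_id, ?_⟩
  have h1 := he.contMDiffAt_mvfderiv_comp_symmL hx
  have h2 := he.contMDiffAt_inverse_mvfderiv_comp_symmL hx
  have h3 : ContMDiffAt I 𝓘(ℝ, E →L[ℝ] E) ∞ (fun y ↦ A (e y)) x :=
    hA.contMDiffAt.comp x (he.contMDiffAt hx)
  refine (h2.clm_comp (h3.clm_comp h1)).congr_of_eventuallyEq ?_
  filter_upwards [eventually_mem_baseSet (I := I), e.open_source.mem_nhds hx] with y hy hy'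
  ext u
  refine (he.isInvertible_mvfderiv_comp_symmL hy' hy).injective ?_
  refine Eq.trans ?_
    ((he.isInvertible_mvfderiv_comp_symmL hy' hy).self_apply_inverse _).symm
  simp only [ContinuousLinearMap.inCoordinates, ContinuousLinearMap.comp_apply]
  rw [Trivialization.symmL_continuousLinearMapAt _ hy, hJ y hy']
  rfl

omit [CompleteSpace E] in
lemma contDiffOn_chartEnd [FiniteDimensional ℝ E] {J : EndField I M}
    (hJ : ∀ x ∈ e.source, ContMDiffAt I (I.prod 𝓘(ℝ, E →L[ℝ] E)) ∞
      (fun x ↦ TotalSpace.mk' (E →L[ℝ] E)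
        (E := fun x : M ↦ TangentSpace I x →L[ℝ] TangentSpace I x) x (J x)) x) :
    ContDiffOn ℝ ∞ (chartEnd e J) e.target := by
  rw [contDiffOn_clm_apply]
  intro u
  refine (he.contDiffOn_comp_symm (f := fun y ↦ mvfderiv I e y (J y (chartField I e u y)))
    fun x hx ↦ ?_).congr fun z _ ↦ rfl
  exact (he.contMDiffAt_section_iff hx).1
    (ContMDiffAt.clm_bundle_apply (hJ x hx) (he.contMDiffAt_chartField hx u))

omit [CompleteSpace E] in
lemma contDiffOn_chartBilin [FiniteDimensional ℝ E] {b : BilinField I M} (hb : b.IsSmooth) :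
    ContDiffOn ℝ ∞ (chartBilin e b) e.target := by
  rw [contDiffOn_clm_apply]
  intro u
  rw [contDiffOn_clm_apply]
  intro v
  refine (he.contDiffOn_comp_symm
    (f := fun y ↦ b y (chartField I e u y) (chartField I e v y)) fun x hx ↦ ?_).congr
    fun z _ ↦ rfl
  have h := ContMDiffAt.clm_bundle_apply₂ (F₃ := ℝ) (E₃ := Trivial M ℝ) (hb x)
    (he.contMDiffAt_chartField hx u) (he.contMDiffAt_chartField hx v)
  rw [contMDiffAt_totalSpace] at h
  exact h.2

lemma mvfderiv_mlieBracket (hx : x ∈ e.source) {X Y : ∀ y : M, TangentSpace I y}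
    {X' Y' : E → E} (hX : DifferentiableAt ℝ X' (e x)) (hY : DifferentiableAt ℝ Y' (e x))
    (hXX' : ∀ᶠ y in 𝓝 x, mvfderiv I e y (X y) = X' (e y))
    (hYY' : ∀ᶠ y in 𝓝 x, mvfderiv I e y (Y y) = Y' (e y)) :
    mvfderiv I e x (VectorField.mlieBracket I X Y x) =
      fderiv ℝ Y' (e x) (X' (e x)) - fderiv ℝ X' (e x) (Y' (e x)) := by
  have : IsManifold I (minSmoothness ℝ 2) M := by
    rw [minSmoothness_of_isRCLikeNormedField]
    exact IsManifold.of_le (n := ∞) (by norm_cast)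
  have mdiff : ∀ {V : ∀ z : E, TangentSpace 𝓘(ℝ, E) z}, DifferentiableAt ℝ (V : E → E) (e x) →
      MDiffAt (T% V) (e x) := by
    intro V hV
    rw [mdifferentiableAt_section]
    simp only [trivializationAt_model_space_apply]
    exact hV.mdifferentiableAt
  have mpullback : ∀ {Z : ∀ y : M, TangentSpace I y} {V : ∀ z : E, TangentSpace 𝓘(ℝ, E) z},
      (∀ᶠ y in 𝓝 x, mvfderiv I e y (Z y) = V (e y)) →
      VectorField.mpullback I 𝓘(ℝ, E) e V =ᶠ[𝓝 x] Z := by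
    intro Z V hZV
    filter_upwards [hZV, e.open_source.mem_nhds hx] with y hy hy'
    change (mvfderiv I e y).inverse (V (e y)) = Z y
    rw [← hy, (he.isInvertible hy').inverse_apply_self]
  let VX : ∀ z : E, TangentSpace 𝓘(ℝ, E) z := X'
  let VY : ∀ z : E, TangentSpace 𝓘(ℝ, E) z := Y'
  have h := VectorField.mpullback_mlieBracket (V := VX) (W := VY) (mdiff hX) (mdiff hY)
    (he.contMDiffAt hx) (by rw [minSmoothness_of_isRCLikeNormedField]; norm_cast)
  rw [(mpullback hXX').mlieBracket_vectorField_eq (mpullback hYY')] at h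
  rw [← h]
  refine ((he.isInvertible hx).self_apply_inverse _).trans ?_
  rw [← VectorField.mlieBracketWithin_univ, VectorField.mlieBracketWithin_eq_lieBracketWithin,
    VectorField.lieBracketWithin_univ]
  rfl

lemma mlieBracket_eq_zero (hx : x ∈ e.source) {X Y : ∀ y : M, TangentSpace I y} {u v : E}
    (hX : ∀ᶠ y in 𝓝 x, mvfderiv I e y (X y) = u) (hY : ∀ᶠ y in 𝓝 x, mvfderiv I e y (Y y) = v) :
    VectorField.mlieBracket I X Y x = 0 := by
  apply he.mvfderiv_injective hx
  rw [he.mvfderiv_mlieBracket hx (differentiableAt_const u) (differentiableAt_const v) hX hY]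
  simp

lemma mvfderiv_bilinField_apply (hx : x ∈ e.source) {Ω : BilinField I M}
    {B : E → E →L[ℝ] E →L[ℝ] ℝ} (hB : DifferentiableAt ℝ B (e x))
    (hΩ : ∀ y ∈ e.source, ∀ v w, Ω y v w = B (e y) (mvfderiv I e y v) (mvfderiv I e y w))
    {Y Z : ∀ y : M, TangentSpace I y} (hY : MDiffAt (T% Y) x) (hZ : MDiffAt (T% Z) x)
    (v : TangentSpace I x) :
    mvfderiv I (fun y ↦ Ω y (Y y) (Z y)) x v =
      fderiv ℝ B (e x) (mvfderiv I e x v) (chartVec e Y (e x)) (chartVec e Z (e x))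
        + B (e x) (fderiv ℝ (chartVec e Y) (e x) (mvfderiv I e x v)) (chartVec e Z (e x))
        + B (e x) (chartVec e Y (e x)) (fderiv ℝ (chartVec e Z) (e x) (mvfderiv I e x v)) := by
  have hBYZ := (hB.hasFDerivAt.clm_apply (he.differentiableAt_chartVec hx hY).hasFDerivAt).clm_apply
    (he.differentiableAt_chartVec hx hZ).hasFDerivAt
  rw [he.mvfderiv_eq_fderiv hx hBYZ.differentiableAt, hBYZ.fderiv]
  · simp
    ring
  · filter_upwards [eventually_mvfderiv_eq_chartVec hx Y, eventually_mvfderiv_eq_chartVec hx Z,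
      e.open_source.mem_nhds hx] with y hyY hyZ hy
    rw [hΩ y hy, hyY, hyZ]

end IsSmoothChart

theorem isClosedForm_of_chart [CompleteSpace E] {Ω : BilinField I M}
    (h : ∀ x : M, ∃ (e : OpenPartialHomeomorph M E) (B : E → E →L[ℝ] E →L[ℝ] ℝ),
      IsSmoothChart I e ∧ x ∈ e.source ∧ DifferentiableAt ℝ B (e x) ∧
      (∀ y ∈ e.source, ∀ v w, Ω y v w = B (e y) (mvfderiv I e y v) (mvfderiv I e y w)) ∧
      (∀ u v, B (e x) u v = -B (e x) v u) ∧
      (∀ u v w, fderiv ℝ B (e x) u v w - fderiv ℝ B (e x) v u w + fderiv ℝ B (e x) w u v = 0)) :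
    IsClosedForm Ω := by
  intro x X Y Z hX hY hZ
  obtain ⟨e, B, he, hx, hB, hΩ, hskew, hd⟩ := h x
  have bracket : ∀ {X Y : ∀ y : M, TangentSpace I y}, MDiffAt (T% X) x → MDiffAt (T% Y) x → _ :=
    fun {X Y} hX hY ↦ he.mvfderiv_mlieBracket hx (he.differentiableAt_chartVec hx hX)
      (he.differentiableAt_chartVec hx hY) (eventually_mvfderiv_eq_chartVec hx X)
      (eventually_mvfderiv_eq_chartVec hx Y)
  rw [he.mvfderiv_bilinField_apply hx hB hΩ hY hZ, he.mvfderiv_bilinField_apply hx hB hΩ hX hZ,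
    he.mvfderiv_bilinField_apply hx hB hΩ hX hY, hΩ x hx, hΩ x hx, hΩ x hx, bracket hX hY,
    bracket hX hZ, bracket hY hZ, (eventually_mvfderiv_eq_chartVec hx X).self_of_nhds,
    (eventually_mvfderiv_eq_chartVec hx Y).self_of_nhds,
    (eventually_mvfderiv_eq_chartVec hx Z).self_of_nhds]
  set X' := chartVec e X
  set Y' := chartVec e Y
  set Z' := chartVec e Z
  have hd' := hd (X' (e x)) (Y' (e x)) (Z' (e x))
  simp only [map_sub, _root_.sub_apply]
  rw [hskew (X' (e x)) (fderiv ℝ Z' (e x) (Y' (e x))),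
    hskew (X' (e x)) (fderiv ℝ Y' (e x) (Z' (e x))),
    hskew (Y' (e x)) (fderiv ℝ Z' (e x) (X' (e x)))]
  linarith

end SmoothChart

/-! ## Linear connections in smooth charts -/

section Connection

open Set Filter Topology

variable {E : Type*} [NormedAddCommGroup E] [NormedSpace ℝ E]
  {H : Type*} [TopologicalSpace H] {I : ModelWithCorners ℝ E H}
  {M : Type*} [TopologicalSpace M] [ChartedSpace H M]
  {e : OpenPartialHomeomorph M E}

lemma IsSmoothChart.exists_restr (he : IsSmoothChart I e) {x : M} (hx : x ∈ e.source) :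
    ∃ e' : OpenPartialHomeomorph M E, IsSmoothChart I e' ∧ x ∈ e'.source ∧
      (e' : M → E) = e ∧ e'.source ⊆ e.source ∧ ∃ r, e'.target = Metric.ball (e x) r := by
  obtain ⟨r, hr, hball⟩ := Metric.mem_nhds_iff.1 (e.open_target.mem_nhds (e.map_source hx))
  let e' := (e.symm.restrOpen (Metric.ball (e x) r) Metric.isOpen_ball).symm
  have hs : e'.source ⊆ e.source := by
    intro y hy
    have hy' : e' y ∈ e.target ∩ Metric.ball (e x) r := e'.map_source hy
    rw [← e'.left_inv hy]
    exact e.map_target hy'.1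
  refine ⟨e', ⟨he.contMDiffOn.mono hs, he.contMDiffOn_symm.mono inter_subset_left⟩, ?_, rfl, hs, r,
    inter_eq_right.2 hball⟩
  have hx' : e'.symm (e x) ∈ e'.source :=
    e'.map_target ⟨e.map_source hx, Metric.mem_ball_self hr⟩
  rwa [show e'.symm (e x) = x from e.left_inv hx] at hx'

variable [IsManifold I ∞ M]

lemma exists_contMDiff_section_eventuallyEq [FiniteDimensional ℝ E] [T2Space M]
    {Y : ∀ y : M, TangentSpace I y} {U : Set M} (hU : IsOpen U)
    (hY : ∀ y ∈ U, ContMDiffAt I (I.prod 𝓘(ℝ, E)) ∞ (T% Y) y) {x : M} (hx : x ∈ U) :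
    ∃ Y' : ∀ y : M, TangentSpace I y, CMDiff ∞ (T% Y') ∧ ∀ᶠ y in 𝓝 x, Y' y = Y y := by
  obtain ⟨f, hf⟩ := (SmoothBumpFunction.nhds_basis_tsupport (I := I) x).mem_iff.1
    (hU.mem_nhds hx)
  refine ⟨fun y ↦ f y • Y y, ?_, ?_⟩
  · exact ContMDiffOn.smul_section_of_tsupport f.contMDiff.contMDiffOn hU hf.2
      fun y hy ↦ (hY y hy).contMDiffWithinAt
  · filter_upwards [f.eventuallyEq_one] with y hy
    rw [hy, Pi.one_apply, one_smul]

variable {D : CovariantDerivative I E (TangentSpace I : M → Type _)}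
  {Γ : E → E →L[ℝ] E →L[ℝ] E}

lemma covariantDerivative_congr_of_eventuallyEq {x : M} {Y Y' : ∀ y : M, TangentSpace I y}
    (hY : MDiffAt (T% Y) x) (h : ∀ᶠ y in 𝓝 x, Y' y = Y y) : D Y' x = D Y x := by
  have hY' : MDiffAt (T% Y') x := by
    refine hY.congr_of_eventuallyEq ?_
    filter_upwards [h] with y hy
    rw [hy]
  exact D.isCovariantDerivativeOnUniv.congr_of_eventuallyEq hY' hY univ_mem h

variable (D) in
/-- `Γ` are the Christoffel symbols of the connection `D` in the chart `e`: for the constant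
vector field `u`, the coordinates of `D u` in the direction `v` are `Γ v u`. -/
def IsChristoffel (e : OpenPartialHomeomorph M E) (Γ : E → E →L[ℝ] E →L[ℝ] E) : Prop :=
  ∀ x ∈ e.source, ∀ (u : E) (v : TangentSpace I x),
    D (chartField I e u) x v = chartField I e (Γ (e x) (mvfderiv I e x v) u) x

variable (D) in
/-- A chart is flat if its coordinate vector fields are parallel. -/
def IsFlatChart (e : OpenPartialHomeomorph M E) : Prop :=
  ∀ x ∈ e.source, ∀ u, D (chartField I e u) x = 0

lemma IsFlatChart.isChristoffel (h : IsFlatChart D e) : IsChristoffel D e 0 := by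
  intro x hx u v
  rw [h x hx, Pi.zero_apply]
  exact (map_zero (mvfderiv I e x).inverse).symm

section Christoffel

variable [FiniteDimensional ℝ E]

theorem exists_isChristoffel [T2Space M] (hD : D.ContMDiffCovariantDerivative ∞)
    (he : IsSmoothChart I e) :
    ∃ Γ : E → E →L[ℝ] E →L[ℝ] E, ContDiffOn ℝ ∞ Γ e.target ∧ IsChristoffel D e Γ := by
  let b := Module.finBasis ℝ E
  let c : Fin (Module.finrank ℝ E) → E →L[ℝ] ℝ := fun i ↦
    LinearMap.toContinuousLinearMap (b.coord i)
  refine ⟨fun z ↦ ∑ i, ContinuousLinearMap.smulRightL ℝ E E (c i) ∘L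
    chartEnd e (fun y ↦ D (chartField I e (b i)) y) z, ?_, ?_⟩
  · refine ContDiffOn.sum fun i _ ↦ contDiffOn_const.clm_comp ?_
    refine he.contDiffOn_chartEnd fun x hx ↦ ?_
    obtain ⟨Y, hY, hYe⟩ := exists_contMDiff_section_eventuallyEq e.open_source
      (fun y hy ↦ he.contMDiffAt_chartField hy (b i)) hx
    have h := hD.contMDiff.contMDiff (σ := Y) (by simpa using hY.contMDiffOn)
    refine (h.contMDiffAt univ_mem).congr_of_eventuallyEq ?_
    filter_upwards [hYe.eventually_nhds, e.open_source.mem_nhds hx] with y hy hy'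
    rw [covariantDerivative_congr_of_eventuallyEq (he.mdifferentiableAt_chartField hy' (b i)) hy]
  · intro x hx u v
    let L : E →ₗ[ℝ] (TangentSpace I x →L[ℝ] TangentSpace I x) :=
      { toFun := fun u ↦ D (chartField I e u) x
        map_add' := fun u u' ↦ by
          rw [chartField_add, D.isCovariantDerivativeOnUniv.add
            (he.mdifferentiableAt_chartField hx u) (he.mdifferentiableAt_chartField hx u')]
        map_smul' := fun a u ↦ by
          rw [chartField_smul, D.isCovariantDerivativeOnUniv.smul_const a
            (he.mdifferentiableAt_chartField hx u)]
          rfl }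
    apply he.mvfderiv_injective hx
    rw [he.mvfderiv_chartField hx]
    change mvfderiv I e x (L u v) = _
    conv_lhs => rw [← b.sum_repr u]
    simp only [map_sum, map_smul, _root_.sum_apply, _root_.smul_apply,
      ContinuousLinearMap.comp_apply, ← he.mvfderiv_endField _ hx]
    rfl

lemma tensorialAt_mvfderiv_sub_mvfderiv (he : IsSmoothChart I e) {x : M} (hx : x ∈ e.source)
    (v : TangentSpace I x) :
    TensorialAt I E (fun Y : ∀ y : M, TangentSpace I y ↦
      (mvfderiv I e x (D Y x v) - mvfderiv I (fun y ↦ mvfderiv I e y (Y y)) x v : E)) x := by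
  constructor
  · intro f σ hf hσ
    have hσ' := (he.mdifferentiableAt_section_iff hx).1 hσ
    have hsmul : (fun y ↦ mvfderiv I e y ((f • σ) y)) = fun y ↦ f y • mvfderiv I e y (σ y) :=
      funext fun y ↦ map_smul _ _ _
    rw [hsmul, mvfderiv_fun_smul hf hσ', D.isCovariantDerivativeOnUniv.leibniz hσ hf]
    simp only [_root_.add_apply, _root_.smul_apply, ContinuousLinearMap.smulRight_apply, map_add,
      map_smul]
    module
  · intro σ τ hσ hτ
    have hσ' := (he.mdifferentiableAt_section_iff hx).1 hσ
    have hτ' := (he.mdifferentiableAt_section_iff hx).1 hτ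
    have hadd : (fun y ↦ mvfderiv I e y ((σ + τ) y)) =
        fun y ↦ mvfderiv I e y (σ y) + mvfderiv I e y (τ y) := funext fun y ↦ map_add _ _ _
    rw [hadd, mvfderiv_fun_add hσ' hτ', D.isCovariantDerivativeOnUniv.add hσ hτ]
    simp only [_root_.add_apply, map_add]
    abel

namespace IsChristoffel

/-- Both sides being tensorial in `Y`, it suffices to compare them on chart fields. -/
theorem mvfderiv_apply (hΓ : IsChristoffel D e Γ) (he : IsSmoothChart I e) {x : M}
    (hx : x ∈ e.source) {Y : ∀ y : M, TangentSpace I y} {Y' : E → E}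
    (hY' : DifferentiableAt ℝ Y' (e x)) (hYY' : ∀ᶠ y in 𝓝 x, mvfderiv I e y (Y y) = Y' (e y))
    (v : TangentSpace I x) :
    mvfderiv I e x (D Y x v) =
      fderiv ℝ Y' (e x) (mvfderiv I e x v) + Γ (e x) (mvfderiv I e x v) (Y' (e x)) := by
  have hYx : Y x = chartField I e (Y' (e x)) x := by
    rw [← hYY'.self_of_nhds, he.chartField_mvfderiv hx]
  have h := (tensorialAt_mvfderiv_sub_mvfderiv (D := D) he hx v).pointwise
    (he.mdifferentiableAt_of_eventually hx hY' hYY')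
    (he.mdifferentiableAt_chartField hx (Y' (e x))) hYx
  rw [he.mvfderiv_eq_fderiv hx hY' hYY',
    he.mvfderiv_eq_fderiv hx (differentiableAt_const (Y' (e x)))
      (he.eventually_mvfderiv_chartField hx _), hΓ x hx, he.mvfderiv_chartField hx,
    fderiv_fun_const, Pi.zero_apply, _root_.zero_apply, sub_zero] at h
  rw [← h]
  abel

theorem symm_of_torsion_eq_zero (hΓ : IsChristoffel D e Γ)
    (he : IsSmoothChart I e) (hD : D.torsion = 0) {z : E} (hz : z ∈ e.target) (u v : E) :
    Γ z u v = Γ z v u := by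
  have hx := e.map_target hz
  have h := (D.torsion_eq_zero_iff.1 hD) (he.mdifferentiableAt_chartField hx u)
    (he.mdifferentiableAt_chartField hx v)
  rw [he.mlieBracket_eq_zero hx (he.eventually_mvfderiv_chartField hx u)
    (he.eventually_mvfderiv_chartField hx v), sub_eq_zero] at h
  have h' := congrArg (mvfderiv I e (e.symm z)) h
  rwa [hΓ _ hx, hΓ _ hx, he.mvfderiv_chartField hx, he.mvfderiv_chartField hx,
    he.mvfderiv_chartField hx, he.mvfderiv_chartField hx, e.right_inv hz] at h'

lemma mvfderiv_second_covariantDerivative (hΓ : IsChristoffel D e Γ)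
    (he : IsSmoothChart I e) {x : M} (hx : x ∈ e.source) (hΓd : DifferentiableAt ℝ Γ (e x))
    {Y Z : ∀ y : M, TangentSpace I y} {v w : E} (hY : ∀ᶠ y in 𝓝 x, Y y = chartField I e v y)
    (hZ : ∀ᶠ y in 𝓝 x, Z y = chartField I e w y) (u : E) :
    mvfderiv I e x (D (fun y ↦ D Z y (Y y)) x (chartField I e u x)) =
      fderiv ℝ Γ (e x) u v w + Γ (e x) u (Γ (e x) v w) := by
  have hΓv : DifferentiableAt ℝ (fun z ↦ Γ z v) (e x) := hΓd.clm_apply (differentiableAt_const v)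
  rw [hΓ.mvfderiv_apply he hx (hΓv.clm_apply (differentiableAt_const w)),
    he.mvfderiv_chartField hx, fderiv_clm_apply_const hΓv, fderiv_clm_apply_const hΓd]
  filter_upwards [hZ.eventually_nhds, hY, e.open_source.mem_nhds hx] with y hZy hYy hy
  rw [covariantDerivative_congr_of_eventuallyEq (he.mdifferentiableAt_chartField hy w) hZy, hYy,
    hΓ y hy, he.mvfderiv_chartField hy, he.mvfderiv_chartField hy]

theorem curvature_eq_zero [T2Space M] (hΓ : IsChristoffel D e Γ)
    (hΓs : ContDiffOn ℝ ∞ Γ e.target) (he : IsSmoothChart I e) (hD : IsFlatConnection D)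
    {z : E} (hz : z ∈ e.target) (u v w : E) :
    fderiv ℝ Γ z u v w + Γ z u (Γ z v w) = fderiv ℝ Γ z v u w + Γ z v (Γ z u w) := by
  obtain ⟨x, hx, rfl⟩ : ∃ x ∈ e.source, e x = z := ⟨e.symm z, e.map_target hz, e.right_inv hz⟩
  have hΓd : DifferentiableAt ℝ Γ (e x) :=
    (hΓs.contDiffAt (e.open_target.mem_nhds hz)).differentiableAt (by simp)
  have extend : ∀ a : E, ∃ Y : ∀ y : M, TangentSpace I y, CMDiff ∞ (T% Y) ∧
      ∀ᶠ y in 𝓝 x, Y y = chartField I e a y := fun a ↦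
    exists_contMDiff_section_eventuallyEq e.open_source
      (fun y hy ↦ he.contMDiffAt_chartField hy a) hx
  obtain ⟨X, hX, hXe⟩ := extend u
  obtain ⟨Y, hY, hYe⟩ := extend v
  obtain ⟨Z, hZ, hZe⟩ := extend w
  have hbracket : VectorField.mlieBracket I X Y x = 0 := by
    refine he.mlieBracket_eq_zero hx (u := u) (v := v) ?_ ?_
    · filter_upwards [hXe, he.eventually_mvfderiv_chartField hx u] with y hXy hy
      rw [hXy, hy]
    · filter_upwards [hYe, he.eventually_mvfderiv_chartField hx v] with y hYy hy
      rw [hYy, hy]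
  have hflat := hD X Y Z hX hY hZ x
  rw [hbracket, map_zero, sub_zero, sub_eq_zero, hXe.self_of_nhds, hYe.self_of_nhds] at hflat
  rw [← hΓ.mvfderiv_second_covariantDerivative he hx hΓd hYe hZe u,
    ← hΓ.mvfderiv_second_covariantDerivative he hx hΓd hXe hZe v, hflat]

/-- In a holomorphic chart `DJ` is the commutator of `Γ` with the constant `j`. -/
lemma mvfderiv_covariantDerivative_endField (hΓ : IsChristoffel D e Γ) {J : EndField I M}
    {j : E →L[ℝ] E} (he : IsHolomorphicChart J e j) {x : M} (hx : x ∈ e.source) (u v : E) :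
    mvfderiv I e x (D (fun y ↦ J y (chartField I e v y)) x (chartField I e u x) -
        J x (D (chartField I e v) x (chartField I e u x))) =
      Γ (e x) u (j v) - j (Γ (e x) u v) := by
  have he' := he.isSmoothChart
  rw [map_sub, he.mfderiv_comp _ hx,
    hΓ.mvfderiv_apply he' hx (Y' := fun _ ↦ j v) (differentiableAt_const _),
    hΓ _ hx, he'.mvfderiv_chartField hx, he'.mvfderiv_chartField hx]
  · simp
  · filter_upwards [e.open_source.mem_nhds hx] with y hy
    rw [he.mfderiv_comp y hy, he'.mvfderiv_chartField hy]

theorem apply_complex (hΓ : IsChristoffel D e Γ) {J : EndField I M}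
    {j : E →L[ℝ] E} (he : IsHolomorphicChart J e j) (hD : D.torsion = 0)
    (hsymm : HasSymmetricDerivative D J) {z : E} (hz : z ∈ e.target) (u v : E) :
    Γ z (j u) v = Γ z u (j v) := by
  have he' := he.isSmoothChart
  have hx := e.map_target hz
  have hS := fun u v ↦ hΓ.symm_of_torsion_eq_zero he' hD hz u v
  have h := congrArg (mvfderiv I e (e.symm z)) (hsymm (e.symm z) _ _
    (he'.mdifferentiableAt_chartField hx u) (he'.mdifferentiableAt_chartField hx v))
  rw [hΓ.mvfderiv_covariantDerivative_endField he hx,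
    hΓ.mvfderiv_covariantDerivative_endField he hx, e.right_inv hz, hS v u, sub_left_inj] at h
  rw [hS, h]

end IsChristoffel

end Christoffel

section FlatChart

/-- The right-hand side of the total differential equation `df = P`, `dP = P ∘ Γ` for a pair
`(f, P)` of functions on `E`. The components of a solution `f` are affine functions for the
connection with Christoffel symbols `Γ`. -/
noncomputable def affineField (Γ : E → E →L[ℝ] E →L[ℝ] E) (q : E × (E × (E →L[ℝ] E))) :
    E →L[ℝ] E × (E →L[ℝ] E) :=
  q.2.2.prod (ContinuousLinearMap.compL ℝ E E E q.2.2 ∘L Γ q.1)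

variable [FiniteDimensional ℝ E] {O : Set E}

lemma contDiffOn_affineField (hΓ : ContDiffOn ℝ ∞ Γ O) :
    ContDiffOn ℝ ∞ (affineField Γ) (O ×ˢ univ) := by
  rw [contDiffOn_clm_apply]
  intro v
  refine ContDiffOn.prodMk (f := fun q : E × (E × (E →L[ℝ] E)) ↦ q.2.2 v)
    (g := fun q : E × (E × (E →L[ℝ] E)) ↦ q.2.2 ∘L Γ q.1 v) ?_ ?_
  · exact contDiffOn_snd.snd.clm_apply contDiffOn_const
  · exact contDiffOn_snd.snd.clm_comp
      ((hΓ.clm_apply contDiffOn_const).comp contDiffOn_fst fun q hq ↦ hq.1)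

lemma fderiv_affineField (hO : IsOpen O) (hΓ : ContDiffOn ℝ ∞ Γ O) {q : E × (E × (E →L[ℝ] E))}
    (hq : q.1 ∈ O) (h : E × (E × (E →L[ℝ] E))) (v : E) :
    fderiv ℝ (affineField Γ) q h v =
      (h.2.2 v, q.2.2 ∘L fderiv ℝ Γ q.1 h.1 v + h.2.2 ∘L Γ q.1 v) := by
  have hΓq : DifferentiableAt ℝ Γ q.1 :=
    (hΓ.contDiffAt (hO.mem_nhds hq)).differentiableAt (by simp)
  have hΓv : HasFDerivAt (fun q : E × (E × (E →L[ℝ] E)) ↦ Γ q.1 v)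
      (fderiv ℝ (fun z ↦ Γ z v) q.1 ∘L ContinuousLinearMap.fst ℝ E (E × (E →L[ℝ] E))) q :=
    (hΓq.clm_apply (differentiableAt_const v)).hasFDerivAt.comp q hasFDerivAt_fst
  have hP : HasFDerivAt (fun q : E × (E × (E →L[ℝ] E)) ↦ q.2.2)
      (ContinuousLinearMap.snd ℝ E (E →L[ℝ] E) ∘L
        ContinuousLinearMap.snd ℝ E (E × (E →L[ℝ] E))) q :=
    (ContinuousLinearMap.snd ℝ E (E →L[ℝ] E) ∘L
      ContinuousLinearMap.snd ℝ E (E × (E →L[ℝ] E))).hasFDerivAt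
  have hφ : DifferentiableAt ℝ (affineField Γ) q :=
    ((contDiffOn_affineField hΓ).contDiffAt
      ((hO.prod isOpen_univ).mem_nhds ⟨hq, trivial⟩)).differentiableAt (by simp)
  have hφv : HasFDerivAt (fun q ↦ affineField Γ q v) _ q :=
    (hP.clm_apply (hasFDerivAt_const v q)).prodMk (hP.clm_comp hΓv)
  rw [← fderiv_clm_apply_const hφ, hφv.fderiv, ← fderiv_clm_apply_const hΓq]
  simp

lemma exists_affine_coordinates (hO : IsOpen O) (hΓ : ContDiffOn ℝ ∞ Γ O)
    (hsymm : ∀ z ∈ O, ∀ u v, Γ z u v = Γ z v u)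
    (hcurv : ∀ z ∈ O, ∀ u v w,
      fderiv ℝ Γ z u v w + Γ z u (Γ z v w) = fderiv ℝ Γ z v u w + Γ z v (Γ z u w))
    {z₀ : E} (hz₀ : z₀ ∈ O) :
    ∃ (f : E → E) (P : E → E →L[ℝ] E) (U : Set E), IsOpen U ∧ z₀ ∈ U ∧ U ⊆ O ∧
      P z₀ = ContinuousLinearMap.id ℝ E ∧ ContDiffOn ℝ ∞ f U ∧ ContDiffOn ℝ ∞ P U ∧
      ∀ z ∈ U, HasFDerivAt f (P z) z ∧ ∀ u, fderiv ℝ P z u = P z ∘L Γ z u := by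
  obtain ⟨σ, U, hU, hzU, hσ₀, hσs, hσ⟩ := exists_contDiffOn_hasFDerivAt_of_integrable
    (hO.prod isOpen_univ) (contDiffOn_affineField hΓ) (fun q hq u v ↦ by
      rw [fderiv_affineField hO hΓ hq.1, fderiv_affineField hO hΓ hq.1]
      refine Prod.ext ?_ ?_
      · change q.2.2 (Γ q.1 u v) = q.2.2 (Γ q.1 v u)
        rw [hsymm _ hq.1]
      · ext w
        change q.2.2 (fderiv ℝ Γ q.1 u v w) + q.2.2 (Γ q.1 u (Γ q.1 v w)) =
          q.2.2 (fderiv ℝ Γ q.1 v u w) + q.2.2 (Γ q.1 v (Γ q.1 u w))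
        rw [← map_add, ← map_add, hcurv _ hq.1])
    (x₀ := z₀) (w₀ := (0, ContinuousLinearMap.id ℝ E)) ⟨hz₀, trivial⟩
  refine ⟨fun z ↦ (σ z).1, fun z ↦ (σ z).2, U, hU, hzU, fun z hz ↦ (hσ z hz).1.1, congr($hσ₀.2),
    hσs.fst, hσs.snd, fun z hz ↦ ⟨(hσ z hz).2.fst, fun u ↦ ?_⟩⟩
  rw [(hσ z hz).2.snd.fderiv]
  rfl

/-- If the differentials of the charts are related by `P` with `dP = P ∘ Γ`, the covariant
derivative of a field which is constant in `e` is annihilated by `P`. -/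
lemma IsChristoffel.isFlatChart {e₀ : OpenPartialHomeomorph M E} (hΓ : IsChristoffel D e₀ Γ)
    (he₀ : IsSmoothChart I e₀) (he : IsSmoothChart I e) (hs : e.source ⊆ e₀.source)
    {P : E → E →L[ℝ] E} (hP : ∀ x ∈ e.source, DifferentiableAt ℝ P (e₀ x))
    (hPΓ : ∀ x ∈ e.source, ∀ u, fderiv ℝ P (e₀ x) u = P (e₀ x) ∘L Γ (e₀ x) u)
    (heP : ∀ x ∈ e.source, ∀ v, mvfderiv I e x v = P (e₀ x) (mvfderiv I e₀ x v)) :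
    IsFlatChart D e := by
  intro x hx u
  ext v
  have hx₀ := hs hx
  have hs' := he₀.differentiableAt_chartVec hx₀ (he.mdifferentiableAt_chartField hx u)
  have hrep := eventually_mvfderiv_eq_chartVec hx₀ (chartField I e u)
  set s := chartVec e₀ (chartField I e u)
  have hconst : (fun z ↦ P z (s z)) =ᶠ[𝓝 (e₀ x)] fun _ ↦ u := by
    have h := (e₀.continuousAt_symm (e₀.map_source hx₀)).eventually_mem
      (by rw [e₀.left_inv hx₀]; exact e.open_source.mem_nhds hx)
    filter_upwards [h, e₀.open_target.mem_nhds (e₀.map_source hx₀)] with z hz hz₀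
    have h' := heP _ hz (chartField I e u (e₀.symm z))
    rw [he.mvfderiv_chartField hz, e₀.right_inv hz₀] at h'
    exact h'.symm
  have hderiv : ∀ w, P (e₀ x) (fderiv ℝ s (e₀ x) w + Γ (e₀ x) w (s (e₀ x))) = 0 := by
    intro w
    have h := congr($(hconst.fderiv_eq (𝕜 := ℝ)) w)
    rw [fderiv_clm_apply (hP x hx) hs', fderiv_fun_const] at h
    simpa only [_root_.add_apply, ContinuousLinearMap.comp_apply, ContinuousLinearMap.flip_apply,
      hPΓ x hx, Pi.zero_apply, _root_.zero_apply, ← map_add] using h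
  apply he.mvfderiv_injective hx
  rw [heP x hx, hΓ.mvfderiv_apply he₀ hx₀ hs' hrep, hderiv]
  exact (map_zero (mvfderiv I e x)).symm

lemma exists_openPartialHomeomorph_of_hasFDerivAt {f : E → E} {P : E → E →L[ℝ] E} {U : Set E}
    (hU : IsOpen U) (hf : ContDiffOn ℝ ∞ f U) (hP : ContinuousOn P U)
    (hfP : ∀ z ∈ U, HasFDerivAt f (P z) z) {z₀ : E} (hz₀ : z₀ ∈ U) (hPz₀ : (P z₀).IsInvertible) :
    ∃ G : OpenPartialHomeomorph E E, (G : E → E) = f ∧ z₀ ∈ G.source ∧ G.source ⊆ U ∧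
      ContDiffOn ℝ ∞ G.symm G.target := by
  obtain ⟨A₀, hA₀⟩ := hPz₀
  let F := (hf.contDiffAt (hU.mem_nhds hz₀)).toOpenPartialHomeomorph f (f' := A₀)
    (by rw [hA₀]; exact hfP _ hz₀) (by simp)
  let S : Set E := U ∩ P ⁻¹' range ((↑) : (E ≃L[ℝ] E) → E →L[ℝ] E)
  let G := F.restrOpen S (hP.isOpen_inter_preimage hU ContinuousLinearEquiv.isOpen)
  have hGS : G.source ⊆ S := inter_subset_right
  refine ⟨G, rfl, ⟨ContDiffAt.mem_toOpenPartialHomeomorph_source _ _ _, hz₀, A₀, hA₀⟩,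
    fun z hz ↦ (hGS hz).1, fun z hz ↦ ?_⟩
  obtain ⟨hzU, A, hA⟩ := hGS (G.map_target hz)
  refine (G.contDiffAt_symm (f₀' := A) hz ?_ ?_).contDiffWithinAt
  · rw [hA]
    exact hfP _ hzU
  · exact hf.contDiffAt (hU.mem_nhds hzU)

theorem exists_isFlatChart [T2Space M]
    (hDs : D.ContMDiffCovariantDerivative ∞) (hDf : IsFlatConnection D) (hDt : D.torsion = 0)
    {e₀ : OpenPartialHomeomorph M E} (he₀ : IsSmoothChart I e₀) {x₀ : M} (hx₀ : x₀ ∈ e₀.source) :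
    ∃ e : OpenPartialHomeomorph M E, IsSmoothChart I e ∧ x₀ ∈ e.source ∧ IsFlatChart D e ∧
      ∃ r, e.target = Metric.ball (e x₀) r := by
  obtain ⟨Γ, hΓs, hΓ⟩ := exists_isChristoffel hDs he₀
  obtain ⟨f, P, U, hU, hzU, -, hP₀, hfs, hPs, hfP⟩ := exists_affine_coordinates e₀.open_target hΓs
    (fun z hz ↦ hΓ.symm_of_torsion_eq_zero he₀ hDt hz)
    (fun z hz ↦ hΓ.curvature_eq_zero hΓs he₀ hDf hz) (e₀.map_source hx₀)
  obtain ⟨G, rfl, hzG, hGU, hGsymm⟩ := exists_openPartialHomeomorph_of_hasFDerivAt hU hfs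
    hPs.continuousOn (fun z hz ↦ (hfP z hz).1) hzU ⟨ContinuousLinearEquiv.refl ℝ E, hP₀.symm⟩
  have hs : ∀ x ∈ (e₀.trans G).source, x ∈ e₀.source ∧ e₀ x ∈ U := by
    intro x hx
    rw [OpenPartialHomeomorph.trans_source] at hx
    exact ⟨hx.1, hGU hx.2⟩
  have htrans : IsSmoothChart I (e₀.trans G) :=
    ⟨hfs.contMDiffOn.comp (he₀.contMDiffOn.mono fun x hx ↦ (hs x hx).1) fun x hx ↦ (hs x hx).2,
      he₀.contMDiffOn_symm.comp (hGsymm.contMDiffOn.mono fun z hz ↦ hz.1) fun z hz ↦ hz.2⟩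
  obtain ⟨e, he, hx, hee, hes, r, hr⟩ := htrans.exists_restr (x := x₀)
    (by rw [OpenPartialHomeomorph.trans_source]; exact ⟨hx₀, hzG⟩)
  refine ⟨e, he, hx, hΓ.isFlatChart he₀ he (fun x hx ↦ (hs x (hes hx)).1) (P := P)
    (fun x hx ↦ (hPs.contDiffAt (hU.mem_nhds (hs x (hes hx)).2)).differentiableAt (by simp))
    (fun x hx ↦ (hfP _ (hs x (hes hx)).2).2) fun x hx v ↦ ?_, r, by rw [hr, hee]⟩
  obtain ⟨hx₀, hxU⟩ := hs x (hes hx)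
  have h := mvfderiv_fderiv_comp (hfP _ hxU).1.differentiableAt (he₀.mdifferentiableAt hx₀)
  rw [(hfP _ hxU).1.fderiv] at h
  rw [hee]
  exact congr($h v)

theorem IsFlatChart.chartBilin_eq (hflat : IsFlatChart D e) (he : IsSmoothChart I e)
    (hc : IsPreconnected e.target) {b : BilinField I M} (hb : b.IsSmooth)
    (hpar : IsParallelForm D b) {z z' : E} (hz : z ∈ e.target) (hz' : z' ∈ e.target) :
    chartBilin e b z = chartBilin e b z' := by
  ext u v
  have hd : DifferentiableOn ℝ (fun z ↦ chartBilin e b z u v) e.target :=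
    (((he.contDiffOn_chartBilin hb).differentiableOn (by simp)).clm_apply
      (differentiableOn_const u)).clm_apply (differentiableOn_const v)
  refine e.open_target.is_const_of_fderiv_eq_zero hc hd (fun y hy ↦ ?_) hz hz'
  obtain ⟨x, hx, rfl⟩ : ∃ x ∈ e.source, e x = y := ⟨e.symm y, e.map_target hy, e.right_inv hy⟩
  ext w
  have h := hpar _ (chartField I e w x) _ _ (he.mdifferentiableAt_chartField hx u)
    (he.mdifferentiableAt_chartField hx v)
  rw [hflat _ hx, hflat _ hx, he.mvfderiv_eq_fderiv hx (h := fun z ↦ chartBilin e b z u v)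
    ((hd _ hy).differentiableAt (e.open_target.mem_nhds hy)), he.mvfderiv_chartField hx] at h
  · rw [h]
    simp
  · filter_upwards [e.open_source.mem_nhds hx] with y hy
    rw [he.bilinField_apply b hy, he.mvfderiv_chartField hy, he.mvfderiv_chartField hy]

theorem IsFlatChart.fderiv_chartEnd_symm (hflat : IsFlatChart D e) (he : IsSmoothChart I e)
    {J : EndField I M} (hJ : J.IsSmooth) (hsymm : HasSymmetricDerivative D J)
    {z : E} (hz : z ∈ e.target) (u v : E) :
    fderiv ℝ (chartEnd e J) z u v = fderiv ℝ (chartEnd e J) z v u := by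
  obtain ⟨x, hx, rfl⟩ : ∃ x ∈ e.source, e x = z := ⟨e.symm z, e.map_target hz, e.right_inv hz⟩
  have hd : DifferentiableAt ℝ (chartEnd e J) (e x) :=
    ((he.contDiffOn_chartEnd fun x _ ↦ hJ x).contDiffAt
      (e.open_target.mem_nhds hz)).differentiableAt (by simp)
  have hDJ : ∀ u v, mvfderiv I e x (D (fun y ↦ J y (chartField I e v y)) x (chartField I e u x)) =
      fderiv ℝ (chartEnd e J) (e x) u v := by
    intro u v
    rw [hflat.isChristoffel.mvfderiv_apply he hx (hd.clm_apply (differentiableAt_const v)),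
      he.mvfderiv_chartField hx, fderiv_clm_apply_const hd]
    · simp
    · filter_upwards [e.open_source.mem_nhds hx] with y hy
      rw [he.mvfderiv_endField J hy, he.mvfderiv_chartField hy]
  have h := hsymm x _ _ (he.mdifferentiableAt_chartField hx u)
    (he.mdifferentiableAt_chartField hx v)
  rw [hflat _ hx, hflat _ hx, _root_.zero_apply, _root_.zero_apply, map_zero, sub_zero,
    sub_zero] at h
  rw [← hDJ, ← hDJ, h]

end FlatChart

end Connection

/-! ## Induced charts of the cotangent bundle -/

section CotangentChart

open Set Filter Topology

variable {E : Type*} [NormedAddCommGroup E] [NormedSpace ℝ E]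
  {M : Type*} [TopologicalSpace M] [ChartedSpace E M] [IsManifold 𝓘(ℝ, E) ∞ M]
  {e : OpenPartialHomeomorph M E}

lemma contMDiffAt_cotangentChart_symm (he : IsSmoothChart 𝓘(ℝ, E) e) {z : E × (E →L[ℝ] ℝ)}
    (hz : z.1 ∈ e.target) :
    ContMDiffAt 𝓘(ℝ, E × (E →L[ℝ] ℝ)) (cotangentModel E) ∞
      (fun z : E × (E →L[ℝ] ℝ) ↦
        (⟨e.symm z.1, z.2 ∘L mvfderiv 𝓘(ℝ, E) e (e.symm z.1)⟩ : CotangentBundle E M)) z := by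
  have hbase : ContMDiffAt 𝓘(ℝ, E × (E →L[ℝ] ℝ)) 𝓘(ℝ, E) ∞
      (fun z : E × (E →L[ℝ] ℝ) ↦ e.symm z.1) z :=
    (he.contMDiffAt_symm hz).comp z contDiffAt_fst.contMDiffAt
  have hfiber : ContMDiffAt 𝓘(ℝ, E × (E →L[ℝ] ℝ)) 𝓘(ℝ, E →L[ℝ] ℝ) ∞
      (fun z : E × (E →L[ℝ] ℝ) ↦ z.2) z := contDiffAt_snd.contMDiffAt
  have hderiv := ContMDiffAt.comp (I' := 𝓘(ℝ, E)) z
    (he.contMDiffAt_mvfderiv_comp_symmL (e.map_target hz)) hbase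
  rw [contMDiffAt_totalSpace]
  refine ⟨hbase, (hfiber.clm_comp hderiv).congr_of_eventuallyEq (Eventually.of_forall fun y ↦ ?_)⟩
  ext u
  exact trivializationAt_dual_apply _ u

variable [CompleteSpace E]

lemma contMDiffAt_cotangentChart (he : IsSmoothChart 𝓘(ℝ, E) e) {ξ : CotangentBundle E M}
    (hξ : ξ.proj ∈ e.source) :
    ContMDiffAt (cotangentModel E) 𝓘(ℝ, E × (E →L[ℝ] ℝ)) ∞ (cotangentChart e) ξ := by
  have hproj : ContMDiffAt (cotangentModel E) 𝓘(ℝ, E) ∞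
      (TotalSpace.proj : CotangentBundle E M → M) ξ := contMDiffAt_proj _
  have hid : ContMDiffAt (cotangentModel E) (cotangentModel E) ∞
      (fun η : CotangentBundle E M ↦ η) ξ := contMDiffAt_id
  rw [contMDiffAt_totalSpace] at hid
  have hbase : ContMDiffAt (cotangentModel E) 𝓘(ℝ, E) ∞
      (fun η : CotangentBundle E M ↦ e η.proj) ξ :=
    ContMDiffAt.comp (I' := 𝓘(ℝ, E)) ξ (he.contMDiffAt hξ) hproj
  have hinv := ContMDiffAt.comp (I' := 𝓘(ℝ, E)) ξ
    (he.contMDiffAt_inverse_mvfderiv_comp_symmL hξ) hproj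
  refine (hbase.prodMk_space (hid.2.clm_comp hinv)).congr_of_eventuallyEq ?_
  filter_upwards [hproj.continuousAt.preimage_mem_nhds (e.open_source.mem_nhds hξ),
    hproj.continuousAt.preimage_mem_nhds
      (eventually_mem_baseSet (I := 𝓘(ℝ, E)) (x := ξ.proj))] with η hη hη'
  refine Prod.ext rfl (ContinuousLinearMap.ext fun u ↦ ?_)
  have hA := he.isInvertible_mvfderiv_comp_symmL hη hη'
  obtain ⟨u, rfl⟩ := hA.surjective u
  have hu := hA.inverse_apply_self u
  simp only [ContinuousLinearMap.comp_apply] at hu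
  simp only [cotangentChart, ContinuousLinearMap.comp_apply, Function.comp_apply]
  erw [hu, (he.isInvertible hη).inverse_apply_self]
  exact (trivializationAt_dual_apply η.2 u).symm

/-- The chart `(p, α) ↦ (e p, α ∘ (de)⁻¹)` of the cotangent bundle induced by a smooth chart `e`,
with values in `E × E*`. -/
noncomputable def IsSmoothChart.cotangent (he : IsSmoothChart 𝓘(ℝ, E) e) :
    OpenPartialHomeomorph (CotangentBundle E M) (E × (E →L[ℝ] ℝ)) where
  toFun := cotangentChart e
  invFun z := ⟨e.symm z.1, z.2 ∘L mvfderiv 𝓘(ℝ, E) e (e.symm z.1)⟩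
  source := TotalSpace.proj ⁻¹' e.source
  target := e.target ×ˢ univ
  map_source' ξ hξ := ⟨e.map_source hξ, trivial⟩
  map_target' z hz := e.map_target hz.1
  left_inv' ξ hξ := by
    obtain ⟨p, α⟩ := ξ
    have h : ∀ y, y = p → (⟨y, (α ∘L (mvfderiv 𝓘(ℝ, E) e p).inverse) ∘L
        mvfderiv 𝓘(ℝ, E) e y⟩ : CotangentBundle E M) = ⟨p, α⟩ := by
      rintro _ rfl
      congr 1
      ext v
      exact congrArg α ((he.isInvertible hξ).inverse_apply_self v)
    exact h _ (e.left_inv hξ)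
  right_inv' z hz := by
    refine Prod.ext (e.right_inv hz.1) ?_
    ext u
    exact congrArg z.2 ((he.isInvertible (e.map_target hz.1)).self_apply_inverse u)
  open_source := e.open_source.preimage (FiberBundle.continuous_proj _ _)
  open_target := e.open_target.prod isOpen_univ
  continuousOn_toFun ξ hξ :=
    (contMDiffAt_cotangentChart he hξ).continuousAt.continuousWithinAt
  continuousOn_invFun z hz :=
    (contMDiffAt_cotangentChart_symm he hz.1).continuousAt.continuousWithinAt

lemma IsSmoothChart.isSmoothChart_cotangent (he : IsSmoothChart 𝓘(ℝ, E) e) :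
    IsSmoothChart (cotangentModel E) he.cotangent where
  contMDiffOn _ hξ := (contMDiffAt_cotangentChart he hξ).contMDiffWithinAt
  contMDiffOn_symm _ hz := (contMDiffAt_cotangentChart_symm he hz.1).contMDiffWithinAt

lemma mvfderiv_cotangentChart_fst (he : IsSmoothChart 𝓘(ℝ, E) e) {ξ : CotangentBundle E M}
    (hξ : ξ.proj ∈ e.source) (w : TangentSpace (cotangentModel E) ξ) :
    (mvfderiv (cotangentModel E) (cotangentChart e) ξ w).1 =
      mvfderiv 𝓘(ℝ, E) e ξ.proj (projDeriv ξ w) := by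
  have hfst := mvfderiv_fderiv_comp (h := Prod.fst) differentiableAt_fst
    ((contMDiffAt_cotangentChart he hξ).mdifferentiableAt (by simp))
  have hproj := mfderiv_comp (I' := 𝓘(ℝ, E)) ξ (he.mdifferentiableAt hξ)
    (mdifferentiableAt_proj (CotangentSpace E : M → Type _))
  rw [fderiv_fst] at hfst
  exact congr($hfst w).symm.trans congr($hproj w)

lemma mvfderiv_cotangentChart_snd (he : IsSmoothChart 𝓘(ℝ, E) e) {ξ : CotangentBundle E M}
    (hξ : ξ.proj ∈ e.source) (w : TangentSpace (cotangentModel E) ξ) (u : E) :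
    (mvfderiv (cotangentModel E) (cotangentChart e) ξ w).2 u =
      mvfderiv (cotangentModel E) (fiberLinear (chartField 𝓘(ℝ, E) e u)) ξ w := by
  let L : E × (E →L[ℝ] ℝ) →L[ℝ] ℝ := ContinuousLinearMap.apply ℝ ℝ u ∘L
    ContinuousLinearMap.snd ℝ E (E →L[ℝ] ℝ)
  have hL := mvfderiv_fderiv_comp (h := L) L.differentiableAt
    ((contMDiffAt_cotangentChart he hξ).mdifferentiableAt (by simp))
  rw [L.fderiv] at hL
  exact congr($hL w).symm

variable {D : CovariantDerivative 𝓘(ℝ, E) E (TangentSpace 𝓘(ℝ, E) : M → Type _)}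

omit [CompleteSpace E] in
lemma IsChristoffel.connectionMap_chartField [FiniteDimensional ℝ E] {Γ : E → E →L[ℝ] E →L[ℝ] E}
    (hΓ : IsChristoffel D e Γ) (he : IsSmoothChart 𝓘(ℝ, E) e) {ξ : CotangentBundle E M}
    (hξ : ξ.proj ∈ e.source) (w : TangentSpace (cotangentModel E) ξ) (u : E) :
    connectionMap D ξ w (chartField 𝓘(ℝ, E) e u ξ.proj) =
      (mvfderiv (cotangentModel E) (cotangentChart e) ξ w).2 u - (cotangentChart e ξ).2
        (Γ (e ξ.proj) (mvfderiv (cotangentModel E) (cotangentChart e) ξ w).1 u) := by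
  rw [connectionMap_apply D ξ w (he.mdifferentiableAt_chartField hξ u), hΓ _ hξ,
    mvfderiv_cotangentChart_snd he hξ, mvfderiv_cotangentChart_fst he hξ]
  rfl

end CotangentChart

/-! ## The linear model -/

section LinearModel

variable {E : Type*} [NormedAddCommGroup E] [NormedSpace ℝ E]

lemma isInvertible_of_nondegenerate [FiniteDimensional ℝ E]
    {b : E →L[ℝ] E →L[ℝ] ℝ} (h : ∀ v, (∀ w, b v w = 0) → v = 0) : b.IsInvertible := by
  have hinj : Function.Injective b.toLinearMap := by
    rw [← LinearMap.ker_eq_bot, LinearMap.ker_eq_bot']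
    intro v hv
    exact h v fun w ↦ congr($hv w)
  have hrank : Module.finrank ℝ E = Module.finrank ℝ (E →L[ℝ] ℝ) := by
    rw [← (LinearMap.toContinuousLinearMap (𝕜 := ℝ) (E := E) (F' := ℝ)).finrank_eq]
    exact (Subspace.dual_finrank_eq (K := ℝ) (V := E)).symm
  refine ⟨(LinearEquiv.ofBijective b.toLinearMap
    ⟨hinj, (LinearMap.injective_iff_surjective_of_finrank_eq_finrank
      hrank).1 hinj⟩).toContinuousLinearEquiv, ?_⟩
  ext v w
  rfl

/-- A linear pseudo-Kähler structure: a complex structure `j` on `E` and a nondegenerate two-form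
`Ω` for which `j` is skew-symmetric. The metric, from which `Ω` determines `j`, is `-Ω(j·, ·)`. -/
structure IsLinearKahler (j : E →L[ℝ] E) (Ω : E →L[ℝ] E →L[ℝ] ℝ) : Prop where
  sq : ∀ v, j (j v) = -v
  skew : ∀ v w, Ω v w = -Ω w v
  apply_complex : ∀ v w, Ω (j v) w = -Ω v (j w)
  isInvertible : Ω.IsInvertible

/-- The linear model `(a, β) ↦ (j a, β ∘ j)` on `E × E*` of `cotangentJ`. -/
noncomputable def linearJ (j : E →L[ℝ] E) : E × (E →L[ℝ] ℝ) →L[ℝ] E × (E →L[ℝ] ℝ) :=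
  j.prodMap (ContinuousLinearMap.precomp ℝ j)

/-- The linear model `(a, β) ↦ (Ω⁻¹ β, Ω a)` on `E × E*` of `cotangentOmega`. -/
noncomputable def linearOmega (Ω : E →L[ℝ] E →L[ℝ] ℝ) : E × (E →L[ℝ] ℝ) →L[ℝ] E × (E →L[ℝ] ℝ) :=
  (Ω.inverse ∘L ContinuousLinearMap.snd ℝ E (E →L[ℝ] ℝ)).prod
    (Ω ∘L ContinuousLinearMap.fst ℝ E (E →L[ℝ] ℝ))

/-- The pull-back along `(p, q) : V → E × E*` of the form
`((a, β), (a', β')) ↦ -Ω(j a, a') - β(j Ω⁻¹ β')`. The space `V` is abstract to spare instance search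
the bilinear forms on the product. -/
noncomputable def diagonalForm {V : Type*} [NormedAddCommGroup V] [NormedSpace ℝ V] (p : V →L[ℝ] E)
    (q : V →L[ℝ] E →L[ℝ] ℝ) (j : E →L[ℝ] E) (Ω : E →L[ℝ] E →L[ℝ] ℝ) : V →L[ℝ] V →L[ℝ] ℝ :=
  ContinuousLinearMap.precomp ℝ p ∘L Ω ∘L (-j) ∘L p
    + ContinuousLinearMap.precomp ℝ ((-j) ∘L Ω.inverse ∘L q) ∘L q

lemma diagonalForm_apply {V : Type*} [NormedAddCommGroup V] [NormedSpace ℝ V] (p : V →L[ℝ] E)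
    (q : V →L[ℝ] E →L[ℝ] ℝ) (j : E →L[ℝ] E) (Ω : E →L[ℝ] E →L[ℝ] ℝ) (y y' : V) :
    diagonalForm p q j Ω y y' = -Ω (j (p y)) (p y') - q y (j (Ω.inverse (q y'))) := by
  have h : diagonalForm p q j Ω y y' = Ω (-j (p y)) (p y') + q y (-j (Ω.inverse (q y'))) := rfl
  rw [h, map_neg, map_neg, _root_.neg_apply, sub_eq_add_neg]

/-- The linear model `((a, β), (a', β')) ↦ -Ω(j a, a') - β(j Ω⁻¹ β')` on `E × E*` of
`cotangentMetric`. -/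
noncomputable abbrev linearMetric (j : E →L[ℝ] E) (Ω : E →L[ℝ] E →L[ℝ] ℝ) :=
  diagonalForm (ContinuousLinearMap.fst ℝ E (E →L[ℝ] ℝ)) (ContinuousLinearMap.snd ℝ E (E →L[ℝ] ℝ))
    j Ω

variable {j : E →L[ℝ] E} {Ω : E →L[ℝ] E →L[ℝ] ℝ}

lemma linearJ_apply (j : E →L[ℝ] E) (y : E × (E →L[ℝ] ℝ)) :
    linearJ j y = (j y.1, y.2 ∘L j) := rfl

lemma linearOmega_apply (Ω : E →L[ℝ] E →L[ℝ] ℝ) (y : E × (E →L[ℝ] ℝ)) :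
    linearOmega Ω y = (Ω.inverse y.2, Ω y.1) := rfl

lemma linearMetric_apply (j : E →L[ℝ] E) (Ω : E →L[ℝ] E →L[ℝ] ℝ) (y y' : E × (E →L[ℝ] ℝ)) :
    linearMetric j Ω y y' = -Ω (j y.1) y'.1 - y.2 (j (Ω.inverse y'.2)) :=
  diagonalForm_apply _ _ _ _ _ _

namespace IsLinearKahler

variable (h : IsLinearKahler j Ω)
include h

lemma exists_eq (y : E × (E →L[ℝ] ℝ)) : ∃ a b, y = (a, Ω b) :=
  ⟨y.1, Ω.inverse y.2, Prod.ext rfl (h.isInvertible.self_apply_inverse _).symm⟩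

lemma linearJ_mk (a b : E) : linearJ j (a, Ω b) = (j a, -Ω (j b)) := by
  refine Prod.ext rfl ?_
  ext v
  simp [linearJ_apply, h.apply_complex]

lemma linearOmega_mk (a b : E) : linearOmega Ω (a, Ω b) = (b, Ω a) :=
  Prod.ext (h.isInvertible.inverse_apply_self b) rfl

lemma linearMetric_mk (a b a' b' : E) :
    linearMetric j Ω (a, Ω b) (a', Ω b') = -Ω (j a) a' + Ω (j b) b' := by
  rw [linearMetric_apply, h.isInvertible.inverse_apply_self, h.apply_complex b]
  ring

lemma linearJ_sq (y : E × (E →L[ℝ] ℝ)) : linearJ j (linearJ j y) = -y := by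
  refine Prod.ext (h.sq _) ?_
  ext v
  simp [linearJ_apply, h.sq]

lemma linearOmega_sq (y : E × (E →L[ℝ] ℝ)) : linearOmega Ω (linearOmega Ω y) = y := by
  obtain ⟨a, b, rfl⟩ := h.exists_eq y
  rw [h.linearOmega_mk, h.linearOmega_mk]

lemma linearJ_linearOmega (y : E × (E →L[ℝ] ℝ)) :
    linearJ j (linearOmega Ω y) = -linearOmega Ω (linearJ j y) := by
  obtain ⟨a, b, rfl⟩ := h.exists_eq y
  rw [h.linearOmega_mk, h.linearJ_mk, h.linearJ_mk, ← map_neg Ω (j b), h.linearOmega_mk,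
    Prod.neg_mk, neg_neg]

lemma apply_complex_symm (v w : E) : Ω (j v) w = Ω (j w) v := by
  rw [h.apply_complex, h.skew, neg_neg]

lemma linearMetric_symm (y y' : E × (E →L[ℝ] ℝ)) :
    linearMetric j Ω y y' = linearMetric j Ω y' y := by
  obtain ⟨a, b, rfl⟩ := h.exists_eq y
  obtain ⟨a', b', rfl⟩ := h.exists_eq y'
  rw [h.linearMetric_mk, h.linearMetric_mk, h.apply_complex_symm a, h.apply_complex_symm b]

lemma eq_zero_of_apply_complex {v : E} (hv : ∀ w, Ω (j v) w = 0) : v = 0 := by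
  have hjv : j v = 0 := h.isInvertible.injective (by ext w; simpa using hv w)
  simpa [hjv] using h.sq v

lemma linearMetric_nondegenerate {y : E × (E →L[ℝ] ℝ)} (hy : ∀ y', linearMetric j Ω y y' = 0) :
    y = 0 := by
  obtain ⟨a, b, rfl⟩ := h.exists_eq y
  have ha : a = 0 := h.eq_zero_of_apply_complex fun w ↦ by
    have hw := hy (w, Ω 0)
    rw [h.linearMetric_mk] at hw
    simpa using hw
  have hb : b = 0 := h.eq_zero_of_apply_complex fun w ↦ by
    have hw := hy (0, Ω w)
    rw [h.linearMetric_mk] at hw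
    simpa using hw
  simp [ha, hb]

lemma linearMetric_linearJ (y y' : E × (E →L[ℝ] ℝ)) :
    linearMetric j Ω (linearJ j y) y' = Ω y.1 y'.1 + y.2 (Ω.inverse y'.2) := by
  obtain ⟨a, b, rfl⟩ := h.exists_eq y
  obtain ⟨a', b', rfl⟩ := h.exists_eq y'
  rw [h.linearJ_mk, ← map_neg, h.linearMetric_mk, h.isInvertible.inverse_apply_self]
  simp [h.sq]

lemma linearMetric_linearOmega (y y' : E × (E →L[ℝ] ℝ)) :
    linearMetric j Ω (linearOmega Ω y) y' = y.2 (j y'.1) - y'.2 (j y.1) := by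
  obtain ⟨a, b, rfl⟩ := h.exists_eq y
  obtain ⟨a', b', rfl⟩ := h.exists_eq y'
  rw [h.linearOmega_mk, h.linearMetric_mk, h.apply_complex b, h.apply_complex_symm a,
    h.apply_complex b']
  ring

lemma linearMetric_linearJ_linearOmega (y y' : E × (E →L[ℝ] ℝ)) :
    linearMetric j Ω (linearJ j (linearOmega Ω y)) y' = y.2 y'.1 - y'.2 y.1 := by
  obtain ⟨a, b, rfl⟩ := h.exists_eq y
  obtain ⟨a', b', rfl⟩ := h.exists_eq y'
  rw [h.linearMetric_linearJ, h.linearOmega_mk, h.isInvertible.inverse_apply_self, h.skew a b']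
  ring

lemma inverse_skew (α β : E →L[ℝ] ℝ) : α (Ω.inverse β) = -β (Ω.inverse α) := by
  obtain ⟨a, rfl⟩ := h.isInvertible.surjective α
  obtain ⟨b, rfl⟩ := h.isInvertible.surjective β
  rw [h.isInvertible.inverse_apply_self, h.isInvertible.inverse_apply_self, h.skew]

lemma linearMetric_linearJ_skew (y y' : E × (E →L[ℝ] ℝ)) :
    linearMetric j Ω (linearJ j y) y' = -linearMetric j Ω y (linearJ j y') := by
  rw [h.linearMetric_symm y, h.linearMetric_linearJ, h.linearMetric_linearJ, h.skew,
    h.inverse_skew]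
  ring

lemma linearMetric_linearOmega_skew (y y' : E × (E →L[ℝ] ℝ)) :
    linearMetric j Ω (linearOmega Ω y) y' = -linearMetric j Ω y (linearOmega Ω y') := by
  rw [h.linearMetric_symm y, h.linearMetric_linearOmega, h.linearMetric_linearOmega]
  ring

lemma linearOmega_eq_iff (y : E × (E →L[ℝ] ℝ)) : linearOmega Ω y = y ↔ y.2 = Ω y.1 := by
  obtain ⟨a, b, rfl⟩ := h.exists_eq y
  rw [h.linearOmega_mk, Prod.mk.injEq, h.isInvertible.injective.eq_iff,
    h.isInvertible.injective.eq_iff]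
  exact ⟨fun h ↦ h.1, fun h ↦ ⟨h, h.symm⟩⟩

lemma linearOmega_eq_neg_iff (y : E × (E →L[ℝ] ℝ)) :
    linearOmega Ω y = -y ↔ y.2 = Ω (-y.1) := by
  obtain ⟨a, b, rfl⟩ := h.exists_eq y
  rw [h.linearOmega_mk, Prod.neg_mk, Prod.mk.injEq, ← map_neg,
    h.isInvertible.injective.eq_iff, h.isInvertible.injective.eq_iff]
  exact ⟨fun h ↦ h.1, fun h ↦ ⟨h, by rw [h, neg_neg]⟩⟩

lemma linearJ_linearOmega_eq_iff (y : E × (E →L[ℝ] ℝ)) :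
    linearJ j (linearOmega Ω y) = y ↔ y.2 = Ω (-j y.1) := by
  obtain ⟨a, b, rfl⟩ := h.exists_eq y
  rw [h.linearOmega_mk, h.linearJ_mk, Prod.mk.injEq,
    ← map_neg, h.isInvertible.injective.eq_iff, h.isInvertible.injective.eq_iff]
  exact ⟨fun h ↦ h.2.symm, fun h' ↦ ⟨by rw [h', map_neg, h.sq, neg_neg], h'.symm⟩⟩

lemma linearJ_linearOmega_eq_neg_iff (y : E × (E →L[ℝ] ℝ)) :
    linearJ j (linearOmega Ω y) = -y ↔ y.2 = Ω (j y.1) := by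
  obtain ⟨a, b, rfl⟩ := h.exists_eq y
  rw [h.linearOmega_mk, h.linearJ_mk, Prod.neg_mk, Prod.mk.injEq,
    neg_inj, h.isInvertible.injective.eq_iff, h.isInvertible.injective.eq_iff]
  exact ⟨fun h ↦ h.2.symm, fun h' ↦ ⟨by rw [h', h.sq], h'.symm⟩⟩

end IsLinearKahler

end LinearModel

/-! ## Special charts -/

section SpecialChart

open Set Filter Topology

variable {E : Type*} [NormedAddCommGroup E] [NormedSpace ℝ E] [FiniteDimensional ℝ E]
  {H : Type*} [TopologicalSpace H] {I : ModelWithCorners ℝ E H}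
  {M : Type*} [TopologicalSpace M] [ChartedSpace H M] [IsManifold I ∞ M]
  {J : EndField I M} {g : BilinField I M}
  {D : CovariantDerivative I E (TangentSpace I : M → Type _)}

omit [FiniteDimensional ℝ E] in
lemma IsComplexStructure.exists_isSmoothChart (hJ : IsComplexStructure J) (x : M) :
    ∃ e : OpenPartialHomeomorph M E, x ∈ e.source ∧ IsSmoothChart I e := by
  obtain ⟨e, j, hx, he⟩ := hJ.exists_chart x
  exact ⟨e, hx, he.isSmoothChart⟩

lemma IsComplexStructure.isSmooth_fundamentalForm (hJ : IsComplexStructure J) (hg : g.IsSmooth) :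
    (fundamentalForm g J).IsSmooth := by
  intro x
  obtain ⟨e, hx, he⟩ := hJ.exists_isSmoothChart x
  have htarget : e.target ∈ 𝓝 (e x) := e.open_target.mem_nhds (e.map_source hx)
  have hB := (he.contDiffOn_chartBilin hg).contDiffAt htarget
  have hA := (he.contDiffOn_chartEnd fun x _ ↦ hJ.smooth x).contDiffAt htarget
  refine he.contMDiffAt_bilinField hx (hB.clm_comp hA) fun y hy v w ↦ ?_
  rw [ContinuousLinearMap.comp_apply, ← he.mvfderiv_endField J hy]
  exact he.bilinField_apply g hy _ _

namespace IsPseudoKahler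

variable (h : IsPseudoKahler J g)
include h

omit [FiniteDimensional ℝ E] in
lemma fundamentalForm_skew (x : M) (v w : TangentSpace I x) :
    fundamentalForm g J x v w = -fundamentalForm g J x w v :=
  (h.skew x v w).trans (congrArg _ (h.metric.symm x _ _))

omit [FiniteDimensional ℝ E] in
lemma fundamentalForm_apply_complex (x : M) (v w : TangentSpace I x) :
    fundamentalForm g J x (J x v) w = -fundamentalForm g J x v (J x w) :=
  h.skew x _ _

omit [FiniteDimensional ℝ E] in
lemma metric_eq_neg_fundamentalForm (x : M) (v w : TangentSpace I x) :
    g x v w = -fundamentalForm g J x (J x v) w := by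
  have hJJ : fundamentalForm g J x (J x v) w = g x (J x (J x v)) w := rfl
  rw [hJJ, h.complex.sq, map_neg, _root_.neg_apply, neg_neg]

lemma fundamentalForm_isInvertible (x : M) : (fundamentalForm g J x).IsInvertible := by
  refine isInvertible_of_nondegenerate (E := E) fun v hv ↦ ?_
  have hJv : J x v = 0 := h.metric.nondegenerate x _ hv
  have hsq := h.complex.sq x v
  rw [hJv, map_zero] at hsq
  exact neg_eq_zero.1 hsq.symm

lemma metric_isInvertible (x : M) : (g x).IsInvertible :=
  isInvertible_of_nondegenerate (E := E) (h.metric.nondegenerate x)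

lemma metric_inverse_apply (x : M) (α : TangentSpace I x →L[ℝ] ℝ) :
    (g x).inverse α = J x ((fundamentalForm g J x).inverse α) := by
  rw [(h.metric_isInvertible x).inverse_apply_eq]
  exact ((h.fundamentalForm_isInvertible x).self_apply_inverse α).symm

lemma isLinearKahler_of_chart {e : OpenPartialHomeomorph M E} (he : IsSmoothChart I e) {x : M}
    (hx : x ∈ e.source) {Ω : E →L[ℝ] E →L[ℝ] ℝ}
    (hΩ : ∀ v w, fundamentalForm g J x v w = Ω (mvfderiv I e x v) (mvfderiv I e x w)) :
    IsLinearKahler (chartEnd e J (e x)) Ω := by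
  have hsurj := (he.isInvertible hx).surjective
  refine ⟨fun v ↦ ?_, fun v w ↦ ?_, fun v w ↦ ?_, isInvertible_of_nondegenerate fun v hv ↦ ?_⟩ <;>
    obtain ⟨v, rfl⟩ := hsurj v
  · rw [← he.mvfderiv_endField J hx, ← he.mvfderiv_endField J hx, h.complex.sq, map_neg]
  · obtain ⟨w, rfl⟩ := hsurj w
    rw [← hΩ, ← hΩ, h.fundamentalForm_skew]
  · obtain ⟨w, rfl⟩ := hsurj w
    rw [← he.mvfderiv_endField J hx, ← he.mvfderiv_endField J hx, ← hΩ, ← hΩ,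
      h.fundamentalForm_apply_complex]
  · have hv0 : v = 0 := by
      refine (h.fundamentalForm_isInvertible x).injective ?_
      ext w
      rw [hΩ, hv, map_zero]
      rfl
    rw [hv0, map_zero]

end IsPseudoKahler

variable (J g D) in
/-- A chart in which the connection `D` is trivial and the Kähler form is constant, equal to `Ω`;
the symmetry of `DJ` then says that `J`, as an `E`-valued one-form, is closed. -/
structure IsSpecialChart (e : OpenPartialHomeomorph M E) (Ω : E →L[ℝ] E →L[ℝ] ℝ) : Prop
    extends IsSmoothChart I e where
  flat : IsFlatChart D e
  fundamentalForm_apply : ∀ x ∈ e.source, ∀ v w,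
    fundamentalForm g J x v w = Ω (mvfderiv I e x v) (mvfderiv I e x w)
  isLinearKahler : ∀ z ∈ e.target, IsLinearKahler (chartEnd e J z) Ω
  contDiffOn_complex : ContDiffOn ℝ ∞ (chartEnd e J) e.target
  fderiv_complex_symm : ∀ z ∈ e.target, ∀ u v,
    fderiv ℝ (chartEnd e J) z u v = fderiv ℝ (chartEnd e J) z v u

theorem IsSpecialPseudoKahler.exists_isSpecialChart [T2Space M] (h : IsSpecialPseudoKahler J g D)
    (x : M) : ∃ e Ω, x ∈ e.source ∧ IsSpecialChart J g D e Ω := by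
  obtain ⟨e₀, hx₀, he₀⟩ := h.complex.exists_isSmoothChart x
  obtain ⟨e, he, hx, hflat, r, hr⟩ :=
    exists_isFlatChart h.smooth_connection h.flat h.torsion_free he₀ hx₀
  have hconst : ∀ y ∈ e.source, ∀ v w, fundamentalForm g J y v w =
      chartBilin e (fundamentalForm g J) (e x) (mvfderiv I e y v) (mvfderiv I e y w) := by
    intro y hy v w
    rw [he.bilinField_apply _ hy, hflat.chartBilin_eq he (hr ▸ (convex_ball _ _).isPreconnected)
      (h.complex.isSmooth_fundamentalForm h.metric.smooth) h.parallel (e.map_source hy)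
      (e.map_source hx)]
  refine ⟨e, chartBilin e (fundamentalForm g J) (e x), hx, he, hflat, hconst, fun z hz ↦ ?_,
    he.contDiffOn_chartEnd fun x _ ↦ h.complex.smooth x,
    fun z hz u v ↦ hflat.fderiv_chartEnd_symm he h.complex.smooth h.symmetric hz u v⟩
  rw [← e.right_inv hz]
  exact h.isLinearKahler_of_chart he (e.map_target hz) (hconst _ (e.map_target hz))

end SpecialChart

/-! ## The structures on the cotangent bundle in induced charts -/

section CotangentCoordinates

open Set Filter Topology

variable {E : Type*} [NormedAddCommGroup E] [NormedSpace ℝ E] [FiniteDimensional ℝ E]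
  {M : Type*} [TopologicalSpace M] [ChartedSpace E M] [IsManifold 𝓘(ℝ, E) ∞ M]
  {e : OpenPartialHomeomorph M E}
  {D : CovariantDerivative 𝓘(ℝ, E) E (TangentSpace 𝓘(ℝ, E) : M → Type _)}
  {J : EndField 𝓘(ℝ, E) M} {g b : BilinField 𝓘(ℝ, E) M}

lemma splitting_cotangentJ (ξ : CotangentBundle E M) (w : TangentSpace (cotangentModel E) ξ) :
    splitting D ξ (cotangentJ D J ξ w) =
      (J ξ.proj (projDeriv ξ w), connectionMap D ξ w ∘L J ξ.proj) :=
  (splitting D ξ).apply_symm_apply _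

lemma splitting_cotangentOmega (ξ : CotangentBundle E M) (w : TangentSpace (cotangentModel E) ξ) :
    splitting D ξ (cotangentOmega D b ξ w) =
      ((b ξ.proj).inverse (connectionMap D ξ w), b ξ.proj (projDeriv ξ w)) :=
  (splitting D ξ).apply_symm_apply _

/-- The Christoffel terms of the horizontal lift cancel because `Γ` is complex symmetric. -/
lemma IsChristoffel.mvfderiv_cotangentJ {Γ : E → E →L[ℝ] E →L[ℝ] E}
    (hΓ : IsChristoffel D e Γ) (he : IsSmoothChart 𝓘(ℝ, E) e) {ξ : CotangentBundle E M}
    (hξ : ξ.proj ∈ e.source) {j : E →L[ℝ] E}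
    (hJ : ∀ v, mvfderiv 𝓘(ℝ, E) e ξ.proj (J ξ.proj v) = j (mvfderiv 𝓘(ℝ, E) e ξ.proj v))
    (hj : ∀ u v, Γ (e ξ.proj) (j u) v = Γ (e ξ.proj) u (j v))
    (w : TangentSpace (cotangentModel E) ξ) :
    mvfderiv (cotangentModel E) (cotangentChart e) ξ (cotangentJ D J ξ w) =
      linearJ j (mvfderiv (cotangentModel E) (cotangentChart e) ξ w) := by
  have hsplit := splitting_cotangentJ (D := D) (J := J) ξ w
  rw [splitting_apply, Prod.mk.injEq] at hsplit
  have hfst : (mvfderiv (cotangentModel E) (cotangentChart e) ξ (cotangentJ D J ξ w)).1 =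
      j (mvfderiv (cotangentModel E) (cotangentChart e) ξ w).1 := by
    rw [mvfderiv_cotangentChart_fst he hξ, mvfderiv_cotangentChart_fst he hξ, hsplit.1, hJ]
  refine Prod.ext hfst ?_
  ext u
  have hfield : J ξ.proj (chartField 𝓘(ℝ, E) e u ξ.proj) = chartField 𝓘(ℝ, E) e (j u) ξ.proj :=
    he.mvfderiv_injective hξ (by rw [hJ, he.mvfderiv_chartField hξ, he.mvfderiv_chartField hξ])
  have hsnd := hΓ.connectionMap_chartField he hξ (cotangentJ D J ξ w) u
  rw [hsplit.2, ContinuousLinearMap.comp_apply, hfield, hΓ.connectionMap_chartField he hξ w (j u),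
    hfst, hj, sub_left_inj] at hsnd
  exact hsnd.symm

lemma IsFlatChart.connectionMap_chartField (hflat : IsFlatChart D e)
    (he : IsSmoothChart 𝓘(ℝ, E) e) {ξ : CotangentBundle E M}
    (hξ : ξ.proj ∈ e.source) (w : TangentSpace (cotangentModel E) ξ) (u : E) :
    connectionMap D ξ w (chartField 𝓘(ℝ, E) e u ξ.proj) =
      (mvfderiv (cotangentModel E) (cotangentChart e) ξ w).2 u := by
  simp [hflat.isChristoffel.connectionMap_chartField he hξ w u]

namespace IsSpecialChart

variable {Ω : E →L[ℝ] E →L[ℝ] ℝ} (he : IsSpecialChart J g D e Ω) {ξ : CotangentBundle E M}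
  (hξ : ξ.proj ∈ e.source)
include he hξ

lemma connectionMap_apply (w : TangentSpace (cotangentModel E) ξ)
    (v : TangentSpace 𝓘(ℝ, E) ξ.proj) :
    connectionMap D ξ w v = (mvfderiv (cotangentModel E) (cotangentChart e) ξ w).2
      (mvfderiv 𝓘(ℝ, E) e ξ.proj v) := by
  rw [← he.flat.connectionMap_chartField he.toIsSmoothChart hξ, he.chartField_mvfderiv hξ]

lemma fundamentalForm_isInvertible : (fundamentalForm g J ξ.proj).IsInvertible := by
  refine isInvertible_of_nondegenerate (E := E)
    fun (v : TangentSpace 𝓘(ℝ, E) ξ.proj) hv ↦ ?_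
  refine he.mvfderiv_injective hξ (((he.isLinearKahler _ (e.map_source hξ)).isInvertible.injective
    ?_).trans (map_zero _).symm)
  ext u
  obtain ⟨w, rfl⟩ := (he.isInvertible hξ).surjective u
  rw [← he.fundamentalForm_apply _ hξ, map_zero, _root_.zero_apply]
  exact hv w

lemma mvfderiv_inverse_fundamentalForm
    {α : TangentSpace 𝓘(ℝ, E) ξ.proj →L[ℝ] ℝ} {β : E →L[ℝ] ℝ}
    (hα : ∀ v, α v = β (mvfderiv 𝓘(ℝ, E) e ξ.proj v)) :
    mvfderiv 𝓘(ℝ, E) e ξ.proj ((fundamentalForm g J ξ.proj).inverse α) = Ω.inverse β := by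
  have hΩ := (he.isLinearKahler _ (e.map_source hξ)).isInvertible
  refine hΩ.injective ?_
  rw [hΩ.self_apply_inverse]
  ext u
  obtain ⟨v, rfl⟩ := (he.isInvertible hξ).surjective u
  rw [← he.fundamentalForm_apply _ hξ,
    (he.fundamentalForm_isInvertible hξ).self_apply_inverse, hα]

lemma mvfderiv_cotangentJ (w : TangentSpace (cotangentModel E) ξ) :
    mvfderiv (cotangentModel E) (cotangentChart e) ξ (cotangentJ D J ξ w) =
      linearJ (chartEnd e J (e ξ.proj)) (mvfderiv (cotangentModel E) (cotangentChart e) ξ w) :=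
  he.flat.isChristoffel.mvfderiv_cotangentJ he.toIsSmoothChart hξ
    (fun v ↦ he.mvfderiv_endField J hξ v) (fun _ _ ↦ rfl) w

lemma mvfderiv_cotangentOmega (w : TangentSpace (cotangentModel E) ξ) :
    mvfderiv (cotangentModel E) (cotangentChart e) ξ
        (cotangentOmega D (fundamentalForm g J) ξ w) =
      linearOmega Ω (mvfderiv (cotangentModel E) (cotangentChart e) ξ w) := by
  have hsplit := splitting_cotangentOmega (D := D) (b := fundamentalForm g J) ξ w
  rw [splitting_apply, Prod.mk.injEq] at hsplit
  refine Prod.ext ?_ ?_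
  · rw [mvfderiv_cotangentChart_fst he.toIsSmoothChart hξ, hsplit.1]
    exact he.mvfderiv_inverse_fundamentalForm hξ (he.connectionMap_apply hξ w)
  · ext u
    rw [← he.flat.connectionMap_chartField he.toIsSmoothChart hξ, hsplit.2, linearOmega_apply,
      mvfderiv_cotangentChart_fst he.toIsSmoothChart hξ]
    refine (he.fundamentalForm_apply _ hξ _ _).trans ?_
    rw [he.mvfderiv_chartField hξ]

lemma mvfderiv_cotangentJ_cotangentOmega (w : TangentSpace (cotangentModel E) ξ) :
    mvfderiv (cotangentModel E) (cotangentChart e) ξ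
        (cotangentJ D J ξ (cotangentOmega D (fundamentalForm g J) ξ w)) =
      linearJ (chartEnd e J (e ξ.proj))
        (linearOmega Ω (mvfderiv (cotangentModel E) (cotangentChart e) ξ w)) := by
  rw [he.mvfderiv_cotangentJ hξ, he.mvfderiv_cotangentOmega hξ]

lemma cotangentMetric_apply (hK : IsPseudoKahler J g)
    (w w' : TangentSpace (cotangentModel E) ξ) :
    cotangentMetric D g ξ w w' = linearMetric (chartEnd e J (e ξ.proj)) Ω
      (mvfderiv (cotangentModel E) (cotangentChart e) ξ w)
      (mvfderiv (cotangentModel E) (cotangentChart e) ξ w') := by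
  have hsplit : cotangentMetric D g ξ w w' = g ξ.proj (projDeriv ξ w) (projDeriv ξ w') -
      g ξ.proj ((g ξ.proj).inverse (connectionMap D ξ w))
        ((g ξ.proj).inverse (connectionMap D ξ w')) := rfl
  rw [hsplit, linearMetric_apply]
  congr 1
  · rw [hK.metric_eq_neg_fundamentalForm, he.fundamentalForm_apply _ hξ,
      he.mvfderiv_endField J hξ, mvfderiv_cotangentChart_fst he.toIsSmoothChart hξ,
      mvfderiv_cotangentChart_fst he.toIsSmoothChart hξ]
  · rw [(hK.metric_isInvertible _).self_apply_inverse]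
    refine (he.connectionMap_apply hξ w _).trans (congrArg _ ?_)
    refine (congrArg _ (hK.metric_inverse_apply _ _)).trans ?_
    rw [he.mvfderiv_endField J hξ]
    exact congrArg _ (he.mvfderiv_inverse_fundamentalForm hξ (he.connectionMap_apply hξ w'))

end IsSpecialChart

end CotangentCoordinates

/-! ## Para-complex structures -/

section ParaComplex

variable {E : Type*} [NormedAddCommGroup E] [NormedSpace ℝ E]
  {H : Type*} [TopologicalSpace H] {I : ModelWithCorners ℝ E H}
  {M : Type*} [TopologicalSpace M] [ChartedSpace H M] {K J : EndField I M}

lemma mem_plusDistribution_iff {x : M} {v : TangentSpace I x} :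
    v ∈ plusDistribution J x ↔ J x v = v :=
  (LinearMap.mem_ker.trans sub_eq_zero).trans eq_comm

lemma mem_minusDistribution_iff {x : M} {v : TangentSpace I x} :
    v ∈ minusDistribution J x ↔ J x v = -v :=
  LinearMap.mem_ker.trans (add_eq_zero_iff_eq_neg'.trans Iff.rfl)

section Anticommute

variable {x : M} (hKJ : ∀ v, K x (J x v) = -J x (K x v))
include hKJ

lemma apply_mem_minusDistribution_of_anticommute {v : TangentSpace I x}
    (hv : v ∈ plusDistribution J x) : K x v ∈ minusDistribution J x := by
  rw [mem_plusDistribution_iff] at hv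
  have h := hKJ v
  rw [hv] at h
  exact mem_minusDistribution_iff.2 (neg_eq_iff_eq_neg.1 h.symm)

lemma apply_mem_plusDistribution_of_anticommute {v : TangentSpace I x}
    (hv : v ∈ minusDistribution J x) : K x v ∈ plusDistribution J x := by
  rw [mem_minusDistribution_iff] at hv
  have h := hKJ v
  rw [hv, map_neg, neg_inj] at h
  exact mem_plusDistribution_iff.2 h.symm

lemma finrank_plusDistribution_eq_of_anticommute (hK : ∀ v, K x (K x v) = -v) :
    Module.finrank ℝ (plusDistribution J x) = Module.finrank ℝ (minusDistribution J x) := by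
  have hleft : ∀ v, K x (-K x v) = v := fun v ↦ by rw [map_neg, hK, neg_neg]
  have hright : ∀ v, -K x (K x v) = v := fun v ↦ by rw [hK, neg_neg]
  refine LinearEquiv.finrank_eq (LinearEquiv.ofLinearMap
    ((K x).toLinearMap.restrict fun _ ↦ apply_mem_minusDistribution_of_anticommute hKJ)
    (-(K x).toLinearMap.restrict fun _ ↦ apply_mem_plusDistribution_of_anticommute hKJ) ?_ ?_)
  · ext v
    exact hleft v
  · ext v
    exact hright v

lemma ne_id_of_anticommute [Nontrivial E] (hK : ∀ v, K x (K x v) = -v) :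
    J x ≠ ContinuousLinearMap.id ℝ (TangentSpace I x) := by
  intro hx
  have : Nontrivial (TangentSpace I x) := inferInstanceAs (Nontrivial E)
  obtain ⟨v, hv⟩ := exists_ne (0 : TangentSpace I x)
  have hJ : ∀ w, J x w = w := fun w ↦ congr($hx w)
  have hKv : K x v = 0 := by
    have h := hKJ v
    rw [hJ, hJ, eq_neg_iff_add_eq_zero, ← two_smul ℝ] at h
    exact (smul_eq_zero.1 h).resolve_left two_ne_zero
  have h := hK v
  rw [hKv, map_zero] at h
  exact hv (neg_eq_zero.1 h.symm)

end Anticommute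

lemma isAlmostParaComplex_of_anticommute [IsManifold I ∞ M] [Nontrivial E]
    (hJ : J.IsSmooth) (hK : ∀ x v, K x (K x v) = -v) (hJJ : ∀ x v, J x (J x v) = v)
    (hKJ : ∀ x v, K x (J x v) = -J x (K x v)) : IsAlmostParaComplex J where
  smooth := hJ
  ne_id x := ne_id_of_anticommute (hKJ x) (hK x)
  sq := hJJ
  finrank_eq x := finrank_plusDistribution_eq_of_anticommute (hKJ x) (hK x)

end ParaComplex

/-! ## Graphs of closed one-forms -/

section Graph

open Set Filter Topology

lemma exists_hasFDerivAt_of_fderiv_symm {E W : Type*} [NormedAddCommGroup E] [NormedSpace ℝ E]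
    [FiniteDimensional ℝ E] [NormedAddCommGroup W] [NormedSpace ℝ W] [CompleteSpace W]
    {L : E →L[ℝ] W} {ψ : E → E →L[ℝ] E} {O : Set E} (hO : IsOpen O) (hψ : ContDiffOn ℝ ∞ ψ O)
    (hs : ∀ z ∈ O, ∀ u v, fderiv ℝ ψ z u v = fderiv ℝ ψ z v u) {x₀ : E} (hx₀ : x₀ ∈ O) (w₀ : W) :
    ∃ (σ : E → W) (U : Set E), IsOpen U ∧ x₀ ∈ U ∧ σ x₀ = w₀ ∧ ContDiffOn ℝ ∞ σ U ∧
      ∀ x ∈ U, x ∈ O ∧ HasFDerivAt σ (L ∘L ψ x) x := by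
  have hderiv : ∀ q : E × W, q.1 ∈ O → HasFDerivAt (fun q : E × W ↦ L ∘L ψ q.1)
      (ContinuousLinearMap.compL ℝ E E W L ∘L fderiv ℝ ψ q.1 ∘L
        ContinuousLinearMap.fst ℝ E W) q := fun q hq ↦
    HasFDerivAt.comp (g := ContinuousLinearMap.compL ℝ E E W L) q
      (ContinuousLinearMap.compL ℝ E E W L).hasFDerivAt
      (((hψ.contDiffAt (hO.mem_nhds hq)).differentiableAt (by simp)).hasFDerivAt.comp q
        hasFDerivAt_fst)
  obtain ⟨σ, U, hU, hxU, hσ, hσs, h⟩ := exists_contDiffOn_hasFDerivAt_of_integrable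
    (φ := fun q : E × W ↦ L ∘L ψ q.1) (O := O ×ˢ univ) (x₀ := x₀) (w₀ := w₀)
    (hO.prod isOpen_univ)
    (contDiffOn_const.clm_comp (hψ.comp contDiffOn_fst fun q hq ↦ hq.1))
    (fun q hq u v ↦ by
      rw [(hderiv q hq.1).fderiv]
      exact congrArg L (hs _ hq.1 u v)) ⟨hx₀, trivial⟩
  exact ⟨σ, U, hU, hxU, hσ, hσs, fun x hx ↦ ⟨(h x hx).1.1, (h x hx).2⟩⟩

variable {E : Type*} [NormedAddCommGroup E] [NormedSpace ℝ E] [FiniteDimensional ℝ E]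
  {M : Type*} [TopologicalSpace M] [ChartedSpace E M] [IsManifold 𝓘(ℝ, E) ∞ M]

/-- The symmetry of `Dψ` makes `Ω ∘ ψ` the derivative of some `σ`, and the graph of `σ` is the
integral manifold. -/
theorem isIntegrableDistribution_cotangent
    {F : ∀ ξ : CotangentBundle E M, Submodule ℝ (TangentSpace (cotangentModel E) ξ)}
    (h : ∀ p : M, ∃ (e : OpenPartialHomeomorph M E) (Ω : E →L[ℝ] E →L[ℝ] ℝ) (ψ : E → E →L[ℝ] E),
      p ∈ e.source ∧ IsSmoothChart 𝓘(ℝ, E) e ∧ ContDiffOn ℝ ∞ ψ e.target ∧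
      (∀ z ∈ e.target, ∀ u v, fderiv ℝ ψ z u v = fderiv ℝ ψ z v u) ∧
      ∀ ξ : CotangentBundle E M, ξ.proj ∈ e.source → ∀ w, w ∈ F ξ ↔
        (mvfderiv (cotangentModel E) (cotangentChart e) ξ w).2 =
          Ω (ψ (e ξ.proj) (mvfderiv (cotangentModel E) (cotangentChart e) ξ w).1)) :
    IsIntegrableDistribution F := by
  refine isIntegrableDistribution_of_chart (V := E) fun ξ ↦ ?_
  obtain ⟨e, Ω, ψ, hξ, he, hψ, hs, hF⟩ := h ξ.proj
  obtain ⟨σ, U, hU, hxU, hσ, hσs, hσd⟩ := exists_hasFDerivAt_of_fderiv_symm (L := Ω) e.open_target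
    hψ hs (e.map_source hξ) (cotangentChart e ξ).2
  have hgraph : ∀ x ∈ U, HasFDerivAt (fun x ↦ (x, σ x))
      ((ContinuousLinearMap.id ℝ E).prod (Ω ∘L ψ x)) x :=
    fun x hx ↦ (hasFDerivAt_id x).prodMk (hσd x hx).2
  refine ⟨he.cotangent, U, e ξ.proj, fun x ↦ (x, σ x), he.isSmoothChart_cotangent, hξ, hU, hxU,
    Prod.ext rfl hσ, contDiffOn_id.prodMk hσs, fun x hx ↦ ⟨(hσd x hx).1, trivial⟩,
    fun x hx ↦ ⟨?_, fun w ↦ ?_⟩⟩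
  · rw [(hgraph x hx).fderiv]
    exact fun a b hab ↦ congrArg Prod.fst hab
  · rw [(hgraph x hx).fderiv, hF _ (e.map_target (hσd x hx).1)]
    have hx' : e (e.symm x) = x := e.right_inv (hσd x hx).1
    change _ = Ω (ψ (e (e.symm x)) _) ↔ _
    rw [hx']
    constructor
    · intro hw
      exact ⟨_, Prod.ext rfl hw.symm⟩
    · rintro ⟨a, ha⟩
      have ha' : (a, Ω (ψ x a)) = mvfderiv (cotangentModel E) (cotangentChart e)
        (he.cotangent.symm (x, σ x)) w := ha
      rw [← ha']

end Graph

/-! ## Smoothness and algebraic relations on the cotangent bundle -/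

section ModelSmoothness

variable {E : Type*} [NormedAddCommGroup E] [NormedSpace ℝ E]
  {V : Type*} [NormedAddCommGroup V] [NormedSpace ℝ V]

lemma contDiff_diagonalForm [FiniteDimensional ℝ V] (p : V →L[ℝ] E) (q : V →L[ℝ] E →L[ℝ] ℝ)
    (Ω : E →L[ℝ] E →L[ℝ] ℝ) : ContDiff ℝ ∞ (fun j ↦ diagonalForm p q j Ω) := by
  have happly : ∀ a : E, ContDiff ℝ ∞ (fun j : E →L[ℝ] E ↦ j a) :=
    fun a ↦ contDiff_id.clm_apply contDiff_const
  rw [contDiff_clm_apply_iff]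
  intro y
  rw [contDiff_clm_apply_iff]
  intro y'
  simp only [diagonalForm_apply]
  exact ((Ω.contDiff.comp (happly _)).clm_apply contDiff_const).neg.sub
    ((q y).contDiff.comp (happly _))

lemma contDiff_clm_prodMap {X E' V' : Type*} [NormedAddCommGroup X] [NormedSpace ℝ X]
    [NormedAddCommGroup E'] [NormedSpace ℝ E'] [NormedAddCommGroup V'] [NormedSpace ℝ V']
    {A : X → E →L[ℝ] E'} {B : X → V →L[ℝ] V'}
    (hA : ContDiff ℝ ∞ A) (hB : ContDiff ℝ ∞ B) :
    ContDiff ℝ ∞ fun x ↦ (A x).prodMap (B x) :=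
  (ContinuousLinearMap.prodMapL ℝ E E' V V').contDiff.comp (hA.prodMk hB)

lemma contDiff_linearJ : ContDiff ℝ ∞ fun j : E →L[ℝ] E ↦ linearJ j := by
  have hdual : ContDiff ℝ ∞ fun j : E →L[ℝ] E ↦ (ContinuousLinearMap.compL ℝ E E ℝ).flip j :=
    ContinuousLinearMap.contDiff _
  exact contDiff_clm_prodMap (A := fun j : E →L[ℝ] E ↦ j) contDiff_id hdual

namespace IsSpecialChart

variable {M : Type*} [TopologicalSpace M] [ChartedSpace E M] [IsManifold 𝓘(ℝ, E) ∞ M]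
  {e : OpenPartialHomeomorph M E}
  {D : CovariantDerivative 𝓘(ℝ, E) E (TangentSpace 𝓘(ℝ, E) : M → Type _)}
  {J : EndField 𝓘(ℝ, E) M} {g : BilinField 𝓘(ℝ, E) M} {Ω : E →L[ℝ] E →L[ℝ] ℝ}
  (he : IsSpecialChart J g D e Ω) {z : E × (E →L[ℝ] ℝ)} (hz : z.1 ∈ e.target)
include he hz

lemma contDiffAt_chartEnd_fst :
    ContDiffAt ℝ ∞ (fun z : E × (E →L[ℝ] ℝ) ↦ chartEnd e J z.1) z :=
  (he.contDiffOn_complex.contDiffAt (e.open_target.mem_nhds hz)).comp z contDiffAt_fst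

lemma contDiffAt_linearJ :
    ContDiffAt ℝ ∞ (fun z : E × (E →L[ℝ] ℝ) ↦ linearJ (chartEnd e J z.1)) z :=
  (contDiff_linearJ (E := E)).contDiffAt.comp z (he.contDiffAt_chartEnd_fst hz)

lemma contDiffAt_linearMetric [FiniteDimensional ℝ E] :
    ContDiffAt ℝ ∞ (fun z : E × (E →L[ℝ] ℝ) ↦ linearMetric (chartEnd e J z.1) Ω) z :=
  (contDiff_diagonalForm _ _ Ω).contDiffAt.comp z (he.contDiffAt_chartEnd_fst hz)

end IsSpecialChart

end ModelSmoothness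

section Cotangent

open Set Filter Topology

variable {E : Type*} [NormedAddCommGroup E] [NormedSpace ℝ E] [FiniteDimensional ℝ E]
  {M : Type*} [TopologicalSpace M] [ChartedSpace E M] [IsManifold 𝓘(ℝ, E) ∞ M]
  {D : CovariantDerivative 𝓘(ℝ, E) E (TangentSpace 𝓘(ℝ, E) : M → Type _)}
  {J : EndField 𝓘(ℝ, E) M} {g : BilinField 𝓘(ℝ, E) M}

namespace IsSpecialPseudoKahler

variable [T2Space M] (h : IsSpecialPseudoKahler J g D)
include h

lemma cotangentJ_sq (ξ : CotangentBundle E M) (w : TangentSpace (cotangentModel E) ξ) :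
    cotangentJ D J ξ (cotangentJ D J ξ w) = -w := by
  obtain ⟨e, Ω, hξ, he⟩ := h.exists_isSpecialChart ξ.proj
  refine he.isSmoothChart_cotangent.mvfderiv_injective hξ ?_
  refine (he.mvfderiv_cotangentJ hξ _).trans ?_
  rw [he.mvfderiv_cotangentJ hξ, (he.isLinearKahler _ (e.map_source hξ)).linearJ_sq]
  exact (ContinuousLinearMap.map_neg _ _).symm

lemma cotangentOmega_sq (ξ : CotangentBundle E M) (w : TangentSpace (cotangentModel E) ξ) :
    cotangentOmega D (fundamentalForm g J) ξ (cotangentOmega D (fundamentalForm g J) ξ w) = w := by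
  obtain ⟨e, Ω, hξ, he⟩ := h.exists_isSpecialChart ξ.proj
  refine he.isSmoothChart_cotangent.mvfderiv_injective hξ ?_
  refine (he.mvfderiv_cotangentOmega hξ _).trans ?_
  rw [he.mvfderiv_cotangentOmega hξ, (he.isLinearKahler _ (e.map_source hξ)).linearOmega_sq]
  rfl

lemma cotangentJ_cotangentOmega (ξ : CotangentBundle E M)
    (w : TangentSpace (cotangentModel E) ξ) :
    cotangentJ D J ξ (cotangentOmega D (fundamentalForm g J) ξ w) =
      - cotangentOmega D (fundamentalForm g J) ξ (cotangentJ D J ξ w) := by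
  obtain ⟨e, Ω, hξ, he⟩ := h.exists_isSpecialChart ξ.proj
  refine he.isSmoothChart_cotangent.mvfderiv_injective hξ ?_
  refine (he.mvfderiv_cotangentJ_cotangentOmega hξ _).trans ?_
  rw [(he.isLinearKahler _ (e.map_source hξ)).linearJ_linearOmega, ← he.mvfderiv_cotangentJ hξ,
    ← he.mvfderiv_cotangentOmega hξ]
  exact (ContinuousLinearMap.map_neg _ _).symm

lemma isSmooth_cotangentJ : (cotangentJ D J).IsSmooth := by
  intro ξ
  obtain ⟨e, Ω, hξ, he⟩ := h.exists_isSpecialChart ξ.proj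
  exact he.isSmoothChart_cotangent.contMDiffAt_endField hξ
    (he.contDiffAt_linearJ (e.map_source hξ)) fun η hη w ↦ he.mvfderiv_cotangentJ hη w

lemma isSmooth_cotangentOmega : (cotangentOmega D (fundamentalForm g J)).IsSmooth := by
  intro ξ
  obtain ⟨e, Ω, hξ, he⟩ := h.exists_isSpecialChart ξ.proj
  exact he.isSmoothChart_cotangent.contMDiffAt_endField hξ
    (contDiffAt_const (c := linearOmega Ω)) fun η hη w ↦ he.mvfderiv_cotangentOmega hη w

lemma isSmooth_cotangentJ_comp_cotangentOmega :
    EndField.IsSmooth fun ξ : CotangentBundle E M ↦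
      cotangentJ D J ξ ∘L cotangentOmega D (fundamentalForm g J) ξ := by
  intro ξ
  obtain ⟨e, Ω, hξ, he⟩ := h.exists_isSpecialChart ξ.proj
  exact he.isSmoothChart_cotangent.contMDiffAt_endField hξ
    ((he.contDiffAt_linearJ (e.map_source hξ)).clm_comp
      (contDiffAt_const (c := linearOmega Ω))) fun η hη w ↦
        he.mvfderiv_cotangentJ_cotangentOmega hη w

lemma isPseudoRiemannian_cotangentMetric : IsPseudoRiemannian (cotangentMetric D g) where
  smooth := by
    intro ξ
    obtain ⟨e, Ω, hξ, he⟩ := h.exists_isSpecialChart ξ.proj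
    exact he.isSmoothChart_cotangent.contMDiffAt_bilinField hξ
      (he.contDiffAt_linearMetric (e.map_source hξ)) fun η hη w w' ↦
        he.cotangentMetric_apply hη h.toIsPseudoKahler w w'
  symm ξ w w' := by
    obtain ⟨e, Ω, hξ, he⟩ := h.exists_isSpecialChart ξ.proj
    rw [he.cotangentMetric_apply hξ h.toIsPseudoKahler,
      he.cotangentMetric_apply hξ h.toIsPseudoKahler,
      (he.isLinearKahler _ (e.map_source hξ)).linearMetric_symm]
  nondegenerate ξ w hw := by
    obtain ⟨e, Ω, hξ, he⟩ := h.exists_isSpecialChart ξ.proj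
    refine he.isSmoothChart_cotangent.mvfderiv_injective hξ ?_
    refine ((he.isLinearKahler _ (e.map_source hξ)).linearMetric_nondegenerate fun y ↦ ?_).trans
      (ContinuousLinearMap.map_zero _).symm
    obtain ⟨w', rfl⟩ := (he.isSmoothChart_cotangent.isInvertible hξ).surjective y
    rw [← hw w']
    exact (he.cotangentMetric_apply hξ h.toIsPseudoKahler w w').symm

lemma isSkew_cotangentJ : IsSkew (cotangentMetric D g) (cotangentJ D J) := by
  intro ξ w w'
  obtain ⟨e, Ω, hξ, he⟩ := h.exists_isSpecialChart ξ.proj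
  rw [he.cotangentMetric_apply hξ h.toIsPseudoKahler,
    he.cotangentMetric_apply hξ h.toIsPseudoKahler, he.mvfderiv_cotangentJ hξ,
    he.mvfderiv_cotangentJ hξ, (he.isLinearKahler _ (e.map_source hξ)).linearMetric_linearJ_skew]

lemma isSkew_cotangentOmega :
    IsSkew (cotangentMetric D g) (cotangentOmega D (fundamentalForm g J)) := by
  intro ξ w w'
  obtain ⟨e, Ω, hξ, he⟩ := h.exists_isSpecialChart ξ.proj
  rw [he.cotangentMetric_apply hξ h.toIsPseudoKahler,
    he.cotangentMetric_apply hξ h.toIsPseudoKahler, he.mvfderiv_cotangentOmega hξ,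
    he.mvfderiv_cotangentOmega hξ,
    (he.isLinearKahler _ (e.map_source hξ)).linearMetric_linearOmega_skew]

end IsSpecialPseudoKahler

end Cotangent

/-! ## Closedness of the fundamental forms -/

section Closedness

open Set Filter Topology

lemma fderiv_bilin_apply_of_eventually {V : Type*} [NormedAddCommGroup V] [NormedSpace ℝ V]
    {B : V → V →L[ℝ] V →L[ℝ] ℝ} {z : V} (hB : DifferentiableAt ℝ B z) {b : V → ℝ} {v w : V}
    (hb : ∀ᶠ y in 𝓝 z, B y v w = b y) (u : V) : fderiv ℝ B z u v w = fderiv ℝ b z u := by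
  have hBv : DifferentiableAt ℝ (fun y ↦ B y v) z := hB.clm_apply (differentiableAt_const v)
  rw [← fderiv_clm_apply_const hB, ← fderiv_clm_apply_const hBv]
  exact congr($(Filter.EventuallyEq.fderiv_eq hb) u)

lemma fderiv_apply_sub_apply {V W : Type*} [NormedAddCommGroup V]
    [NormedSpace ℝ V] [NormedAddCommGroup W] [NormedSpace ℝ W] {f : V → V →L[ℝ] V} {z : V × W}
    (hf : DifferentiableAt ℝ f z.1) (α β : V →L[ℝ] ℝ) (a b : V) (u : V × W) :
    fderiv ℝ (fun y : V × W ↦ α (f y.1 a) - β (f y.1 b)) z u =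
      α (fderiv ℝ f z.1 u.1 a) - β (fderiv ℝ f z.1 u.1 b) := by
  have hterm : ∀ (α : V →L[ℝ] ℝ) (a : V), HasFDerivAt (fun y : V × W ↦ α (f y.1 a))
      (α ∘L (ContinuousLinearMap.apply ℝ V a ∘L fderiv ℝ f z.1) ∘L ContinuousLinearMap.fst ℝ V W)
      z := by
    intro α a
    have hfa : HasFDerivAt (fun x ↦ f x a)
        (ContinuousLinearMap.apply ℝ V a ∘L fderiv ℝ f z.1) z.1 :=
      (ContinuousLinearMap.apply ℝ V a).hasFDerivAt.comp z.1 hf.hasFDerivAt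
    exact α.hasFDerivAt.comp z (hfa.comp z hasFDerivAt_fst)
  rw [((hterm α a).fun_sub (hterm β b)).fderiv]
  rfl

variable {E : Type*} [NormedAddCommGroup E] [NormedSpace ℝ E] [FiniteDimensional ℝ E]
  {M : Type*} [TopologicalSpace M] [ChartedSpace E M] [IsManifold 𝓘(ℝ, E) ∞ M]
  {D : CovariantDerivative 𝓘(ℝ, E) E (TangentSpace 𝓘(ℝ, E) : M → Type _)}
  {J : EndField 𝓘(ℝ, E) M} {g : BilinField 𝓘(ℝ, E) M}

namespace IsSpecialPseudoKahler

variable [T2Space M] (h : IsSpecialPseudoKahler J g D)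
include h

lemma isClosedForm_of_linear {K : EndField (cotangentModel E) (CotangentBundle E M)}
    {A : (E →L[ℝ] E) → (E →L[ℝ] E →L[ℝ] ℝ) → E × (E →L[ℝ] ℝ) →L[ℝ] E × (E →L[ℝ] ℝ)}
    {b : (E →L[ℝ] E) → (E →L[ℝ] E →L[ℝ] ℝ) → E × (E →L[ℝ] ℝ) → E × (E →L[ℝ] ℝ) → ℝ}
    (hK : ∀ {e Ω}, IsSpecialChart J g D e Ω → ∀ ξ : CotangentBundle E M, ξ.proj ∈ e.source →
      ∀ w, mvfderiv (cotangentModel E) (cotangentChart e) ξ (K ξ w) =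
        A (chartEnd e J (e ξ.proj)) Ω (mvfderiv (cotangentModel E) (cotangentChart e) ξ w))
    (hA : ∀ {e Ω}, IsSpecialChart J g D e Ω → ∀ z : E × (E →L[ℝ] ℝ), z.1 ∈ e.target →
      DifferentiableAt ℝ (fun z : E × (E →L[ℝ] ℝ) ↦ A (chartEnd e J z.1) Ω) z)
    (hb : ∀ {j Ω}, IsLinearKahler j Ω → ∀ y y', linearMetric j Ω (A j Ω y) y' = b j Ω y y')
    (hskew : ∀ {j Ω}, IsLinearKahler j Ω → ∀ y y', b j Ω y y' = -b j Ω y' y)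
    (hclosed : ∀ {e Ω}, IsSpecialChart J g D e Ω → ∀ z : E × (E →L[ℝ] ℝ), z.1 ∈ e.target →
      ∀ u v w, fderiv ℝ (fun z : E × (E →L[ℝ] ℝ) ↦ b (chartEnd e J z.1) Ω v w) z u -
        fderiv ℝ (fun z : E × (E →L[ℝ] ℝ) ↦ b (chartEnd e J z.1) Ω u w) z v +
        fderiv ℝ (fun z : E × (E →L[ℝ] ℝ) ↦ b (chartEnd e J z.1) Ω u v) z w = 0) :
    IsClosedForm (fundamentalForm (cotangentMetric D g) K) := by
  refine isClosedForm_of_chart fun ξ ↦ ?_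
  obtain ⟨e, Ω, hξ, he⟩ := h.exists_isSpecialChart ξ.proj
  have hz : (cotangentChart e ξ).1 ∈ e.target := e.map_source hξ
  have hlin : ∀ᶠ z in 𝓝 (cotangentChart e ξ), IsLinearKahler (chartEnd e J z.1) Ω := by
    filter_upwards [(e.open_target.preimage continuous_fst).mem_nhds hz] with z hz using
      he.isLinearKahler _ hz
  have hd := ((he.contDiffAt_linearMetric hz).differentiableAt (by simp)).clm_comp (hA he _ hz)
  have hB := fun u v w ↦ fderiv_bilin_apply_of_eventually hd (hlin.mono fun z hz ↦ hb hz v w) u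
  refine ⟨he.cotangent, _, he.isSmoothChart_cotangent, hξ, hd, fun η hη w w' ↦ ?_,
    fun y y' ↦ ?_, fun u v w ↦ ?_⟩
  · refine (he.cotangentMetric_apply hη h.toIsPseudoKahler _ _).trans ?_
    exact congrArg (fun y ↦ linearMetric (chartEnd e J (e η.proj)) Ω y _) (hK he η hη w)
  · have hk := he.isLinearKahler _ hz
    exact (hb hk y y').trans ((hskew hk y y').trans (congrArg Neg.neg (hb hk y' y).symm))
  · refine (congrArg₂ (· + ·) (congrArg₂ (· - ·) (hB u v w) (hB v u w)) (hB w u v)).trans ?_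
    exact hclosed he _ hz u v w

lemma isClosedForm_cotangentJ :
    IsClosedForm (fundamentalForm (cotangentMetric D g) (cotangentJ D J)) := by
  refine h.isClosedForm_of_linear (A := fun j _ ↦ linearJ j)
    (b := fun _ Ω y y' ↦ Ω y.1 y'.1 + y.2 (Ω.inverse y'.2))
    (fun he ξ hξ ↦ he.mvfderiv_cotangentJ hξ)
    (fun he z hz ↦ (he.contDiffAt_linearJ hz).differentiableAt (by simp))
    IsLinearKahler.linearMetric_linearJ (fun hk y y' ↦ ?_) (fun _ _ _ _ _ _ ↦ by simp)
  rw [hk.skew, hk.inverse_skew]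
  ring

lemma isClosedForm_cotangentJ_comp_cotangentOmega :
    IsClosedForm (fundamentalForm (cotangentMetric D g)
      fun ξ ↦ cotangentJ D J ξ ∘L cotangentOmega D (fundamentalForm g J) ξ) :=
  h.isClosedForm_of_linear (A := fun j Ω ↦ linearJ j ∘L linearOmega Ω)
    (b := fun _ _ y y' ↦ y.2 y'.1 - y'.2 y.1)
    (fun he ξ hξ ↦ he.mvfderiv_cotangentJ_cotangentOmega hξ)
    (fun he z hz ↦ ((he.contDiffAt_linearJ hz).differentiableAt (by simp)).clm_comp
      (differentiableAt_const _))
    IsLinearKahler.linearMetric_linearJ_linearOmega (fun _ _ _ ↦ by ring)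
    (fun _ _ _ _ _ _ ↦ by simp)

lemma isClosedForm_cotangentOmega :
    IsClosedForm (fundamentalForm (cotangentMetric D g)
      (cotangentOmega D (fundamentalForm g J))) := by
  refine h.isClosedForm_of_linear (A := fun _ Ω ↦ linearOmega Ω)
    (b := fun j _ y y' ↦ y.2 (j y'.1) - y'.2 (j y.1))
    (fun he ξ hξ ↦ he.mvfderiv_cotangentOmega hξ)
    (fun _ _ _ ↦ differentiableAt_const _)
    IsLinearKahler.linearMetric_linearOmega (fun _ _ _ ↦ by ring)
    (fun {e Ω} he z hz u v w ↦ ?_)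
  have hj : DifferentiableAt ℝ (chartEnd e J) z.1 :=
    (he.contDiffOn_complex.contDiffAt (e.open_target.mem_nhds hz)).differentiableAt (by simp)
  have hsymm := he.fderiv_complex_symm _ hz
  rw [fderiv_apply_sub_apply hj, fderiv_apply_sub_apply hj, fderiv_apply_sub_apply hj,
    hsymm u.1 v.1, hsymm u.1 w.1, hsymm v.1 w.1]
  ring

end IsSpecialPseudoKahler

end Closedness

/-! ## The para-hyper-Kähler structure -/

section ParaHyperKahler

variable {E : Type*} [NormedAddCommGroup E] [NormedSpace ℝ E] [FiniteDimensional ℝ E]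
  {M : Type*} [TopologicalSpace M] [ChartedSpace E M] [IsManifold 𝓘(ℝ, E) ∞ M]
  {D : CovariantDerivative 𝓘(ℝ, E) E (TangentSpace 𝓘(ℝ, E) : M → Type _)}
  {J : EndField 𝓘(ℝ, E) M} {g : BilinField 𝓘(ℝ, E) M}

namespace IsSpecialPseudoKahler

variable [T2Space M] (h : IsSpecialPseudoKahler J g D)
include h

theorem isParaComplexStructure_cotangentOmega [Nontrivial E] :
    IsParaComplexStructure (cotangentOmega D (fundamentalForm g J)) where
  toIsAlmostParaComplex := isAlmostParaComplex_of_anticommute h.isSmooth_cotangentOmega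
    h.cotangentJ_sq h.cotangentOmega_sq h.cotangentJ_cotangentOmega
  integrable_plus := by
    refine isIntegrableDistribution_cotangent fun p ↦ ?_
    obtain ⟨e, Ω, hp, he⟩ := h.exists_isSpecialChart p
    refine ⟨e, Ω, fun _ ↦ ContinuousLinearMap.id ℝ E, hp, he.toIsSmoothChart, contDiffOn_const,
      fun z _ u v ↦ by simp, fun ξ hξ w ↦ ?_⟩
    rw [mem_plusDistribution_iff, ← (he.isSmoothChart_cotangent.isInvertible hξ).injective.eq_iff]
    refine Iff.trans (Eq.congr_left (he.mvfderiv_cotangentOmega hξ w)) ?_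
    exact (he.isLinearKahler _ (e.map_source hξ)).linearOmega_eq_iff _
  integrable_minus := by
    refine isIntegrableDistribution_cotangent fun p ↦ ?_
    obtain ⟨e, Ω, hp, he⟩ := h.exists_isSpecialChart p
    refine ⟨e, Ω, fun _ ↦ -ContinuousLinearMap.id ℝ E, hp, he.toIsSmoothChart, contDiffOn_const,
      fun z _ u v ↦ by simp, fun ξ hξ w ↦ ?_⟩
    rw [mem_minusDistribution_iff, ← (he.isSmoothChart_cotangent.isInvertible hξ).injective.eq_iff,
      ContinuousLinearMap.map_neg]
    refine Iff.trans (Eq.congr_left (he.mvfderiv_cotangentOmega hξ w)) ?_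
    exact (he.isLinearKahler _ (e.map_source hξ)).linearOmega_eq_neg_iff _

lemma cotangentJ_comp_cotangentOmega_sq (ξ : CotangentBundle E M)
    (w : TangentSpace (cotangentModel E) ξ) :
    (cotangentJ D J ξ ∘L cotangentOmega D (fundamentalForm g J) ξ)
      ((cotangentJ D J ξ ∘L cotangentOmega D (fundamentalForm g J) ξ) w) = w := by
  simp only [ContinuousLinearMap.comp_apply]
  rw [h.cotangentJ_cotangentOmega, h.cotangentJ_sq, ContinuousLinearMap.map_neg,
    h.cotangentOmega_sq, neg_neg]

lemma cotangentJ_cotangentJ_comp_cotangentOmega (ξ : CotangentBundle E M)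
    (w : TangentSpace (cotangentModel E) ξ) :
    cotangentJ D J ξ ((cotangentJ D J ξ ∘L cotangentOmega D (fundamentalForm g J) ξ) w) =
      - (cotangentJ D J ξ ∘L cotangentOmega D (fundamentalForm g J) ξ) (cotangentJ D J ξ w) := by
  simp only [ContinuousLinearMap.comp_apply]
  rw [h.cotangentJ_cotangentOmega, ContinuousLinearMap.map_neg]

theorem isParaComplexStructure_cotangentJ_comp_cotangentOmega [Nontrivial E] :
    IsParaComplexStructure fun ξ : CotangentBundle E M ↦
      cotangentJ D J ξ ∘L cotangentOmega D (fundamentalForm g J) ξ where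
  toIsAlmostParaComplex :=
    isAlmostParaComplex_of_anticommute h.isSmooth_cotangentJ_comp_cotangentOmega
      h.cotangentJ_sq h.cotangentJ_comp_cotangentOmega_sq
      h.cotangentJ_cotangentJ_comp_cotangentOmega
  integrable_plus := by
    refine isIntegrableDistribution_cotangent fun p ↦ ?_
    obtain ⟨e, Ω, hp, he⟩ := h.exists_isSpecialChart p
    refine ⟨e, Ω, fun z ↦ -chartEnd e J z, hp, he.toIsSmoothChart, he.contDiffOn_complex.neg,
      fun z hz u v ↦ ?_, fun ξ hξ w ↦ ?_⟩
    · rw [fderiv_fun_neg]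
      exact congrArg Neg.neg (he.fderiv_complex_symm z hz u v)
    · rw [mem_plusDistribution_iff,
        ← (he.isSmoothChart_cotangent.isInvertible hξ).injective.eq_iff]
      refine Iff.trans (Eq.congr_left (he.mvfderiv_cotangentJ_cotangentOmega hξ w)) ?_
      exact (he.isLinearKahler _ (e.map_source hξ)).linearJ_linearOmega_eq_iff _
  integrable_minus := by
    refine isIntegrableDistribution_cotangent fun p ↦ ?_
    obtain ⟨e, Ω, hp, he⟩ := h.exists_isSpecialChart p
    refine ⟨e, Ω, chartEnd e J, hp, he.toIsSmoothChart, he.contDiffOn_complex,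
      he.fderiv_complex_symm, fun ξ hξ w ↦ ?_⟩
    rw [mem_minusDistribution_iff, ← (he.isSmoothChart_cotangent.isInvertible hξ).injective.eq_iff,
      ContinuousLinearMap.map_neg]
    refine Iff.trans (Eq.congr_left (he.mvfderiv_cotangentJ_cotangentOmega hξ w)) ?_
    exact (he.isLinearKahler _ (e.map_source hξ)).linearJ_linearOmega_eq_neg_iff _

theorem isCanonicalComplexStructure_cotangentJ :
    IsCanonicalComplexStructure J (cotangentJ D J) := by
  intro e j he ξ hξ w
  obtain ⟨Γ, -, hΓ⟩ := exists_isChristoffel h.smooth_connection he.isSmoothChart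
  exact hΓ.mvfderiv_cotangentJ he.isSmoothChart hξ (he.mfderiv_comp _ hξ)
    (fun u v ↦ hΓ.apply_complex he h.torsion_free h.symmetric (e.map_source hξ) u v) w

theorem isCanonicalComplexStructure_iff
    (JN : EndField (cotangentModel E) (CotangentBundle E M)) :
    IsCanonicalComplexStructure J JN ↔ JN = cotangentJ D J := by
  refine ⟨fun hJN ↦ ?_, fun hJN ↦ hJN ▸ h.isCanonicalComplexStructure_cotangentJ⟩
  funext ξ
  ext1 w
  obtain ⟨e, j, hξ, he⟩ := h.complex.exists_chart ξ.proj
  exact he.isSmoothChart.isSmoothChart_cotangent.mvfderiv_injective hξ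
    ((hJN e j he ξ hξ w).trans (h.isCanonicalComplexStructure_cotangentJ e j he ξ hξ w).symm)

theorem isComplexStructure_cotangentJ : IsComplexStructure (cotangentJ D J) where
  smooth := h.isSmooth_cotangentJ
  sq := h.cotangentJ_sq
  exists_chart ξ := by
    obtain ⟨e, j, hξ, he⟩ := h.complex.exists_chart ξ.proj
    have hs := he.isSmoothChart.isSmoothChart_cotangent
    refine ⟨he.isSmoothChart.cotangent, linearJ j, hξ, hs.contMDiffOn, hs.contMDiffOn_symm,
      fun y ↦ ?_, fun η hη w ↦ h.isCanonicalComplexStructure_cotangentJ e j he η hη w⟩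
    refine Prod.ext (he.sq _) ?_
    ext v
    simp [linearJ_apply, he.sq]

theorem isParaHyperKahler_cotangent [Nontrivial E] :
    IsParaHyperKahler (cotangentJ D J) (cotangentOmega D (fundamentalForm g J))
      (fun ξ ↦ cotangentJ D J ξ ∘L cotangentOmega D (fundamentalForm g J) ξ)
      (cotangentMetric D g) where
  eq_comp _ _ := rfl
  anticomm₁₂ := h.cotangentJ_cotangentOmega
  anticomm₁₃ := h.cotangentJ_cotangentJ_comp_cotangentOmega
  anticomm₂₃ ξ w := by
    simp only [ContinuousLinearMap.comp_apply]
    rw [h.cotangentJ_cotangentOmega ξ (cotangentOmega D (fundamentalForm g J) ξ w), neg_neg]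
  types := Or.inl ⟨h.isComplexStructure_cotangentJ, h.isParaComplexStructure_cotangentOmega,
    h.isParaComplexStructure_cotangentJ_comp_cotangentOmega⟩
  metric := h.isPseudoRiemannian_cotangentMetric
  skew₁ := h.isSkew_cotangentJ
  skew₂ := h.isSkew_cotangentOmega
  skew₃ ξ w w' := by
    simp only [ContinuousLinearMap.comp_apply]
    rw [h.isSkew_cotangentJ, h.isSkew_cotangentOmega, neg_neg, h.cotangentJ_cotangentOmega,
      ContinuousLinearMap.map_neg, neg_neg]
  closed₁ := h.isClosedForm_cotangentJ
  closed₂ := h.isClosedForm_cotangentOmega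
  closed₃ := h.isClosedForm_cotangentJ_comp_cotangentOmega

end IsSpecialPseudoKahler

end ParaHyperKahler

theorem theorem3 {E : Type*} [NormedAddCommGroup E] [NormedSpace ℝ E] [FiniteDimensional ℝ E]
    [Nontrivial E] {M : Type*} [TopologicalSpace M] [T2Space M] [ChartedSpace E M]
    [IsManifold 𝓘(ℝ, E) ∞ M]
    (J : EndField 𝓘(ℝ, E) M) (g : BilinField 𝓘(ℝ, E) M)
    (D : CovariantDerivative 𝓘(ℝ, E) E (TangentSpace 𝓘(ℝ, E) : M → Type _))
    (h : IsSpecialPseudoKahler J g D)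
    (J₁ J₂ J₃ : EndField (cotangentModel E) (CotangentBundle E M))
    (hJ₁ : J₁ = cotangentJ D J)
    (hJ₂ : J₂ = cotangentOmega D (fundamentalForm g J))
    (hJ₃ : J₃ = fun ξ ↦ J₁ ξ ∘L J₂ ξ) :
    IsParaHyperKahler J₁ J₂ J₃ (cotangentMetric D g) ∧
    IsComplexStructure J₁ ∧ IsParaComplexStructure J₂ ∧ IsParaComplexStructure J₃ ∧
    (∀ JN : EndField (cotangentModel E) (CotangentBundle E M),
      IsCanonicalComplexStructure J JN ↔ JN = J₁) := by
  subst hJ₁ hJ₂ hJ₃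
  exact ⟨h.isParaHyperKahler_cotangent, h.isComplexStructure_cotangentJ,
    h.isParaComplexStructure_cotangentOmega,
    h.isParaComplexStructure_cotangentJ_comp_cotangentOmega, h.isCanonicalComplexStructure_iff⟩
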